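/- Let $\Phi\subset\mathfrak h^*$ be an irreducible reduced crystallographic root system over $\mathbb C$ (the root system of a simple, simply connected complex algebraic group), with simple roots $\{\alpha_i\}_{i\in I}$, highest root $\theta$, Weyl group $W$, coroot lattice $Q^\vee$, coweight lattice $P^\vee$ and fundamental coweights $\{\varpi_i^\vee\}_{i\in I}$; put $\varpi_0^\vee=0$, $\alpha_0=-\theta$. Let $W_{\mathrm{af}}=Q^\vee\rtimes W\subset\widetilde W_{\mathrm{af}}=P^\vee\rtimes W$, with translations $t_\lambda$, simple reflections $s_i$ ($i\in I$) and $s_0=t_{\theta^\vee}s_\theta$, and Coxeter length $\ell$ on $W_{\mathrm{af}}$. A node $s\in I_{\mathrm{af}}=I\cup\{0\}$ is special if it is the image of $0$ under an automorphism of the affine Dynkin diagram. For $s$ special let $u_s\in W$ be the shortest element with $u_s^{-1}(\varpi_s^\vee)$ anti-dominant, and $\pi_s=t_{\varpi_s^\vee}u_s$. Put $\Sigma=\{\pi_s\}$, so that $\widetilde W_{\mathrm{af}}=\Sigma\ltimes W_{\mathrm{af}}$, and $\ell(\sigma w)=\ell(w)$ for $\sigma\in\Sigma$, $w\in W_{\mathrm{af}}$.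 Let $W_{\mathrm{af}}^0$ (resp. $\widetilde W_{\mathrm{af}}^0$) be the set of $w\in W_{\mathrm{af}}$ (resp. $\widetilde W_{\mathrm{af}}$) of minimal length in $wW$. Let $S=\mathrm{Sym}(\mathfrak h^*)$ and $S^{\mathrm{reg}}=S[\alpha^{-1}:\alpha\in\Phi]$. Let $S^{\mathrm{reg}}[\widetilde W_{\mathrm{af}}]$ be the twisted group algebra for the level zero action (translations act trivially on $S^{\mathrm{reg}}$), with $(f\otimes v)(g\otimes w)=f\,v(g)\otimes vw$. Put $A_i=\alpha_i^{-1}(1-s_i)$ for $i\in I_{\mathrm{af}}$, $A_w=A_{i_1}\cdots A_{i_l}$ for a reduced expression $w=s_{i_1}\cdots s_{i_l}$ in $W_{\mathrm{af}}$, and $A_{\pi w}=\pi A_w$ for $\pi\in\Sigma$, $w\in W_{\mathrm{af}}$. The extended Peterson algebra $\widetilde{\mathbb P}$ is the centralizer of $S$ in $\widetilde{\mathbb A}=\sum_{w\in\widetilde W_{\mathrm{af}}}S A_w$. For $w\in\widetilde W_{\mathrm{af}}^0$, let $j_w$ be the unique element of $\widetilde{\mathbb P}$ of the form $A_w+\sum_{v\in\widetilde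 W_{\mathrm{af}}\setminus\widetilde W_{\mathrm{af}}^0}j_w^v A_v$ with $j_w^v\in S$. For $u\in W$ write $u(a)=u\,a\,u^{-1}$. For $i\in I$ let $i^s$ be the unique special node with $\varpi_i^\vee+Q^\vee=\varpi_{i^s}^\vee+Q^\vee$, and define $\kappa_i\in W_{\mathrm{af}}^0$ by $t_{-\varpi_i^\vee}=\pi_{i^s}^{-1}\kappa_i$. **Theorem.** The objects $i^s$, $u_{i^s}$, $\kappa_i$ and $j_w$ ($w\in\widetilde W_{\mathrm{af}}^0$) above are well defined: the special node $i^s$, the shortest element $u_{i^s}$ and the elements $j_w$ exist and are unique, and $\pi_{i^s}t_{-\varpi_i^\vee}\in W_{\mathrm{af}}^0$. Moreover, let $i\in I$ and let $v\in W_{\mathrm{af}}$ be such that $v\kappa_i\in W_{\mathrm{af}}^0$ and $\ell(v\kappa_i)=\ell(v)+\ell(\kappa_i)$. Then $\bar v:=\pi_{i^s}^{-1}v\,\pi_{i^s}\in W_{\mathrm{af}}^0$ and $$j_{v\kappa_i}=u_{i^s}(j_{\bar v})\,j_{\kappa_i}.$$ -/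

import Mathlib

noncomputable section

namespace AffineNilHecke

/-! Throughout, `P` is a root system with root space `M = 𝔥*` and coroot space `N = 𝔥`. -/

section Lattices

variable {ι M N : Type*} [AddCommGroup M] [Module ℂ M] [AddCommGroup N] [Module ℂ N]
  (P : RootPairing ι ℂ M N)

/-- The coweight lattice `P^∨ ⊆ 𝔥`: the elements pairing integrally with all roots. -/
def coweightLattice : AddSubgroup N where
  carrier := {h | ∀ j, ∃ n : ℤ, P.toLinearMap (P.root j) h = n}
  zero_mem' := fun _ => ⟨0, by simp⟩
  add_mem' := by
    intro x y hx hy j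
    obtain ⟨m, hm⟩ := hx j
    obtain ⟨n, hn⟩ := hy j
    exact ⟨m + n, by simp [hm, hn]⟩
  neg_mem' := by
    intro x hx j
    obtain ⟨m, hm⟩ := hx j
    exact ⟨-m, by simp [hm]⟩

/-- The coroot lattice `Q^∨ ⊆ 𝔥`. -/
def corootLattice : AddSubgroup N := AddSubgroup.closure (Set.range P.coroot)

lemma coroot_mem_coweightLattice [P.IsCrystallographic] (j : ι) :
    P.coroot j ∈ coweightLattice P := fun k => by
  obtain ⟨n, hn⟩ := P.exists_value (S := ℤ) k j
  exact ⟨n, by simpa using hn.symm⟩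

/-- The action of the Weyl group on `𝔥`, dual to its action on `𝔥*`. -/
def coAct (w : P.weylGroup) : N →+ N :=
  DistribSMul.toAddMonoidHom N (MulOpposite.op ((w⁻¹ : P.weylGroup) : P.Aut))

lemma coAct_apply (w : P.weylGroup) (h : N) :
    coAct P w h = RootPairing.Equiv.coweightEquiv P P ((w : P.Aut)⁻¹) h := rfl

lemma coAct_one (h : N) : coAct P 1 h = h := by
  simp [coAct]

lemma coAct_mul (v w : P.weylGroup) (h : N) :
    coAct P (v * w) h = coAct P v (coAct P w h) := by
  rw [coAct_apply, coAct_apply, coAct_apply, Subgroup.coe_mul, mul_inv_rev]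
  rfl

lemma pairing_coAct (w : P.weylGroup) (x : M) (h : N) :
    P.toLinearMap x (coAct P w h) = P.toLinearMap (w⁻¹ • x) h :=
  (LinearMap.congr_fun (LinearMap.congr_fun
    ((w : P.Aut)⁻¹).weight_coweight_transpose h) x).symm

lemma coAct_mem_coweightLattice (w : P.weylGroup) {h : N} (hh : h ∈ coweightLattice P) :
    coAct P w h ∈ coweightLattice P := fun j => by
  rw [pairing_coAct, RootPairing.weylGroup_apply_root]
  exact hh _

lemma coAct_coroot (w : P.weylGroup) (j : ι) :
    ∃ k, coAct P w (P.coroot j) = P.coroot k :=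
  ⟨_, congr_fun ((w : P.Aut)⁻¹).coroot_coweightMap j⟩

lemma coAct_mem_corootLattice (w : P.weylGroup) {h : N} (hh : h ∈ corootLattice P) :
    coAct P w h ∈ corootLattice P := by
  induction hh using AddSubgroup.closure_induction with
  | mem x hx =>
    obtain ⟨j, rfl⟩ := hx
    obtain ⟨k, hk⟩ := coAct_coroot P w j
    rw [hk]
    exact AddSubgroup.subset_closure ⟨k, rfl⟩
  | zero => rw [map_zero]; exact zero_mem _
  | add x y _ _ hx hy => rw [map_add]; exact add_mem hx hy
  | neg x _ hx => rw [map_neg]; exact neg_mem hx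

/-- The action of the Weyl group on the coweight lattice, written multiplicatively. -/
def coweightAction : P.weylGroup →* MulAut (Multiplicative (coweightLattice P)) where
  toFun w :=
    { toFun := fun t => Multiplicative.ofAdd
        ⟨coAct P w t.toAdd, coAct_mem_coweightLattice P w t.toAdd.2⟩
      invFun := fun t => Multiplicative.ofAdd
        ⟨coAct P w⁻¹ t.toAdd, coAct_mem_coweightLattice P w⁻¹ t.toAdd.2⟩
      left_inv := fun t => by
        apply Multiplicative.toAdd.injective
        apply Subtype.ext
        simp [← coAct_mul, coAct_one]
      right_inv := fun t => by
        apply Multiplicative.toAdd.injective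
        apply Subtype.ext
        simp [← coAct_mul, coAct_one]
      map_mul' := fun s t => by
        apply Multiplicative.toAdd.injective
        apply Subtype.ext
        simp }
  map_one' := by
    ext t
    simp [coAct_one]
  map_mul' v w := by
    ext t
    simp [coAct_mul]

lemma coweightAction_apply (w : P.weylGroup) (t : Multiplicative (coweightLattice P)) :
    ((coweightAction P w t).toAdd : N) = coAct P w t.toAdd := rfl

/-- The extended affine Weyl group `P^∨ ⋊ W`. -/
abbrev ExtWeyl : Type _ := Multiplicative (coweightLattice P) ⋊[coweightAction P] P.weylGroup

/-- The translation element `t_μ`, for `μ` in the coweight lattice. -/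
def translation (μ : coweightLattice P) : ExtWeyl P :=
  SemidirectProduct.inl (Multiplicative.ofAdd μ)

/-- The inclusion of the finite Weyl group. -/
def ofWeyl : P.weylGroup →* ExtWeyl P := SemidirectProduct.inr

/-- The affine Weyl group `Q^∨ ⋊ W`, as a subgroup of `P^∨ ⋊ W`. -/
def affineWeyl : Subgroup (ExtWeyl P) where
  carrier := {x | (x.left.toAdd : N) ∈ corootLattice P}
  one_mem' := zero_mem (corootLattice P)
  mul_mem' := by
    intro x y hx hy
    exact add_mem (S := AddSubgroup N) hx (coAct_mem_corootLattice P x.right hy)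
  inv_mem' := by
    intro x hx
    exact coAct_mem_corootLattice P x.right⁻¹ (neg_mem (S := AddSubgroup N) hx)

end Lattices

section NilHeckeRing

variable {ι M N : Type*} [AddCommGroup M] [Module ℂ M] [AddCommGroup N] [Module ℂ N]
  (P : RootPairing ι ℂ M N)

/-- `S = Sym(𝔥*)`, the equivariant cohomology ring of a point. -/
abbrev SRing (_ : RootPairing ι ℂ M N) : Type _ := SymmetricAlgebra ℂ M

/-- The root `α_j` as an element of `S`. -/
def rootS (j : ι) : SRing P := SymmetricAlgebra.ι ℂ M (P.root j)

/-- The multiplicative set generated by the roots. -/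
def rootMonoid : Submonoid (SRing P) := Submonoid.closure (Set.range (rootS P))

/-- `S^reg`, the localization of `S` at all roots. -/
def SReg : Type _ := Localization (rootMonoid P)

instance : CommRing (SReg P) := inferInstanceAs (CommRing (Localization (rootMonoid P)))

instance : Algebra (SRing P) (SReg P) :=
  inferInstanceAs (Algebra (SRing P) (Localization (rootMonoid P)))

instance : IsLocalization (rootMonoid P) (SReg P) :=
  inferInstanceAs (IsLocalization (rootMonoid P) (Localization (rootMonoid P)))

/-- The automorphism of `S` induced by a Weyl group element. -/
def symAct (w : P.weylGroup) : SRing P →ₐ[ℂ] SRing P :=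
  SymmetricAlgebra.lift
    (SymmetricAlgebra.ι ℂ M ∘ₗ (RootPairing.Equiv.weightEquiv P P (w : P.Aut)).toLinearMap)

lemma symAct_ι (w : P.weylGroup) (x : M) :
    symAct P w (SymmetricAlgebra.ι ℂ M x) = SymmetricAlgebra.ι ℂ M (w • x) := by
  rw [symAct, SymmetricAlgebra.lift_ι_apply]
  rfl

lemma symAct_one : symAct P 1 = AlgHom.id ℂ _ := by
  apply SymmetricAlgebra.algHom_ext
  ext x
  simp [symAct_ι]

lemma symAct_mul (v w : P.weylGroup) :
    symAct P (v * w) = (symAct P v).comp (symAct P w) := by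
  apply SymmetricAlgebra.algHom_ext
  ext x
  simp [symAct_ι, mul_smul]

lemma rootMonoid_le_comap (w : P.weylGroup) :
    rootMonoid P ≤ (rootMonoid P).comap (symAct P w : SRing P →+* SRing P) := by
  rw [rootMonoid, Submonoid.closure_le]
  rintro _ ⟨j, rfl⟩
  refine Submonoid.subset_closure ⟨P.weylGroupToPerm w j, ?_⟩
  rw [rootS, rootS, ← RootPairing.weylGroup_apply_root]
  exact (symAct_ι P w _).symm

/-- The automorphism of `S^reg` induced by a Weyl group element. -/
def regAct (w : P.weylGroup) : SReg P →+* SReg P :=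
  IsLocalization.map (SReg P) (symAct P w : SRing P →+* SRing P) (rootMonoid_le_comap P w)

lemma regAct_algebraMap (w : P.weylGroup) (f : SRing P) :
    regAct P w (algebraMap (SRing P) (SReg P) f) = algebraMap _ _ (symAct P w f) :=
  IsLocalization.map_eq _ _

lemma regAct_one : regAct P 1 = RingHom.id _ := by
  apply IsLocalization.ringHom_ext (rootMonoid P)
  ext f
  simp [regAct_algebraMap, symAct_one]

lemma regAct_mul (v w : P.weylGroup) :
    regAct P (v * w) = (regAct P v).comp (regAct P w) := by
  apply IsLocalization.ringHom_ext (rootMonoid P)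
  ext f
  simp [regAct_algebraMap, symAct_mul]

/-- The level zero action of the extended affine Weyl group on `S^reg`: translations act
trivially. -/
instance levelZeroAction : MulSemiringAction (ExtWeyl P) (SReg P) where
  smul x f := regAct P x.right f
  one_smul f := by
    change regAct P 1 f = f
    rw [regAct_one]; rfl
  mul_smul x y f := by
    change regAct P (x.right * y.right) f = regAct P x.right (regAct P y.right f)
    rw [regAct_mul]; rfl
  smul_zero x := map_zero (regAct P x.right)
  smul_add x := map_add (regAct P x.right)
  smul_one x := map_one (regAct P x.right)
  smul_mul x := map_mul (regAct P x.right)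

/-- The twisted group algebra `S^reg[P^∨ ⋊ W]`, with product
`(f ⊗ v) (g ⊗ w) = f v(g) ⊗ vw`. -/
abbrev TwistedAlg : Type _ := SkewMonoidAlgebra (SReg P) (ExtWeyl P)

/-- The group element `x` in the twisted group algebra. -/
def grp (x : ExtWeyl P) : TwistedAlg P := SkewMonoidAlgebra.single x 1

/-- The scalar `f` in the twisted group algebra. -/
def scalar (f : SReg P) : TwistedAlg P := SkewMonoidAlgebra.single 1 f

/-- The inverse of a root in `S^reg`. -/
def rootInv (j : ι) : SReg P :=
  IsLocalization.mk' (SReg P) (1 : SRing P)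
    (⟨rootS P j, Submonoid.subset_closure ⟨j, rfl⟩⟩ : rootMonoid P)

/-- The action of a finite Weyl group element on `S^reg[P^∨ ⋊ W]` by conjugation,
`u(a) = u a u⁻¹`. -/
def conj (u : P.weylGroup) (a : TwistedAlg P) : TwistedAlg P :=
  grp P (ofWeyl P u) * a * grp P (ofWeyl P u)⁻¹

end NilHeckeRing

lemma nonempty_index {ι M N : Type*} [AddCommGroup M] [Module ℂ M] [AddCommGroup N] [Module ℂ N]
    (P : RootPairing ι ℂ M N) [P.IsRootSystem] [P.IsIrreducible] : Nonempty ι := by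
  by_contra h
  rw [not_nonempty_iff] at h
  have h1 := RootPairing.IsRootSystem.span_root_eq_top (P := P)
  have h2 := RootPairing.IsIrreducible.nontrivial (P := P)
  rw [Set.range_eq_empty, Submodule.span_empty] at h1
  exact bot_ne_top h1

section Based

variable {ι M N : Type*} [AddCommGroup M] [Module ℂ M] [AddCommGroup N] [Module ℂ N]
  {P : RootPairing ι ℂ M N} [P.IsRootSystem] (b : P.Base)

/-- The fundamental coweight `ϖ_j^∨ ∈ 𝔥`, `j ∈ I`, dual to the simple roots. -/
def fundCoweightN (j : b.support) : N := P.flip.toPerfPair.symm (b.toWeightBasis.coord j)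

lemma fundCoweightN_mem (j : b.support) : fundCoweightN b j ∈ coweightLattice P := fun k => by
  have key : ∀ x : M, P.toLinearMap x (fundCoweightN b j) = b.toWeightBasis.coord j x := fun x =>
    LinearMap.congr_fun (P.flip.toPerfPair.apply_symm_apply (b.toWeightBasis.coord j)) x
  simp only [key]
  have hk := b.root_mem_span_int k
  generalize P.root k = y at hk
  induction hk using Submodule.span_induction with
  | mem x hx =>
    obtain ⟨l, hl, rfl⟩ := hx
    classical
    refine ⟨if (⟨l, hl⟩ : b.support) = j then 1 else 0, ?_⟩
    rw [Module.Basis.coord_apply, b.toWeightBasis_repr_root ⟨l, hl⟩, Finsupp.single_apply]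
    split_ifs <;> simp
  | zero => exact ⟨0, by simp⟩
  | add x y _ _ hx hy =>
    obtain ⟨m, hm⟩ := hx
    obtain ⟨n, hn⟩ := hy
    exact ⟨m + n, by rw [map_add, hm, hn]; push_cast; rfl⟩
  | smul a x _ hx =>
    obtain ⟨m, hm⟩ := hx
    exact ⟨a * m, by rw [map_zsmul, hm]; simp⟩

variable [Finite ι] [P.IsIrreducible]

lemma exists_highestRoot : ∃ j : ι, ∀ k, b.height k ≤ b.height j :=
  haveI := nonempty_index P
  Finite.exists_max _

/-- (The index of) the highest root `θ`, the root of maximal height. -/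
def highestRoot : ι := (exists_highestRoot b).choose

variable [P.IsCrystallographic]

/-- The set `I_af = I ∪ {0}` of affine Dynkin nodes; the node `0` is `none`. -/
abbrev AffineNode (b : P.Base) : Type _ := Option b.support

/-- (The index of) the classical projection of the simple affine root attached to a node:
`α_j` for `j ∈ I`, and `α_0 = -θ`. -/
def nodeRoot : AffineNode b → ι
  | some j => j
  | none => P.reflectionPerm (highestRoot b) (highestRoot b)

/-- The simple reflections: `s_j ∈ W` for `j ∈ I` and `s_0 = t_{θ^∨} s_θ`. -/
def simpleReflection : AffineNode b → ExtWeyl P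
  | some j => ofWeyl P (RootPairing.weylGroup.ofIdx P j)
  | none => translation P ⟨P.coroot (highestRoot b), coroot_mem_coweightLattice P _⟩ *
      ofWeyl P (RootPairing.weylGroup.ofIdx P (highestRoot b))

/-- The automorphisms of the affine Dynkin diagram: permutations of the nodes that preserve the
affine Cartan matrix. -/
def IsDiagramAut (σ : Equiv.Perm (AffineNode b)) : Prop :=
  ∀ j k, P.pairing (nodeRoot b (σ j)) (nodeRoot b (σ k)) = P.pairing (nodeRoot b j) (nodeRoot b k)

/-- The special nodes: the images of `0` under diagram automorphisms. -/
def IsSpecial (s : AffineNode b) : Prop := ∃ σ, IsDiagramAut b σ ∧ σ none = s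

/-- The fundamental coweight `ϖ_s^∨` attached to an affine node, where `ϖ_0^∨ = 0`. -/
def fundCoweight : AffineNode b → coweightLattice P
  | some j => ⟨fundCoweightN b j, fundCoweightN_mem b j⟩
  | none => 0

/-- `s` is the special node `i^s` attached to `i ∈ I`: `ϖ_i^∨ + Q^∨ = ϖ_s^∨ + Q^∨`. -/
def IsSpecialFor (i : b.support) (s : AffineNode b) : Prop :=
  IsSpecial b s ∧
    ((fundCoweight b (some i) : N) - (fundCoweight b s : N)) ∈ corootLattice P

/-- The special node `i^s`. -/
def specialNode (i : b.support) : AffineNode b := Classical.epsilon (IsSpecialFor b i)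

/-- The length function of the finite Weyl group. -/
def weylLength (w : P.weylGroup) : ℕ :=
  sInf {n | ∃ l : List b.support,
    l.length = n ∧ (l.map fun j => RootPairing.weylGroup.ofIdx P (j : ι)).prod = w}

/-- Anti-dominance of an element of `𝔥` in the coweight lattice. -/
def IsAntidominant (h : N) : Prop :=
  ∀ j : b.support, ∃ n : ℕ, P.toLinearMap (P.root j) h = -(n : ℂ)

/-- `u` is the shortest element of `W` such that `u⁻¹ ϖ_s^∨` is anti-dominant. -/
def IsShortestAntidominant (s : AffineNode b) (u : P.weylGroup) : Prop :=
  IsAntidominant b (coAct P u⁻¹ (fundCoweight b s)) ∧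
    ∀ u' : P.weylGroup, IsAntidominant b (coAct P u'⁻¹ (fundCoweight b s)) →
      weylLength b u ≤ weylLength b u'

/-- The element `u_s ∈ W`. -/
def uElt (s : AffineNode b) : P.weylGroup := Classical.epsilon (IsShortestAntidominant b s)

/-- The element `π_s = t_{ϖ_s^∨} u_s` of the extended affine Weyl group. -/
def piElt (s : AffineNode b) : ExtWeyl P := translation P (fundCoweight b s) * ofWeyl P (uElt b s)

/-- The group `Σ = {π_s : s special}`. -/
def sigmaSet : Set (ExtWeyl P) := {x | ∃ s, IsSpecial b s ∧ x = piElt b s}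

/-- The product of simple affine reflections along a word. -/
def wordProd (l : List (AffineNode b)) : ExtWeyl P := (l.map (simpleReflection b)).prod

/-- The (Coxeter) length function of the affine Weyl group. -/
def affLength (x : ExtWeyl P) : ℕ :=
  sInf {n | ∃ l : List (AffineNode b), l.length = n ∧ wordProd b l = x}

/-- The length function of the extended affine Weyl group: `ℓ(σ w) = ℓ(w)` for `σ ∈ Σ` and `w` in
the affine Weyl group. -/
def extLength (x : ExtWeyl P) : ℕ :=
  sInf {n | ∃ σ ∈ sigmaSet b, ∃ w ∈ affineWeyl P, x = σ * w ∧ affLength b w = n}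

/-- The affine Grassmannian elements `W_af^0` of the affine Weyl group. -/
def affGrassmannian : Set (ExtWeyl P) :=
  {x | x ∈ affineWeyl P ∧ ∀ u : P.weylGroup, affLength b x ≤ affLength b (x * ofWeyl P u)}

/-- The affine Grassmannian elements of the extended affine Weyl group. -/
def extGrassmannian : Set (ExtWeyl P) :=
  {x | ∀ u : P.weylGroup, extLength b x ≤ extLength b (x * ofWeyl P u)}

/-- The element `κ_i`, given by `t_{-ϖ_i^∨} = π_{i^s}⁻¹ κ_i`. -/
def kappa (i : b.support) : ExtWeyl P :=
  piElt b (specialNode b i) * translation P (-fundCoweight b (some i))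

/-- `A_s = α_s⁻¹ (1 - s_s)` for an affine node `s`. -/
def nilGen (s : AffineNode b) : TwistedAlg P :=
  scalar P (rootInv P (nodeRoot b s)) * (1 - grp P (simpleReflection b s))

/-- A reduced expression of an element of the affine Weyl group. -/
def reducedWord (x : ExtWeyl P) : List (AffineNode b) :=
  Classical.epsilon fun l => wordProd b l = x ∧ l.length = affLength b x

/-- `A_w` for `w` in the affine Weyl group: the product of the `A_s` along a reduced expression
of `w` (it does not depend on the reduced expression, by the braid relations). -/
def nilAff (x : ExtWeyl P) : TwistedAlg P := ((reducedWord b x).map (nilGen b)).prod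

/-- The decomposition `x = π v` with `π ∈ Σ` and `v` in the affine Weyl group. -/
def decomp (x : ExtWeyl P) : ExtWeyl P × ExtWeyl P :=
  Classical.epsilon fun p => p.1 ∈ sigmaSet b ∧ p.2 ∈ affineWeyl P ∧ x = p.1 * p.2

/-- `A_{π v} = π A_v` for `π ∈ Σ` and `v` in the affine Weyl group. -/
def nilExt (x : ExtWeyl P) : TwistedAlg P := grp P (decomp b x).1 * nilAff b (decomp b x).2

/-- The level zero extended affine nil-Hecke algebra `∑ S A_w`, a left `S`-submodule of the
twisted group algebra. -/
def nilHecke : Submodule (SRing P) (TwistedAlg P) :=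
  Submodule.span (SRing P) (Set.range (nilExt b))

/-- The extended Peterson algebra: the centralizer of `S` in the extended affine nil-Hecke
algebra. -/
def peterson : Set (TwistedAlg P) :=
  {a | a ∈ nilHecke b ∧ ∀ f : SRing P,
    a * scalar P (algebraMap (SRing P) (SReg P) f) = scalar P (algebraMap (SRing P) (SReg P) f) * a}

/-- `a` is the Schubert basis element `j_w`: it lies in the extended Peterson algebra and it is
`A_w` plus an `S`-linear combination of `A_v` with `v` not affine Grassmannian. -/
def IsSchubert (w : ExtWeyl P) (a : TwistedAlg P) : Prop :=
  a ∈ peterson b ∧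
    a - nilExt b w ∈ Submodule.span (SRing P) (nilExt b '' (extGrassmannian b)ᶜ)

/-- The Schubert basis element `j_w` of the extended Peterson algebra. -/
def jElt (w : ExtWeyl P) : TwistedAlg P := Classical.epsilon (IsSchubert b w)

/-- `v̄ = π_{i^s}⁻¹ v π_{i^s}`. -/
def bar (i : b.support) (v : ExtWeyl P) : ExtWeyl P :=
  (piElt b (specialNode b i))⁻¹ * v * piElt b (specialNode b i)

end Based

end AffineNilHecke

end

open AffineNilHecke

/-! Everything rests on one additive map: `proj` sends f ⊗ t_λ w to f ⊗ t_λ. An element commuting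
with all weights is supported on translations, because W acts faithfully on 𝔥* and S^reg is a
domain; so `proj` fixes the Peterson algebra (`proj_eq_self`). If v is not Grassmannian, then A_v =
A_y A_j for some j ∈ I, and `proj` kills every product ending in 1 - s_j. Hence j_w can only be
`proj` A_w. It exists because `proj` A_w stays in the nil-Hecke algebra and differs from A_w by an
element of the left ideal spanned by the non-Grassmannian A_v (`proj_nilProd`). The outcome is
`jElt_eq`: j_w = `proj` A_w.

For the factorization put π = π_{i^s}, u = u_{i^s}, y = t_{-ϖ_i^∨} and q = `proj` A_y. Since v κ_i =
π v̄ y and the lengths add, A_{vκ_i} = π A_v̄ A_y. For j ∈ I the projection of A_j A_y is zero: for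
j = i the product itself vanishes, and for j ≠ i it equals A_y A_j. This makes q invariant under
conjugation by W (`grp_comm_proj_nilExt_translation`), and `proj` is linear for right multiplication
by such a q (`proj_mul_of_invariant`), so `proj` (A_v̄ A_y) = j_v̄ q. Writing π = t u with t a
translation, j_{vκ_i} = π j_v̄ q u⁻¹ and j_{κ_i} = π q u⁻¹; the formula follows because u(j_v̄)
commutes with t.

The rest is Coxeter theory for the action of the extended affine Weyl group on 𝔥* ⊕ ℂδ.
`RootedGenerators` isolates what the exchange condition and Matsumoto's theorem need,
`mem_sigmaSet_iff` identifies Σ with the elements preserving positive affine roots, and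
`nilProd_braid` makes A_w independent of the reduced word. -/

set_option linter.unusedSectionVars false

namespace AffineNilHecke

/-! ### Coxeter combinatorics from signed roots: exchange, length, Matsumoto's theorem. -/

section RootedGenerators

/-- Generators `s j` of a group acting on a set of roots with simple roots `a j`, such that each
`s j` makes exactly the simple root `a j` negative. -/
structure RootedGenerators {G R J : Type*} [Group G] [MulAction G R]
    (pos : R → Prop) (a : J → R) (s : J → G) : Prop where
  sq : ∀ j, s j * s j = 1
  pos_simple : ∀ j, pos (a j)
  pos_smul_neg : ∀ (x : G) (j : J), pos (x • s j • a j) ↔ ¬ pos (x • a j)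
  pos_smul : ∀ j r, pos r → r ≠ a j → pos (s j • r)
  conj : ∀ (x : G) (j k : J), x • a j = a k → x * s j = s k * x

variable {G R J : Type*} [Group G] [MulAction G R]

/-- The product of generators along a word. -/
def genProd (s : J → G) (l : List J) : G := (l.map s).prod

/-- The word length with respect to a family of generators. -/
noncomputable def genLength (s : J → G) (x : G) : ℕ :=
  sInf {n | ∃ l : List J, l.length = n ∧ genProd s l = x}

/-- The alternating word `i j i j …` with `n` letters. -/
def altWord (i j : J) : ℕ → List J
  | 0 => []
  | n + 1 => i :: altWord j i n

@[simp] lemma length_altWord (i j : J) (n : ℕ) : (altWord i j n).length = n := by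
  induction n generalizing i j with
  | zero => rfl
  | succ n ih => simp [altWord, ih]

@[simp] lemma genProd_nil (s : J → G) : genProd s [] = 1 := rfl

@[simp] lemma genProd_cons (s : J → G) (j : J) (l : List J) :
    genProd s (j :: l) = s j * genProd s l := by simp [genProd]

@[simp] lemma genProd_append (s : J → G) (l l' : List J) :
    genProd s (l ++ l') = genProd s l * genProd s l' := by simp [genProd]

lemma genLength_le (s : J → G) (l : List J) : genLength s (genProd s l) ≤ l.length :=
  Nat.sInf_le ⟨l, rfl, rfl⟩

lemma exists_reduced (s : J → G) {x : G} (hx : ∃ l, genProd s l = x) :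
    ∃ l, genProd s l = x ∧ l.length = genLength s x := by
  obtain ⟨l, hl⟩ := hx
  obtain ⟨l', h, h'⟩ := Nat.sInf_mem (s := {n | ∃ l : List J, l.length = n ∧ genProd s l = x})
    ⟨_, l, rfl, hl⟩
  exact ⟨l', h', h⟩

lemma genLength_one (s : J → G) : genLength s 1 = 0 :=
  Nat.le_zero.1 (genLength_le s [])

lemma genLength_mul_le (s : J → G) {x y : G} (hx : ∃ l, genProd s l = x)
    (hy : ∃ l, genProd s l = y) : genLength s (x * y) ≤ genLength s x + genLength s y := by
  obtain ⟨l, rfl, hl⟩ := exists_reduced s hx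
  obtain ⟨l', rfl, hl'⟩ := exists_reduced s hy
  rw [← hl, ← hl', ← genProd_append, ← List.length_append]
  exact genLength_le s _

lemma isReduced_append_left {s : J → G} {l l' : List J}
    (h : genLength s (genProd s (l ++ l')) = (l ++ l').length) :
    genLength s (genProd s l) = l.length := by
  have h1 := genLength_le s l
  have h2 := genLength_le s l'
  have h3 := genLength_mul_le s ⟨l, rfl⟩ ⟨l', rfl⟩
  rw [← genProd_append, h, List.length_append] at h3
  omega

lemma isReduced_append_right {s : J → G} {l l' : List J}
    (h : genLength s (genProd s (l ++ l')) = (l ++ l').length) :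
    genLength s (genProd s l') = l'.length := by
  have h1 := genLength_le s l
  have h2 := genLength_le s l'
  have h3 := genLength_mul_le s ⟨l, rfl⟩ ⟨l', rfl⟩
  rw [← genProd_append, h, List.length_append] at h3
  omega

namespace RootedGenerators

variable {pos : R → Prop} {a : J → R} {s : J → G} (h : RootedGenerators pos a s)
include h

lemma inv (j : J) : (s j)⁻¹ = s j := inv_eq_of_mul_eq_one_right (h.sq j)

lemma mul_cancel (j : J) (x : G) : s j * (s j * x) = x := by rw [← mul_assoc, h.sq, one_mul]

lemma mul_cancel_right (j : J) (x : G) : x * s j * s j = x := by rw [mul_assoc, h.sq, mul_one]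

lemma genProd_reverse (l : List J) : genProd s l.reverse = (genProd s l)⁻¹ := by
  induction l with
  | nil => simp
  | cons j l ih => simp [ih, h.inv]

lemma eq_simple {j : J} {r : R} (hr : pos r) (hn : ¬ pos (s j • r)) : r = a j := by
  by_contra hc
  exact hn (h.pos_smul j r hr hc)

lemma pos_mul_simple (x : G) (j : J) : pos ((x * s j) • a j) ↔ ¬ pos (x • a j) := by
  rw [mul_smul, h.pos_smul_neg]

/-- Apply the letters to the positive root a j, starting from the right. The letter k that first
makes it negative meets the root a k itself, so `conj` carries s j through the suffix, where it
cancels k. -/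
lemma exchange_right (l : List J) (j : J) (hn : ¬ pos (genProd s l • a j)) :
    ∃ l₁ k l₂, l = l₁ ++ k :: l₂ ∧ genProd s l * s j = genProd s (l₁ ++ l₂) := by
  induction l with
  | nil => simp [h.pos_simple] at hn
  | cons k l ih =>
    by_cases hp : pos (genProd s l • a j)
    · rw [genProd_cons, mul_smul] at hn
      have h2 := h.conj _ _ _ (h.eq_simple hp hn)
      exact ⟨[], k, l, rfl, by rw [genProd_cons, mul_assoc, h2, h.mul_cancel]; rfl⟩
    · obtain ⟨l₁, p, l₂, rfl, h2⟩ := ih hp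
      exact ⟨k :: l₁, p, l₂, rfl, by rw [genProd_cons, mul_assoc, h2]; simp⟩

lemma exchange_left (l : List J) (j : J) (hn : ¬ pos ((genProd s l)⁻¹ • a j)) :
    ∃ l₁ k l₂, l = l₁ ++ k :: l₂ ∧ s j * genProd s l = genProd s (l₁ ++ l₂) := by
  rw [← h.genProd_reverse] at hn
  obtain ⟨l₁, k, l₂, h1, h2⟩ := h.exchange_right _ _ hn
  refine ⟨l₂.reverse, k, l₁.reverse, ?_, ?_⟩
  · rw [← l.reverse_reverse, h1]; simp
  · rw [← inv_inj, mul_inv_rev, h.inv, ← h.genProd_reverse, h2, ← h.genProd_reverse]; simp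

lemma isGen_inv {x : G} (hx : ∃ l, genProd s l = x) : ∃ l, genProd s l = x⁻¹ := by
  obtain ⟨l, rfl⟩ := hx
  exact ⟨l.reverse, h.genProd_reverse l⟩

omit h in
lemma isGen_mul {x y : G} (hx : ∃ l, genProd s l = x) (hy : ∃ l, genProd s l = y) :
    ∃ l, genProd s l = x * y := by
  obtain ⟨l, rfl⟩ := hx
  obtain ⟨l', rfl⟩ := hy
  exact ⟨l ++ l', by simp⟩

omit h in
lemma isGen_simple (j : J) : ∃ l, genProd s l = s j := ⟨[j], by simp⟩

lemma genLength_inv {x : G} (hx : ∃ l, genProd s l = x) : genLength s x⁻¹ = genLength s x := by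
  have key : ∀ y : G, (∃ l, genProd s l = y) → genLength s y⁻¹ ≤ genLength s y := by
    intro y hy
    obtain ⟨l, rfl, hl⟩ := exists_reduced s hy
    rw [← hl, ← h.genProd_reverse, ← l.length_reverse]
    exact genLength_le s _
  refine le_antisymm (key x hx) ?_
  simpa using key x⁻¹ (h.isGen_inv hx)

lemma genLength_mul_of_not_pos {x : G} (hx : ∃ l, genProd s l = x) {j : J}
    (hn : ¬ pos (x • a j)) : genLength s (x * s j) + 1 = genLength s x := by
  obtain ⟨l, rfl, hl⟩ := exists_reduced s hx
  obtain ⟨l₁, k, l₂, h1, h2⟩ := h.exchange_right l j hn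
  have h3 := genLength_le s (l₁ ++ l₂)
  have h4 := genLength_mul_le s (isGen_mul hx (isGen_simple j)) (isGen_simple (s := s) j)
  rw [h.mul_cancel_right] at h4
  have h5 := genLength_le s [j]
  simp only [genProd_cons, genProd_nil, mul_one, List.length_singleton] at h5
  have h6 : l.length = (l₁ ++ l₂).length + 1 := by rw [h1]; simp; omega
  rw [h2] at h4 ⊢
  omega

lemma genLength_mul_of_pos {x : G} (hx : ∃ l, genProd s l = x) {j : J}
    (hp : pos (x • a j)) : genLength s (x * s j) = genLength s x + 1 := by
  have := h.genLength_mul_of_not_pos (isGen_mul hx (isGen_simple j)) (j := j)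
    (by rw [h.pos_mul_simple]; exact fun h => h hp)
  rw [h.mul_cancel_right] at this
  exact this.symm

lemma genLength_simple_mul {x : G} (hx : ∃ l, genProd s l = x) (j : J) :
    genLength s (s j * x) = genLength s (x⁻¹ * s j) := by
  rw [← h.genLength_inv (isGen_mul (isGen_simple j) hx), mul_inv_rev, h.inv]

lemma genLength_simple_mul_of_not_pos {x : G} (hx : ∃ l, genProd s l = x) {j : J}
    (hn : ¬ pos (x⁻¹ • a j)) : genLength s (s j * x) + 1 = genLength s x := by
  rw [h.genLength_simple_mul hx, h.genLength_mul_of_not_pos (h.isGen_inv hx) hn, h.genLength_inv hx]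

lemma genLength_simple_mul_of_pos {x : G} (hx : ∃ l, genProd s l = x) {j : J}
    (hp : pos (x⁻¹ • a j)) : genLength s (s j * x) = genLength s x + 1 := by
  rw [h.genLength_simple_mul hx, h.genLength_mul_of_pos (h.isGen_inv hx) hp, h.genLength_inv hx]

/-- A nontrivial element has a right descent. -/
lemma exists_descent {x : G} (hx : ∃ l, genProd s l = x) (h1 : x ≠ 1) :
    ∃ j, ¬ pos (x • a j) := by
  obtain ⟨l, rfl, hl⟩ := exists_reduced s hx
  rcases List.eq_nil_or_concat l with rfl | ⟨l', j, rfl⟩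
  · exact absurd rfl h1
  · refine ⟨j, fun hp => ?_⟩
    have h2 := h.genLength_mul_of_pos hx hp
    have h3 := genLength_le s l'
    rw [← hl] at h2
    simp only [List.concat_eq_append, genProd_append, genProd_cons, genProd_nil, mul_one,
      h.mul_cancel_right, List.length_append, List.length_singleton] at h2
    omega

lemma eq_one_of_forall_pos {x : G} (hx : ∃ l, genProd s l = x) (hp : ∀ j, pos (x • a j)) :
    x = 1 := by
  by_contra hc
  obtain ⟨j, hj⟩ := h.exists_descent hx hc
  exact hj (hp j)

lemma simple_injective {i j : J} (hij : s i = s j) : a i = a j := by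
  by_contra hc
  have h1 := h.pos_smul i (a j) (h.pos_simple j) (Ne.symm hc)
  have h2 := (h.pos_smul_neg 1 j)
  rw [one_smul, one_smul, ← hij] at h2
  exact h2.1 h1 (h.pos_simple j)

/-- Matsumoto's theorem: a family satisfying the braid relations has the same product along any two
reduced words of an element. -/
theorem matsumoto {A : Type*} [Monoid A] (F : J → A)
    (hb : ∀ i j m, i ≠ j → genProd s (altWord i j m) = genProd s (altWord j i m) →
      genLength s (genProd s (altWord i j m)) = m →
      ((altWord i j m).map F).prod = ((altWord j i m).map F).prod) :
    ∀ n (l l' : List J), l.length = n → l'.length = n → genProd s l = genProd s l' →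
      genLength s (genProd s l) = n → (l.map F).prod = (l'.map F).prod := by
  intro n
  induction n with
  | zero =>
    intro l l' hl hl' _ _
    rw [List.length_eq_zero_iff.1 hl, List.length_eq_zero_iff.1 hl']
  | succ n ih =>
    have first : ∀ i (l l' : List J), l.length = n → l'.length = n →
        genProd s (i :: l) = genProd s (i :: l') → genLength s (genProd s (i :: l)) = n + 1 →
        ((i :: l).map F).prod = ((i :: l').map F).prod := by
      intro i l l' hl hl' he hr
      rw [genProd_cons, genProd_cons, mul_right_inj] at he
      have := isReduced_append_right (l := [i]) (l' := l) (by simpa [hl] using hr)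
      simp [ih l l' hl hl' he (this.trans hl)]
    have last : ∀ i (l l' : List J), l.length = n → l'.length = n →
        genProd s (l ++ [i]) = genProd s (l' ++ [i]) → genLength s (genProd s (l ++ [i])) = n + 1 →
        ((l ++ [i]).map F).prod = ((l' ++ [i]).map F).prod := by
      intro i l l' hl hl' he hr
      have := isReduced_append_left (l := l) (l' := [i]) (by rw [hr]; simp [hl])
      rw [genProd_append, genProd_append, mul_left_inj] at he
      simp [ih l l' hl hl' he (this.trans hl)]
    -- exchanging a new first letter into a reduced word
    have step : ∀ j (l l' : List J), l.length = n + 1 → l'.length = n →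
        genProd s l = genProd s (j :: l') → genLength s (genProd s l) = n + 1 →
        (l.map F).prod = ((j :: l').map F).prod ∨
          (genProd s (j :: l.dropLast) = genProd s l ∧
            ((j :: l.dropLast).map F).prod = ((j :: l').map F).prod) := by
      intro j l l' hl hl' he hr
      have hn : ¬ pos ((genProd s l)⁻¹ • a j) := by
        intro hp
        have h1 := h.genLength_simple_mul_of_pos ⟨l, rfl⟩ hp
        rw [hr, he, genProd_cons, h.mul_cancel] at h1
        have h2 := genLength_le s l'
        omega
      obtain ⟨l₁, k, l₂, hl1, hl2⟩ := h.exchange_left l j hn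
      have he2 : genProd s (j :: (l₁ ++ l₂)) = genProd s l := by
        rw [genProd_cons, ← hl2, h.mul_cancel]
      have hlen : (l₁ ++ l₂).length = n := by
        rw [hl1] at hl; simp at hl ⊢; omega
      have hF := first j (l₁ ++ l₂) l' hlen hl' (he2.trans he) (by rw [he2, hr])
      -- Either the deleted letter is the last one of l, which leaves `l.dropLast`, or the old and
      -- the new word share their last letter z and `last` applies.
      rcases List.eq_nil_or_concat l₂ with rfl | ⟨l₃, z, rfl⟩
      · right
        have : l.dropLast = l₁ ++ [] := by rw [hl1]; simp
        rw [this]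
        exact ⟨he2, hF⟩
      · left
        rw [← hF]
        simp only [List.concat_eq_append] at *
        have e1 : l = (l₁ ++ k :: l₃) ++ [z] := by rw [hl1]; simp
        have e2 : j :: (l₁ ++ (l₃ ++ [z])) = (j :: (l₁ ++ l₃)) ++ [z] := by simp
        rw [e2] at he2 ⊢
        rw [e1] at hr he2 ⊢
        refine last z _ _ ?_ ?_ he2.symm hr
        · rw [e1] at hl; simp at hl ⊢; omega
        · simp at hlen ⊢; omega
    -- The two words have alternating prefixes of length k + 1 and tails of length d. An exchange
    -- puts the other letter in front and drops the last one: the prefixes grow and the tails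
    -- shrink, until at d = 0 the braid hypothesis applies.
    have claim : ∀ d k, k + 1 + d = n + 1 → ∀ i j, i ≠ j → ∀ t t' : List J, t.length = d →
        t'.length = d →
        genProd s (altWord i j (k + 1) ++ t) = genProd s (altWord j i (k + 1) ++ t') →
        genLength s (genProd s (altWord i j (k + 1) ++ t)) = n + 1 →
        ((altWord i j (k + 1) ++ t).map F).prod = ((altWord j i (k + 1) ++ t').map F).prod := by
      intro d
      induction d with
      | zero =>
        intro k hk i j hij t t' ht ht' he hr
        rw [List.length_eq_zero_iff.1 ht, List.length_eq_zero_iff.1 ht'] at *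
        simp only [List.append_nil] at *
        exact hb i j _ hij he (by omega)
      | succ d ihd =>
        intro k hk i j hij t t' ht ht' he hr
        have hd : ∀ (i j : J) (t : List J), t.length = d + 1 →
            j :: (altWord i j (k + 1) ++ t).dropLast = altWord j i (k + 1 + 1) ++ t.dropLast := by
          intro i j t ht
          rw [List.dropLast_append_of_ne_nil (by rintro rfl; simp at ht)]
          rfl
        rcases step j (altWord i j (k + 1) ++ t) (altWord i j k ++ t') (by simp; omega)
          (by simp; omega) he hr with h1 | ⟨h1, h2⟩
        · exact h1
        rcases step i (altWord j i (k + 1) ++ t') (altWord j i k ++ t) (by simp; omega)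
          (by simp; omega) he.symm (he ▸ hr) with h3 | ⟨h3, h4⟩
        · exact h3.symm
        rw [hd i j t ht] at h1 h2
        rw [hd j i t' ht'] at h3 h4
        have := ihd (k + 1) (by omega) i j hij t'.dropLast t.dropLast (by simp [ht'])
          (by simp [ht]) (by rw [h1, h3, he]) (by rw [h3, ← he, hr])
        exact h4.symm.trans (this.trans h2)
    intro l l' hl hl' he hr
    obtain ⟨i, t, rfl⟩ := List.exists_cons_of_length_eq_add_one hl
    obtain ⟨j, t', rfl⟩ := List.exists_cons_of_length_eq_add_one hl'
    by_cases hij : i = j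
    · subst hij
      exact first i t t' (by simpa using hl) (by simpa using hl') he hr
    · exact claim n 0 (by omega) i j hij t t' (by simpa using hl) (by simpa using hl') he hr

end RootedGenerators

end RootedGenerators

end AffineNilHecke

noncomputable section

namespace AffineNilHecke

/-! ### The linear action of the extended affine Weyl group on 𝔥* ⊕ ℂδ. -/

section AffineAction

variable {ι M N : Type*} [AddCommGroup M] [Module ℂ M] [AddCommGroup N] [Module ℂ N]
  {P : RootPairing ι ℂ M N}

lemma weyl_ext {v w : P.weylGroup} (h : ∀ m : M, v • m = w • m) : v = w := by
  apply Subtype.ext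
  apply RootPairing.Equiv.weightHom_injective P
  ext m
  exact h m

lemma ofIdx_smul_apply (k : ι) (m : M) :
    RootPairing.weylGroup.ofIdx P k • m = m - P.toLinearMap m (P.coroot k) • P.root k := by
  rw [RootPairing.weylGroup.ofIdx_smul, RootPairing.Equiv.reflection_smul,
    RootPairing.reflection_apply]
  rfl

lemma weyl_smul_smul (w : P.weylGroup) (c : ℂ) (m : M) : w • (c • m) = c • (w • m) :=
  map_smul (RootPairing.Equiv.weightEquiv P P (w : P.Aut)) c m

lemma pairing_smul_coAct (w : P.weylGroup) (m : M) (h : N) :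
    P.toLinearMap (w • m) (coAct P w h) = P.toLinearMap m h := by
  rw [pairing_coAct, inv_smul_smul]

lemma coAct_coroot_eq (w : P.weylGroup) (k : ι) :
    coAct P w (P.coroot k) = P.coroot (P.weylGroupToPerm w k) :=
  congr_fun ((w : P.Aut)⁻¹).coroot_coweightMap k

lemma pairing_smul_coroot {w : P.weylGroup} {j k : ι} (h : w • P.root j = P.root k) (m : M) :
    P.toLinearMap (w • m) (P.coroot k) = P.toLinearMap m (P.coroot j) := by
  rw [RootPairing.weylGroup_apply_root] at h
  rw [← P.root.injective h, ← coAct_coroot_eq, pairing_smul_coAct]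

/-- The action of the extended affine Weyl group on affine weights `𝔥* ⊕ ℂ δ`. -/
instance affineAction : MulAction (ExtWeyl P) (M × ℂ) where
  smul x v := (x.right • v.1, v.2 - P.toLinearMap (x.right • v.1) (x.left.toAdd : N))
  one_smul v := by
    change ((1 : P.weylGroup) • v.1, v.2 - P.toLinearMap ((1 : P.weylGroup) • v.1) (0 : N)) = v
    simp
  mul_smul x y v := by
    change ((x.right * y.right) • v.1, v.2 - P.toLinearMap ((x.right * y.right) • v.1)
      ((x.left.toAdd : N) + coAct P x.right y.left.toAdd)) =
      (x.right • y.right • v.1, (v.2 - P.toLinearMap (y.right • v.1) (y.left.toAdd : N)) -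
        P.toLinearMap (x.right • y.right • v.1) (x.left.toAdd : N))
    rw [mul_smul, map_add, pairing_smul_coAct]
    ext
    · rfl
    · simp only; ring

lemma ext_smul_def (x : ExtWeyl P) (v : M × ℂ) :
    x • v = (x.right • v.1, v.2 - P.toLinearMap (x.right • v.1) (x.left.toAdd : N)) := rfl

lemma ofWeyl_smul (w : P.weylGroup) (v : M × ℂ) : ofWeyl P w • v = (w • v.1, v.2) := by
  rw [ext_smul_def]
  change (w • v.1, v.2 - P.toLinearMap (w • v.1) (0 : N)) = _
  simp

lemma translation_smul (μ : coweightLattice P) (v : M × ℂ) :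
    translation P μ • v = (v.1, v.2 - P.toLinearMap v.1 (μ : N)) := by
  rw [ext_smul_def]
  change ((1 : P.weylGroup) • v.1, v.2 - P.toLinearMap ((1 : P.weylGroup) • v.1) (μ : N)) = _
  simp

lemma ext_smul_add (x : ExtWeyl P) (v w : M × ℂ) : x • (v + w) = x • v + x • w := by
  simp only [ext_smul_def, Prod.fst_add, Prod.snd_add, smul_add, map_add, LinearMap.add_apply]
  ext
  · rfl
  · simp only [Prod.snd_add]; ring

lemma ext_smul_smul (x : ExtWeyl P) (c : ℂ) (v : M × ℂ) : x • (c • v) = c • (x • v) := by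
  simp only [ext_smul_def, Prod.smul_fst, Prod.smul_snd, weyl_smul_smul, map_smul,
    LinearMap.smul_apply]
  ext
  · rfl
  · simp only [Prod.smul_snd, smul_eq_mul]; ring

lemma ext_smul_neg (x : ExtWeyl P) (v : M × ℂ) : x • (-v) = -(x • v) := by
  have := ext_smul_smul x (-1) v
  simpa using this

lemma ext_smul_sub (x : ExtWeyl P) (v w : M × ℂ) : x • (v - w) = x • v - x • w := by
  rw [sub_eq_add_neg, ext_smul_add, ext_smul_neg, sub_eq_add_neg]

variable [P.IsRootSystem]

lemma eq_of_pairing_eq {h h' : N} (e : ∀ m, P.toLinearMap m h = P.toLinearMap m h') : h = h' :=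
  P.flip.toPerfPair.injective (LinearMap.ext e)

/-- The first coordinate recovers the finite part and, the pairing being perfect, the δ-coordinate
recovers the translation. Group identities can thus be checked on vectors. -/
lemma extWeyl_ext {x y : ExtWeyl P} (h : ∀ v : M × ℂ, x • v = y • v) : x = y := by
  have h1 : x.right = y.right := weyl_ext fun m => congr_arg Prod.fst (h (m, 0))
  have h2 : ∀ m, P.toLinearMap m (x.left.toAdd : N) = P.toLinearMap m (y.left.toAdd : N) := by
    intro m
    have := congr_arg Prod.snd (h (x.right⁻¹ • m, 0))
    simp only [ext_smul_def, ← h1, smul_inv_smul] at this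
    simpa using this
  refine SemidirectProduct.ext ?_ h1
  apply Multiplicative.toAdd.injective
  exact Subtype.ext (eq_of_pairing_eq h2)

end AffineAction

/-! ### Positive affine roots. -/

section AffineRoots

variable {ι M N : Type*} [AddCommGroup M] [Module ℂ M] [AddCommGroup N] [Module ℂ N]
  {P : RootPairing ι ℂ M N} (b : P.Base)

/-- A positive affine root `α + n δ`: `n > 0`, or `n = 0` and `α` is positive. -/
def IsPosAff (v : M × ℂ) : Prop :=
  ∃ (k : ι) (n : ℤ), v = (P.root k, (n : ℂ)) ∧ (0 < n ∨ n = 0 ∧ 0 < b.height k)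

lemma isPosAff_iff (k : ι) (n : ℤ) :
    IsPosAff b (P.root k, (n : ℂ)) ↔ 0 < n ∨ n = 0 ∧ 0 < b.height k := by
  constructor
  · rintro ⟨k', n', h, h'⟩
    rw [Prod.mk.injEq] at h
    have h1 := P.root.injective h.1
    have h2 : n = n' := by exact_mod_cast h.2
    rw [h1, h2]
    exact h'
  · exact fun h => ⟨k, n, rfl, h⟩

lemma isPosAff_finite_iff (k : ι) : IsPosAff b (P.root k, (0 : ℂ)) ↔ 0 < b.height k := by
  have := isPosAff_iff b k 0
  simpa using this

lemma height_neg (k : ι) : b.height (P.reflectionPerm k k) = -b.height k :=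
  b.height_reflectionPerm_self k

lemma root_neg (k : ι) : P.root (P.reflectionPerm k k) = -P.root k := by
  rw [RootPairing.root_reflectionPerm, RootPairing.reflection_apply_self]

lemma coroot_neg (k : ι) : P.coroot (P.reflectionPerm k k) = -P.coroot k := by
  rw [RootPairing.coroot_reflectionPerm, RootPairing.coreflection_apply_self]

lemma isPosAff_neg_iff (k : ι) (n : ℤ) :
    IsPosAff b (-(P.root k, (n : ℂ))) ↔ ¬ IsPosAff b (P.root k, (n : ℂ)) := by
  have : -(P.root k, (n : ℂ)) = (P.root (P.reflectionPerm k k), ((-n : ℤ) : ℂ)) := by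
    rw [root_neg]; simp
  rw [this, isPosAff_iff, isPosAff_iff, height_neg]
  have := b.height_ne_zero k
  omega

lemma exists_ext_smul_root (x : ExtWeyl P) (k : ι) : ∃ m : ℤ, ∀ n : ℤ,
    x • (P.root k, (n : ℂ)) = (P.root (P.weylGroupToPerm x.right k), ((n + m : ℤ) : ℂ)) := by
  obtain ⟨m, hm⟩ := x.left.toAdd.2 (P.weylGroupToPerm x.right k)
  refine ⟨-m, fun n => ?_⟩
  rw [ext_smul_def, RootPairing.weylGroup_apply_root]
  simp only [hm]
  push_cast
  rfl

lemma isPosAff_smul_neg_iff (x : ExtWeyl P) (k : ι) (n : ℤ) :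
    IsPosAff b (x • -(P.root k, (n : ℂ))) ↔ ¬ IsPosAff b (x • (P.root k, (n : ℂ))) := by
  obtain ⟨m, hm⟩ := exists_ext_smul_root x k
  rw [ext_smul_neg, hm, isPosAff_neg_iff]

end AffineRoots

/-! ### The simple affine reflections satisfy the axioms of `RootedGenerators`. -/

section SimpleAffineRoots

variable {ι M N : Type*} [AddCommGroup M] [Module ℂ M] [AddCommGroup N] [Module ℂ N]
  {P : RootPairing ι ℂ M N} [P.IsRootSystem] (b : P.Base) [Finite ι] [P.IsIrreducible]

lemma height_le_highestRoot (k : ι) : b.height k ≤ b.height (highestRoot b) :=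
  (exists_highestRoot b).choose_spec k

lemma height_highestRoot_pos : 0 < b.height (highestRoot b) := by
  have h1 := height_le_highestRoot b (P.reflectionPerm (highestRoot b) (highestRoot b))
  have h2 := b.height_ne_zero (highestRoot b)
  rw [height_neg] at h1
  omega

variable [P.IsCrystallographic]

/-- The coefficient of `δ` in a simple affine root. -/
def nodeLevel : AffineNode b → ℤ
  | some _ => 0
  | none => 1

/-- The simple affine roots `α_j` and `-θ + δ`. -/
def simpleAffRoot (j : AffineNode b) : M × ℂ := (P.root (nodeRoot b j), (nodeLevel b j : ℂ))

lemma simpleReflection_smul (j : AffineNode b) (v : M × ℂ) :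
    simpleReflection b j • v =
      v - P.toLinearMap v.1 (P.coroot (nodeRoot b j)) • simpleAffRoot b j := by
  rcases j with _ | j
  · simp only [simpleReflection, simpleAffRoot, nodeRoot, nodeLevel, mul_smul, ofWeyl_smul,
      translation_smul, ofIdx_smul_apply, root_neg, coroot_neg]
    ext
    · simp
    · simp; ring
  · simp only [simpleReflection, simpleAffRoot, nodeRoot, nodeLevel, ofWeyl_smul, ofIdx_smul_apply]
    ext <;> simp

lemma simpleReflection_smul_self (j : AffineNode b) :
    simpleReflection b j • simpleAffRoot b j = -simpleAffRoot b j := by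
  rw [simpleReflection_smul]
  have : P.toLinearMap (simpleAffRoot b j).1 (P.coroot (nodeRoot b j)) = 2 :=
    P.root_coroot_two _
  rw [this, two_smul]
  abel

lemma simpleReflection_sq (j : AffineNode b) :
    simpleReflection b j * simpleReflection b j = 1 := by
  apply extWeyl_ext
  intro v
  rw [mul_smul, one_smul, simpleReflection_smul b j v, ext_smul_sub, ext_smul_smul,
    simpleReflection_smul_self, simpleReflection_smul]
  simp

lemma conj_simpleReflection (x : ExtWeyl P) (j k : AffineNode b)
    (h : x • simpleAffRoot b j = simpleAffRoot b k) :
    x * simpleReflection b j = simpleReflection b k * x := by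
  apply extWeyl_ext
  intro v
  rw [mul_smul, mul_smul, simpleReflection_smul, simpleReflection_smul, ext_smul_sub,
    ext_smul_smul, h]
  congr 2
  exact (pairing_smul_coroot (congr_arg Prod.fst h) v.1).symm

variable [P.IsReduced]

/-- The root k - θ has nonzero height, so k lies strictly below θ. With p the pairing, s_θ k = k -
pθ has height at least -ht θ, which forces p < 2. -/
lemma pairingIn_highestRoot_of_pos {k : ι} (hk : k ≠ highestRoot b)
    (h : 0 < P.pairingIn ℤ k (highestRoot b)) :
    P.pairingIn ℤ k (highestRoot b) = 1 := by
  obtain ⟨l, hl⟩ := P.root_sub_root_mem_of_pairingIn_pos h hk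
  have h1 := b.height_sub hl
  have h2 := b.height_ne_zero l
  have h3 := height_le_highestRoot b k
  have h4 : P.root (P.reflectionPerm (highestRoot b) k) =
      P.root k + (-P.pairingIn ℤ k (highestRoot b)) • P.root (highestRoot b) := by
    rw [RootPairing.root_reflectionPerm, neg_smul, P.reflection_apply_root' ℤ, sub_eq_add_neg]
  have h5 := b.height_add_zsmul h4
  have h6 := height_le_highestRoot b (P.reflectionPerm (P.reflectionPerm (highestRoot b) k)
    (P.reflectionPerm (highestRoot b) k))
  rw [height_neg, h5, smul_eq_mul] at h6
  have h7 := height_highestRoot_pos b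
  have h8 : b.height k < b.height (highestRoot b) := by omega
  have h9 : P.pairingIn ℤ k (highestRoot b) < 2 := by nlinarith
  omega

lemma pairingIn_highestRoot_of_neg {k : ι} (hk : P.root k ≠ -P.root (highestRoot b))
    (h : P.pairingIn ℤ k (highestRoot b) < 0) :
    P.pairingIn ℤ k (highestRoot b) = -1 := by
  have h1 : P.pairingIn ℤ (P.reflectionPerm k k) (highestRoot b) =
      -P.pairingIn ℤ k (highestRoot b) := by
    apply Int.cast_injective (α := ℂ)
    have e := P.algebraMap_pairingIn ℤ (P.reflectionPerm k k) (highestRoot b)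
    have e' := P.algebraMap_pairingIn ℤ k (highestRoot b)
    simp only [algebraMap_int_eq, eq_intCast] at e e'
    rw [e, Int.cast_neg, e', RootPairing.pairing_reflectionPerm_self_left]
  have := pairingIn_highestRoot_of_pos b (k := P.reflectionPerm k k)
    (fun hc => hk (by rw [← hc, root_neg, neg_neg])) (by omega)
  omega

lemma simpleReflection_none_smul_root (k : ι) (n : ℤ) :
    simpleReflection b none • (P.root k, (n : ℂ)) =
      (P.root (P.reflectionPerm (highestRoot b) k),
        ((n + P.pairingIn ℤ k (highestRoot b) : ℤ) : ℂ)) := by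
  have e' := P.algebraMap_pairingIn ℤ k (highestRoot b)
  simp only [algebraMap_int_eq, eq_intCast] at e'
  rw [simpleReflection_smul]
  simp only [simpleAffRoot, nodeRoot, nodeLevel, root_neg, coroot_neg]
  rw [RootPairing.root_reflectionPerm, RootPairing.reflection_apply_root]
  ext
  · simp
  · push_cast; rw [e']; simp

lemma simpleReflection_some_smul_root (j : b.support) (k : ι) (n : ℤ) :
    simpleReflection b (some j) • (P.root k, (n : ℂ)) = (P.root (P.reflectionPerm j k), (n : ℂ)) := by
  rw [simpleReflection_smul]
  simp only [simpleAffRoot, nodeRoot, nodeLevel]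
  rw [RootPairing.root_reflectionPerm, RootPairing.reflection_apply_root]
  ext <;> simp

/-- The case of s_0 carries the content. Away from ±θ the pairing p with θ^∨ is -1, 0 or 1, and s_0
adds p to the level. Only p = -1 is delicate: then k + θ is a root, so k is negative and its level
is at least 1; if the level drops to 0, the image k + θ is a positive root. -/
lemma isPosAff_simpleReflection_smul (j : AffineNode b) (v : M × ℂ) (hv : IsPosAff b v)
    (hj : v ≠ simpleAffRoot b j) : IsPosAff b (simpleReflection b j • v) := by
  obtain ⟨k, n, rfl, hn⟩ := hv
  rcases j with _ | j
  · rw [simpleReflection_none_smul_root, isPosAff_iff]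
    have hθ := height_highestRoot_pos b
    by_cases h1 : k = highestRoot b
    · subst h1
      rw [P.pairingIn_same]
      omega
    by_cases h2 : P.root k = -P.root (highestRoot b)
    · have h3 : k = P.reflectionPerm (highestRoot b) (highestRoot b) :=
        P.root.injective (by rw [h2, root_neg])
      have h4 : b.height k = -b.height (highestRoot b) := by rw [h3, height_neg]
      have h5 : n ≠ 1 := by
        rintro rfl
        exact hj (by rw [simpleAffRoot, h3]; rfl)
      have h6 : P.reflectionPerm (highestRoot b) k = highestRoot b := by
        rw [h3, RootPairing.reflectionPerm_self]
      have h7 : P.pairingIn ℤ k (highestRoot b) = -2 := by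
        apply Int.cast_injective (α := ℂ)
        have e' := P.algebraMap_pairingIn ℤ k (highestRoot b)
        simp only [algebraMap_int_eq, eq_intCast] at e'
        rw [e', h3, RootPairing.pairing_reflectionPerm_self_left, RootPairing.pairing_same]
        simp
      rw [h6, h7]
      omega
    have h4 : P.root (P.reflectionPerm (highestRoot b) k) =
        P.root k + (-P.pairingIn ℤ k (highestRoot b)) • P.root (highestRoot b) := by
      rw [RootPairing.root_reflectionPerm, neg_smul, P.reflection_apply_root' ℤ, sub_eq_add_neg]
    have h5 := b.height_add_zsmul h4
    have h6 := height_le_highestRoot b (P.reflectionPerm (highestRoot b) k)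
    have h7 := b.height_ne_zero (P.reflectionPerm (highestRoot b) k)
    have h8 := height_le_highestRoot b (P.reflectionPerm k k)
    rw [height_neg] at h8
    rw [smul_eq_mul] at h5
    rcases lt_trichotomy (P.pairingIn ℤ k (highestRoot b)) 0 with h | h | h
    · have e := pairingIn_highestRoot_of_neg b h2 h
      rw [e] at h5 ⊢
      omega
    · rw [h] at h5 ⊢
      omega
    · have e := pairingIn_highestRoot_of_pos b h1 h
      rw [e] at h5 ⊢
      omega
  · rw [simpleReflection_some_smul_root, isPosAff_iff]
    rcases hn with hn | ⟨rfl, hn⟩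
    · exact Or.inl hn
    · refine Or.inr ⟨rfl, ?_⟩
      refine RootPairing.Base.IsPos.reflectionPerm hn j.2 ?_
      rintro rfl
      exact hj rfl

lemma isPosAff_simpleAffRoot (j : AffineNode b) : IsPosAff b (simpleAffRoot b j) := by
  rw [simpleAffRoot, isPosAff_iff]
  rcases j with _ | j
  · exact Or.inl one_pos
  · refine Or.inr ⟨rfl, ?_⟩
    rw [nodeRoot, RootPairing.Base.height_one_of_mem_support j.2]
    exact one_pos

/-- The simple affine roots and reflections. -/
lemma affine_rootedGenerators :
    RootedGenerators (IsPosAff b) (simpleAffRoot b) (simpleReflection b) where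
  sq := simpleReflection_sq b
  pos_simple := isPosAff_simpleAffRoot b
  pos_smul_neg x j := by
    rw [simpleReflection_smul_self]
    exact isPosAff_smul_neg_iff b x _ _
  pos_smul j r := isPosAff_simpleReflection_smul b j r
  conj := conj_simpleReflection b

lemma ofWeyl_injective : Function.Injective (ofWeyl P) := SemidirectProduct.inr_injective

/-- The simple roots and reflections. -/
lemma finite_rootedGenerators :
    RootedGenerators (fun m : M => IsPosAff b (m, 0)) (fun j : b.support => P.root j)
      (fun j => RootPairing.weylGroup.ofIdx P (j : ι)) where
  sq j := ofWeyl_injective (by rw [map_mul, map_one]; exact simpleReflection_sq b (some j))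
  pos_simple j := by
    rw [isPosAff_finite_iff, RootPairing.Base.height_one_of_mem_support j.2]
    exact one_pos
  pos_smul_neg x j := by
    have := (affine_rootedGenerators b).pos_smul_neg (ofWeyl P x) (some j)
    simpa [simpleReflection, simpleAffRoot, nodeRoot, nodeLevel, ofWeyl_smul] using this
  pos_smul j r hr hj := by
    have := (affine_rootedGenerators b).pos_smul (some j) (r, 0) hr
      (fun hc => hj (congr_arg Prod.fst hc))
    simpa [simpleReflection, ofWeyl_smul] using this
  conj x j k h := by
    apply ofWeyl_injective
    rw [map_mul, map_mul]
    refine conj_simpleReflection b (ofWeyl P x) (some j) (some k) ?_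
    simp only [simpleAffRoot, nodeRoot, nodeLevel, ofWeyl_smul, h]

end SimpleAffineRoots

end AffineNilHecke

end

noncomputable section

namespace AffineNilHecke

/-! ### Removing inversions. -/

section Descent

variable {G R J : Type*} [Group G] [MulAction G R]
  {pos : R → Prop} {a : J → R} {s : J → G}

/-- Stripping descents: an element with finitely many inversions can be multiplied by a word to make
all simple roots stay positive. -/
lemma RootedGenerators.exists_mul_forall_pos (h : RootedGenerators pos a s) (x : G)
    (hx : {r | pos r ∧ ¬ pos (x • r)}.Finite) :
    ∃ l, ∀ j, pos ((x * genProd s l) • a j) := by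
  generalize hn : {r | pos r ∧ ¬ pos (x • r)}.ncard = n
  induction n using Nat.strong_induction_on generalizing x with
  | _ n ih =>
    by_cases hp : ∀ j, pos (x • a j)
    · exact ⟨[], by simpa using hp⟩
    push Not at hp
    obtain ⟨j, hj⟩ := hp
    -- At a descent j of x, s_j maps the inversions of x s_j injectively into those of x and misses
    -- a j, so their number drops.
    have hsub : (s j • ·) '' {r | pos r ∧ ¬ pos ((x * s j) • r)} ⊂ {r | pos r ∧ ¬ pos (x • r)} := by
      refine (Set.ssubset_iff_of_subset ?_).2 ⟨a j, ⟨h.pos_simple j, hj⟩, ?_⟩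
      · rintro _ ⟨r, ⟨hr, hr'⟩, rfl⟩
        refine ⟨h.pos_smul j r hr ?_, by rwa [← mul_smul]⟩
        rintro rfl
        exact hr' ((h.pos_mul_simple x j).2 hj)
      · rintro ⟨r, ⟨hr, -⟩, hr'⟩
        have h1 := h.pos_smul_neg 1 j
        simp only [one_smul] at h1
        have h2 : r = s j • a j := by
          rw [← hr']
          simp only [← mul_smul, h.sq, one_smul]
        exact h1.1 (h2 ▸ hr) (h.pos_simple j)
    have hinj : Function.Injective ((s j • ·) : R → R) := MulAction.injective _
    have hlt := Set.ncard_lt_ncard hsub hx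
    rw [Set.ncard_image_of_injective _ hinj, hn] at hlt
    obtain ⟨l, hl⟩ := ih _ hlt (x * s j)
      ((hx.subset hsub.subset).of_finite_image hinj.injOn) rfl
    exact ⟨j :: l, by simpa [mul_assoc] using hl⟩

end Descent

/-! ### Translations, the coroot lattice and normality of the affine Weyl group. -/

section Generation

variable {ι M N : Type*} [AddCommGroup M] [Module ℂ M] [AddCommGroup N] [Module ℂ N]
  {P : RootPairing ι ℂ M N}

lemma conj_ofIdx {w : P.weylGroup} {i k : ι} (h : w • P.root i = P.root k) :
    w * RootPairing.weylGroup.ofIdx P i = RootPairing.weylGroup.ofIdx P k * w := by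
  apply weyl_ext
  intro m
  rw [mul_smul, mul_smul, ofIdx_smul_apply, ofIdx_smul_apply, smul_sub, weyl_smul_smul, h,
    pairing_smul_coroot h]

lemma ofIdx_sq (k : ι) :
    RootPairing.weylGroup.ofIdx P k * RootPairing.weylGroup.ofIdx P k = 1 := by
  apply weyl_ext
  intro m
  rw [mul_smul, one_smul]
  exact P.reflection_same k m

lemma ofIdx_smul_root (j k : ι) :
    RootPairing.weylGroup.ofIdx P j • P.root k = P.root (P.reflectionPerm j k) := by
  rw [RootPairing.root_reflectionPerm]
  rfl

lemma ofIdx_reflectionPerm (j k : ι) :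
    RootPairing.weylGroup.ofIdx P (P.reflectionPerm j k) = RootPairing.weylGroup.ofIdx P j *
      RootPairing.weylGroup.ofIdx P k * RootPairing.weylGroup.ofIdx P j := by
  rw [conj_ofIdx (ofIdx_smul_root j k), mul_assoc, ofIdx_sq, mul_one]

lemma coAct_ofIdx (k : ι) (h : N) :
    coAct P (RootPairing.weylGroup.ofIdx P k) h =
      h - P.toLinearMap (P.root k) h • P.coroot k := by
  have h1 : (RootPairing.weylGroup.ofIdx P k : P.Aut)⁻¹ = RootPairing.Equiv.reflection P k :=
    RootPairing.Equiv.reflection_inv P k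
  rw [coAct_apply, h1, RootPairing.Equiv.reflection_coweightEquiv, RootPairing.coreflection_apply]

lemma translation_add (μ ν : coweightLattice P) :
    translation P (μ + ν) = translation P μ * translation P ν := by
  rw [translation, translation, translation, ← map_mul]
  rfl

lemma translation_zero : translation P 0 = 1 := map_one _

lemma translation_neg (μ : coweightLattice P) : translation P (-μ) = (translation P μ)⁻¹ :=
  map_inv SemidirectProduct.inl _

lemma coe_mul_left (x y : ExtWeyl P) :
    ((x * y).left.toAdd : N) = x.left.toAdd + coAct P x.right y.left.toAdd := rfl

lemma ofWeyl_mul_translation (w : P.weylGroup) (μ : coweightLattice P) :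
    ofWeyl P w * translation P μ =
      translation P ⟨coAct P w μ, coAct_mem_coweightLattice P w μ.2⟩ * ofWeyl P w := by
  apply SemidirectProduct.ext
  · apply Multiplicative.toAdd.injective
    apply Subtype.ext
    rw [coe_mul_left, coe_mul_left]
    change 0 + coAct P w μ = coAct P w μ + coAct P 1 0
    simp
  · simp [ofWeyl, translation]

lemma translation_mul_ofWeyl (x : ExtWeyl P) :
    translation P x.left.toAdd * ofWeyl P x.right = x :=
  SemidirectProduct.inl_left_mul_inr_right x

/-- A Weyl group element moves a coweight by an element of the coroot lattice. -/
lemma sub_coAct_mem (w : P.weylGroup) {h : N} (hh : h ∈ coweightLattice P) :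
    h - coAct P w h ∈ corootLattice P := by
  obtain ⟨w, hw⟩ := w
  revert h
  induction hw using RootPairing.weylGroup.induction with
  | mem k =>
    intro h hh
    have := coAct_ofIdx (P := P) k h
    rw [RootPairing.weylGroup.ofIdx] at this
    obtain ⟨n, hn⟩ := hh k
    rw [this, hn, sub_sub_cancel, Int.cast_smul_eq_zsmul]
    have hk : P.coroot k ∈ corootLattice P := AddSubgroup.subset_closure (Set.mem_range_self k)
    exact zsmul_mem hk n
  | one =>
    intro h hh
    have : coAct P (⟨1, one_mem _⟩ : P.weylGroup) h = h := coAct_one P h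
    rw [this, sub_self]
    exact zero_mem _
  | mul v w hv hw ihv ihw =>
    intro h hh
    have : coAct P ⟨v * w, mul_mem hv hw⟩ h = coAct P ⟨v, hv⟩ (coAct P ⟨w, hw⟩ h) :=
      coAct_mul P ⟨v, hv⟩ ⟨w, hw⟩ h
    rw [this]
    have := add_mem (ihw hh) (ihv (coAct_mem_coweightLattice P ⟨w, hw⟩ hh))
    rwa [sub_add_sub_cancel] at this

lemma mem_affineWeyl_iff (x : ExtWeyl P) :
    x ∈ affineWeyl P ↔ (x.left.toAdd : N) ∈ corootLattice P := Iff.rfl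

lemma coe_inv_left (x : ExtWeyl P) :
    ((x⁻¹).left.toAdd : N) = coAct P x.right⁻¹ (-(x.left.toAdd : N)) := rfl

lemma ofWeyl_mem_affineWeyl (w : P.weylGroup) : ofWeyl P w ∈ affineWeyl P :=
  zero_mem (corootLattice P)

/-- Membership of a quotient in the affine Weyl group, through the coroot lattice. -/
lemma inv_mul_mem_affineWeyl_iff (x y : ExtWeyl P) :
    x⁻¹ * y ∈ affineWeyl P ↔ (y.left.toAdd : N) - x.left.toAdd ∈ corootLattice P := by
  rw [mem_affineWeyl_iff, coe_mul_left, coe_inv_left]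
  change coAct P x.right⁻¹ _ + coAct P x.right⁻¹ _ ∈ _ ↔ _
  rw [← map_add, neg_add_eq_sub]
  refine ⟨fun h => ?_, coAct_mem_corootLattice P _⟩
  have := coAct_mem_corootLattice P x.right h
  rwa [← coAct_mul, mul_inv_cancel, coAct_one] at this

/-- W acts trivially on P^∨/Q^∨, so the class of the translation part turns products into sums. -/
lemma left_sub_mem_iff (x y : ExtWeyl P) : (x * y ∈ affineWeyl P) ↔
    ((x.left.toAdd : N) + y.left.toAdd) ∈ corootLattice P := by
  rw [mem_affineWeyl_iff, coe_mul_left]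
  have := sub_coAct_mem x.right y.left.toAdd.2
  constructor
  · intro h
    have := add_mem h this
    rwa [add_assoc, add_sub_cancel] at this
  · intro h
    have := sub_mem h this
    rwa [add_sub_assoc, sub_sub_cancel] at this

instance affineWeyl_normal : (affineWeyl P).Normal where
  conj_mem y hy x := by
    have h1 : (x⁻¹)⁻¹ * (y * x⁻¹) ∈ affineWeyl P := by
      rw [inv_mul_mem_affineWeyl_iff, coe_mul_left]
      have h2 := sub_coAct_mem y.right (x⁻¹).left.toAdd.2
      have h3 := sub_mem ((mem_affineWeyl_iff y).1 hy) h2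
      rwa [← sub_add, sub_add_eq_add_sub] at h3
    rwa [inv_inv, ← mul_assoc] at h1

end Generation

/-! ### Dominance, affine height and generation of the affine Weyl group. -/

section Generation

variable {ι M N : Type*} [AddCommGroup M] [Module ℂ M] [AddCommGroup N] [Module ℂ N]
  {P : RootPairing ι ℂ M N} [P.IsRootSystem] (b : P.Base) [Finite ι] [P.IsIrreducible]
  [P.IsCrystallographic] [P.IsReduced]

lemma exists_finite_word (w : P.weylGroup) :
    ∃ l, genProd (fun j : b.support => RootPairing.weylGroup.ofIdx P (j : ι)) l = w := by
  obtain ⟨w, hw⟩ := w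
  induction hw using RootPairing.weylGroup.induction with
  | mem k =>
    change ∃ l, _ = RootPairing.weylGroup.ofIdx P k
    induction k using b.induction_reflect with
    | h₀ i ih =>
      rw [ofIdx_reflectionPerm]
      exact RootedGenerators.isGen_mul (RootedGenerators.isGen_mul ih ih) ih
    | h₁ i hi => exact ⟨[⟨i, hi⟩], by simp⟩
    | h₂ i j ih hj =>
      rw [ofIdx_reflectionPerm]
      have hj' : ∃ l, genProd (fun j : b.support => RootPairing.weylGroup.ofIdx P (j : ι)) l =
        RootPairing.weylGroup.ofIdx P j := ⟨[⟨j, hj⟩], by simp⟩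
      exact RootedGenerators.isGen_mul (RootedGenerators.isGen_mul hj' ih) hj'
  | one => exact ⟨[], rfl⟩
  | mul v w hv hw ihv ihw => exact RootedGenerators.isGen_mul ihv ihw

lemma genProd_map_some (l : List b.support) :
    genProd (simpleReflection b) (l.map some) =
      ofWeyl P (genProd (fun j : b.support => RootPairing.weylGroup.ofIdx P (j : ι)) l) := by
  induction l with
  | nil => simp
  | cons j l ih => simp only [List.map_cons, genProd_cons, ih, map_mul]; rfl

lemma exists_word_ofWeyl (w : P.weylGroup) :
    ∃ l, genProd (simpleReflection b) l = ofWeyl P w := by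
  obtain ⟨l, rfl⟩ := exists_finite_word b w
  exact ⟨l.map some, genProd_map_some b l⟩

lemma cast_pairingIn (i j : ι) : ((P.pairingIn ℤ i j : ℤ) : ℂ) = P.pairing i j := by
  have := P.algebraMap_pairingIn ℤ i j
  simpa using this

lemma pairingIn_neg_left (i j : ι) :
    P.pairingIn ℤ (P.reflectionPerm i i) j = -P.pairingIn ℤ i j := by
  apply Int.cast_injective (α := ℂ)
  rw [Int.cast_neg, cast_pairingIn, cast_pairingIn, RootPairing.pairing_reflectionPerm_self_left]

lemma pairingIn_neg_right (i j : ι) :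
    P.pairingIn ℤ i (P.reflectionPerm j j) = -P.pairingIn ℤ i j := by
  apply Int.cast_injective (α := ℂ)
  rw [Int.cast_neg, cast_pairingIn, cast_pairingIn, RootPairing.pairing_reflectionPerm_self_right]

/-- The highest root is dominant. -/
lemma pairingIn_highestRoot_nonneg {k : ι} (hk : 0 < b.height k) :
    0 ≤ P.pairingIn ℤ k (highestRoot b) := by
  by_contra! hc
  have h1 : P.root k ≠ -P.root (highestRoot b) := by
    intro h
    have h2 : k = P.reflectionPerm (highestRoot b) (highestRoot b) :=
      P.root.injective (by rw [h, root_neg])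
    rw [h2, height_neg] at hk
    have := height_highestRoot_pos b
    omega
  obtain ⟨l, hl⟩ := P.root_add_root_mem_of_pairingIn_neg hc h1
  have h2 := b.height_add hl
  have h3 := height_le_highestRoot b l
  omega

/-- A dominant root pairs with a dominant coweight at least as much as its conjugates do. -/
lemma re_pairing_smul_le {γ : ι} (hγ : ∀ j ∈ b.support, 0 ≤ P.pairingIn ℤ γ j) {h : N}
    (hh : ∀ k, 0 < b.height k → 0 ≤ (P.toLinearMap (P.root k) h).re) (w : P.weylGroup) :
    (P.toLinearMap (w • P.root γ) h).re ≤ (P.toLinearMap (P.root γ) h).re := by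
  have hR := finite_rootedGenerators b
  generalize hn : genLength (fun j : b.support => RootPairing.weylGroup.ofIdx P (j : ι)) w = n
  induction n generalizing w with
  | zero =>
    obtain ⟨l, rfl, hl⟩ := exists_reduced _ (exists_finite_word b w)
    rw [hn, List.length_eq_zero_iff] at hl
    subst hl
    simp
  | succ n ih =>
    obtain ⟨j, hj⟩ := hR.exists_descent (exists_finite_word b w) (by
      rintro rfl
      rw [genLength_one] at hn
      omega)
    have h1 := hR.genLength_mul_of_not_pos (exists_finite_word b w) hj
    rw [hn] at h1
    have h2 := ih (w * RootPairing.weylGroup.ofIdx P j) (by simpa using h1)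
    have h3 := (hR.pos_mul_simple w j).2 hj
    rw [RootPairing.weylGroup_apply_root, isPosAff_finite_iff] at h3
    have h4 := hh _ h3
    rw [← RootPairing.weylGroup_apply_root] at h4
    refine le_trans ?_ h2
    -- Here w'α_j is positive and wγ = w'γ - ⟨γ, α_j^∨⟩ w'α_j, so the subtracted term pairs
    -- nonnegatively with h.
    set w' := w * RootPairing.weylGroup.ofIdx P j with hw'
    have h5 : w = w' * RootPairing.weylGroup.ofIdx P j := by rw [hw', mul_assoc, ofIdx_sq, mul_one]
    have h6 : w • P.root γ = w' • P.root γ - ((P.pairingIn ℤ γ j : ℤ) : ℂ) • (w' • P.root j) := by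
      rw [h5, mul_smul, ofIdx_smul_apply, smul_sub, weyl_smul_smul, cast_pairingIn]
      rfl
    rw [h6, LinearMap.map_sub, LinearMap.map_smul, LinearMap.sub_apply, LinearMap.smul_apply,
      Complex.sub_re,
      smul_eq_mul, ← Complex.ofReal_intCast, Complex.re_ofReal_mul]
    have h7 : (0 : ℝ) ≤ (P.pairingIn ℤ γ j : ℤ) := by exact_mod_cast hγ j j.2
    nlinarith [mul_nonneg h7 h4]

/-- No root is orthogonal to all conjugates of a root. -/
lemma exists_pairing_ne_zero (k l : ι) :
    ∃ w : P.weylGroup, P.toLinearMap (w • P.root k) (P.coroot l) ≠ 0 := by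
  by_contra! hc
  have h1 : Submodule.span ℂ (MulAction.orbit P.weylGroup (P.root k)) ≤
      LinearMap.ker (P.toLinearMap.flip (P.coroot l)) := by
    rw [Submodule.span_le]
    rintro _ ⟨w, rfl⟩
    exact hc w
  rw [P.span_orbit_eq_top k] at h1
  have h2 : P.toLinearMap (P.root l) (P.coroot l) = 0 := h1 (Submodule.mem_top (x := P.root l))
  rw [P.root_coroot_two] at h2
  norm_num at h2

/-- Every root pairs positively with a simple affine coroot. -/
lemma exists_node_pairingIn_pos (k : ι) : ∃ j, 0 < P.pairingIn ℤ k (nodeRoot b j) := by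
  -- Otherwise γ = -k is dominant and pairs nonpositively with θ^∨, and by dominance so do all its
  -- conjugates. Reflecting in θ reverses the sign of this pairing, so every conjugate is orthogonal
  -- to θ^∨, against irreducibility.
  by_contra! hc
  set γ := P.reflectionPerm k k with hγ
  have h1 : ∀ j ∈ b.support, 0 ≤ P.pairingIn ℤ γ j := by
    intro j hj
    have := hc (some ⟨j, hj⟩)
    rw [hγ, pairingIn_neg_left]
    simpa [nodeRoot] using this
  have h2 : P.pairingIn ℤ γ (highestRoot b) ≤ 0 := by
    have := hc none
    rw [hγ, pairingIn_neg_left]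
    rw [nodeRoot, pairingIn_neg_right] at this
    omega
  have h3 : ∀ w : P.weylGroup,
      (P.toLinearMap (w • P.root γ) (P.coroot (highestRoot b))).re ≤ 0 := by
    intro w
    refine (re_pairing_smul_le b h1 ?_ w).trans ?_
    · intro l hl
      rw [P.root_coroot_eq_pairing, ← cast_pairingIn, Complex.intCast_re]
      exact_mod_cast pairingIn_highestRoot_nonneg b hl
    · rw [P.root_coroot_eq_pairing, ← cast_pairingIn, Complex.intCast_re]
      exact_mod_cast h2
  obtain ⟨w, hw⟩ := exists_pairing_ne_zero (P := P) γ (highestRoot b)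
  have h4 := h3 (RootPairing.weylGroup.ofIdx P (highestRoot b) * w)
  have h5 := h3 w
  rw [mul_smul, ofIdx_smul_apply, LinearMap.map_sub, LinearMap.map_smul, LinearMap.sub_apply,
    LinearMap.smul_apply, P.root_coroot_two] at h4
  apply hw
  rw [RootPairing.weylGroup_apply_root, P.root_coroot_eq_pairing, ← cast_pairingIn] at h4 h5 ⊢
  generalize P.pairingIn ℤ (P.weylGroupToPerm w γ) (highestRoot b) = p at h4 h5 ⊢
  rw [Complex.intCast_re] at h5
  rw [Complex.sub_re, smul_eq_mul, ← Complex.ofReal_intCast, Complex.re_ofReal_mul,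
    Complex.ofReal_re] at h4
  norm_num at h4 h5
  have h6 : (0 : ℝ) ≤ (p : ℝ) := by linarith
  have h7 : (0 : ℤ) ≤ p := by exact_mod_cast h6
  have h8 : p = 0 := by omega
  rw [h8, Int.cast_zero]

/-- The affine height: simple affine roots have height one. -/
lemma isPosAff_iff_height (k : ι) (n : ℤ) : IsPosAff b (P.root k, (n : ℂ)) ↔
    0 < b.height k + n * (b.height (highestRoot b) + 1) := by
  rw [isPosAff_iff]
  -- Finite heights lie between -ht θ and ht θ, so one δ, counted as ht θ + 1, outweighs any of
  -- them.
  have h1 := height_le_highestRoot b k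
  have h2 := height_le_highestRoot b (P.reflectionPerm k k)
  rw [height_neg] at h2
  have h3 := height_highestRoot_pos b
  rcases lt_trichotomy n 0 with h | rfl | h
  · have : n * (b.height (highestRoot b) + 1) ≤ -1 * (b.height (highestRoot b) + 1) :=
      mul_le_mul_of_nonneg_right (by omega) (by omega)
    omega
  · simp
  · have : 1 * (b.height (highestRoot b) + 1) ≤ n * (b.height (highestRoot b) + 1) :=
      mul_le_mul_of_nonneg_right (by omega) (by omega)
    omega

lemma isPosAff_add_smul {k k₁ k₂ : ι} {n n₁ n₂ p : ℤ} (hp : 0 ≤ p)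
    (h : (P.root k, (n : ℂ)) = (P.root k₁, (n₁ : ℂ)) + (p : ℂ) • (P.root k₂, (n₂ : ℂ)))
    (h₁ : IsPosAff b (P.root k₁, (n₁ : ℂ))) (h₂ : IsPosAff b (P.root k₂, (n₂ : ℂ))) :
    IsPosAff b (P.root k, (n : ℂ)) := by
  rw [isPosAff_iff_height] at *
  have e1 := congr_arg Prod.fst h
  have e2 := congr_arg Prod.snd h
  simp only [Prod.fst_add, Prod.smul_fst, Prod.snd_add, Prod.smul_snd, smul_eq_mul] at e1 e2
  rw [Int.cast_smul_eq_zsmul] at e1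
  have e3 : n = n₁ + p * n₂ := by exact_mod_cast e2
  rw [b.height_add_zsmul e1, e3, smul_eq_mul]
  nlinarith [mul_nonneg hp h₂.le]

lemma exists_root_eq_smul_simple (x : ExtWeyl P) (j : AffineNode b) :
    ∃ (k : ι) (n : ℤ), x • simpleAffRoot b j = (P.root k, (n : ℂ)) := by
  obtain ⟨m, hm⟩ := exists_ext_smul_root x (nodeRoot b j)
  exact ⟨_, _, hm _⟩

/-- An element keeping the simple affine roots positive keeps all positive affine roots positive. -/
lemma isPosAff_smul_of_forall_simple {x : ExtWeyl P}
    (hx : ∀ j, IsPosAff b (x • simpleAffRoot b j)) {v : M × ℂ} (hv : IsPosAff b v) :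
    IsPosAff b (x • v) := by
  obtain ⟨k, n, rfl, -⟩ := id hv
  have hv' := (isPosAff_iff_height b k n).1 hv
  generalize hN : (b.height k + n * (b.height (highestRoot b) + 1)).toNat = H
  induction H using Nat.strong_induction_on generalizing k n with
  | _ H ih =>
    -- Unless v is the simple affine root at j, reflecting in that root keeps v positive and lowers
    -- the affine height by the pairing. So v is a smaller positive affine root plus a positive
    -- multiple of a simple one.
    obtain ⟨j, hj⟩ := exists_node_pairingIn_pos b k
    by_cases hc : (P.root k, (n : ℂ)) = simpleAffRoot b j
    · rw [hc]; exact hx j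
    have h1 := isPosAff_simpleReflection_smul b j _ hv hc
    have e1 : simpleReflection b j • (P.root k, (n : ℂ)) =
        (P.root k, (n : ℂ)) - ((P.pairingIn ℤ k (nodeRoot b j) : ℤ) : ℂ) • simpleAffRoot b j := by
      rw [simpleReflection_smul, cast_pairingIn]
      rfl
    obtain ⟨m, hm⟩ := exists_ext_smul_root (simpleReflection b j) k
    set k' := P.weylGroupToPerm (simpleReflection b j).right k
    have e2 := (hm n).symm.trans e1
    have e3 := congr_arg Prod.fst e2
    have e4 := congr_arg Prod.snd e2
    simp only [simpleAffRoot, Prod.fst_sub, Prod.smul_fst, Prod.snd_sub, Prod.smul_snd,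
      smul_eq_mul] at e3 e4
    rw [Int.cast_smul_eq_zsmul, sub_eq_add_neg, ← neg_smul] at e3
    have e5 : n + m = n - P.pairingIn ℤ k (nodeRoot b j) * nodeLevel b j := by exact_mod_cast e4
    have e6 := b.height_add_zsmul e3
    have e7 : b.height (nodeRoot b j) + nodeLevel b j * (b.height (highestRoot b) + 1) = 1 := by
      rcases j with _ | j
      · simp [nodeRoot, nodeLevel, height_neg]
      · simp [nodeRoot, nodeLevel, RootPairing.Base.height_one_of_mem_support j.2]
    have e8 : b.height k' + (n + m) * (b.height (highestRoot b) + 1) =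
        b.height k + n * (b.height (highestRoot b) + 1) - P.pairingIn ℤ k (nodeRoot b j) := by
      rw [e6, e5, smul_eq_mul]
      linear_combination (-P.pairingIn ℤ k (nodeRoot b j)) * e7
    rw [hm] at h1
    have h2 := (isPosAff_iff_height b _ _).1 h1
    have h3 := ih _ (by omega) k' (n + m) h1 h2 rfl
    have e9 : x • (P.root k, (n : ℂ)) = x • (P.root k', ((n + m : ℤ) : ℂ)) +
        ((P.pairingIn ℤ k (nodeRoot b j) : ℤ) : ℂ) • (x • simpleAffRoot b j) := by
      rw [e2, ext_smul_sub, ext_smul_smul, sub_add_cancel]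
    obtain ⟨m₁, hm₁⟩ := exists_ext_smul_root x k
    obtain ⟨m₂, hm₂⟩ := exists_ext_smul_root x k'
    obtain ⟨k₃, n₃, h₃⟩ := exists_root_eq_smul_simple b x j
    have h4 := hx j
    rw [h₃] at e9 h4
    rw [hm₂] at e9 h3
    rw [hm₁] at e9 ⊢
    exact isPosAff_add_smul b hj.le e9 h3 h4

/-- The translation by θ^∨ is s_0 s_θ, and conjugating by W keeps words available. If a root k' ≠ ±θ
has pairing ε = ±1 with θ^∨, then s_{k'} θ^∨ = θ^∨ - ε k'^∨ expresses k'^∨ through θ^∨ and a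
conjugate. Every root is W-conjugate to one that is not orthogonal to θ^∨. -/
lemma exists_word_translation_coroot (k : ι) :
    ∃ l, genProd (simpleReflection b) l =
      translation P ⟨P.coroot k, coroot_mem_coweightLattice P k⟩ := by
  have hR := affine_rootedGenerators b
  have conj : ∀ (w : P.weylGroup) (μ : coweightLattice P),
      (∃ l, genProd (simpleReflection b) l = translation P μ) →
      ∃ l, genProd (simpleReflection b) l =
        translation P ⟨coAct P w μ, coAct_mem_coweightLattice P w μ.2⟩ := by
    intro w μ h
    have h1 := RootedGenerators.isGen_mul (RootedGenerators.isGen_mul (exists_word_ofWeyl b w) h)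
      (hR.isGen_inv (exists_word_ofWeyl b w))
    rwa [ofWeyl_mul_translation, mul_inv_cancel_right] at h1
  have neg : ∀ μ : coweightLattice P, (∃ l, genProd (simpleReflection b) l = translation P μ) →
      ∃ l, genProd (simpleReflection b) l = translation P (-μ) := by
    intro μ h
    rw [translation_neg]
    exact hR.isGen_inv h
  have add : ∀ μ ν : coweightLattice P, (∃ l, genProd (simpleReflection b) l = translation P μ) →
      (∃ l, genProd (simpleReflection b) l = translation P ν) →
      ∃ l, genProd (simpleReflection b) l = translation P (μ + ν) := by
    intro μ ν h h'
    rw [translation_add]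
    exact RootedGenerators.isGen_mul h h'
  set θ := highestRoot b with hθ
  have hbase : ∃ l, genProd (simpleReflection b) l =
      translation P ⟨P.coroot θ, coroot_mem_coweightLattice P θ⟩ := by
    have h1 := RootedGenerators.isGen_mul (RootedGenerators.isGen_simple (s := simpleReflection b)
      none) (exists_word_ofWeyl b (RootPairing.weylGroup.ofIdx P θ))
    have h2 : simpleReflection b none * ofWeyl P (RootPairing.weylGroup.ofIdx P θ) =
        translation P ⟨P.coroot θ, coroot_mem_coweightLattice P θ⟩ := by
      rw [simpleReflection, mul_assoc, ← map_mul, ofIdx_sq, map_one, mul_one]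
    rwa [h2] at h1
  obtain ⟨w, hw⟩ := exists_pairing_ne_zero (P := P) k θ
  have main : ∀ k' : ι, P.pairingIn ℤ k' θ ≠ 0 → ∃ l, genProd (simpleReflection b) l =
      translation P ⟨P.coroot k', coroot_mem_coweightLattice P k'⟩ := by
    intro k' hk'
    by_cases h1 : k' = θ
    · rw [h1]; exact hbase
    by_cases h2 : P.root k' = -P.root θ
    · have h3 : k' = P.reflectionPerm θ θ := P.root.injective (by rw [h2, root_neg])
      have h4 := neg _ hbase
      convert h4
      rw [h3, coroot_neg]
      rfl
    have h3 := conj (RootPairing.weylGroup.ofIdx P k') _ hbase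
    have h4 : coAct P (RootPairing.weylGroup.ofIdx P k') (P.coroot θ) =
        P.coroot θ - (P.pairingIn ℤ k' θ) • P.coroot k' := by
      rw [coAct_ofIdx, P.root_coroot_eq_pairing, ← cast_pairingIn, Int.cast_smul_eq_zsmul]
    rcases lt_or_gt_of_ne hk' with h | h
    · have h5 := add _ _ h3 (neg _ hbase)
      convert h5
      simp only [AddSubgroup.coe_add, AddSubgroup.coe_neg]
      rw [h4, pairingIn_highestRoot_of_neg b h2 h]
      simp
    · have h5 := add _ _ hbase (neg _ h3)
      convert h5
      simp only [AddSubgroup.coe_add, AddSubgroup.coe_neg]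
      rw [h4, pairingIn_highestRoot_of_pos b h1 h]
      simp
  have h1 := main (P.weylGroupToPerm w k) (by
    rw [RootPairing.weylGroup_apply_root, P.root_coroot_eq_pairing, ← cast_pairingIn] at hw
    exact_mod_cast hw)
  have h2 := conj w⁻¹ _ h1
  convert h2
  simp only [← coAct_coroot_eq, ← coAct_mul, inv_mul_cancel, coAct_one]

/-- The affine Weyl group is generated by the simple affine reflections. -/
lemma mem_affineWeyl_iff_exists_word (x : ExtWeyl P) :
    x ∈ affineWeyl P ↔ ∃ l, genProd (simpleReflection b) l = x := by
  have hR := affine_rootedGenerators b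
  constructor
  · intro hx
    rw [← translation_mul_ofWeyl x]
    refine RootedGenerators.isGen_mul ?_ (exists_word_ofWeyl b _)
    have key : ∀ h : N, h ∈ corootLattice P → ∀ hc : h ∈ coweightLattice P,
        ∃ l, genProd (simpleReflection b) l = translation P ⟨h, hc⟩ := by
      intro h hh
      have hle : ∀ y ∈ corootLattice P, y ∈ coweightLattice P := by
        have : corootLattice P ≤ coweightLattice P := by
          rw [corootLattice, AddSubgroup.closure_le]
          rintro _ ⟨k, rfl⟩
          exact coroot_mem_coweightLattice P k
        exact this
      induction hh using AddSubgroup.closure_induction with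
      | mem y hy =>
        obtain ⟨k, rfl⟩ := hy
        exact fun _ => exists_word_translation_coroot b k
      | zero => exact fun _ => ⟨[], translation_zero.symm⟩
      | add y z hy hz ihy ihz =>
        intro _
        have := RootedGenerators.isGen_mul (ihy (hle y hy)) (ihz (hle z hz))
        rwa [← translation_add] at this
      | neg y hy ihy =>
        intro _
        have := hR.isGen_inv (ihy (hle y hy))
        rwa [← translation_neg] at this
    exact key _ hx _
  · rintro ⟨l, rfl⟩
    induction l with
    | nil => exact one_mem _
    | cons j l ih =>
      rw [genProd_cons]
      refine mul_mem ?_ ih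
      rcases j with _ | j
      · refine mul_mem ?_ (ofWeyl_mem_affineWeyl _)
        exact AddSubgroup.subset_closure ⟨_, rfl⟩
      · exact ofWeyl_mem_affineWeyl _

end Generation

end AffineNilHecke

end

noncomputable section

namespace AffineNilHecke

/-! ### Elements of length zero, special nodes and the group Σ. -/

section LengthZero

variable {ι M N : Type*} [AddCommGroup M] [Module ℂ M] [AddCommGroup N] [Module ℂ N]
  {P : RootPairing ι ℂ M N} [P.IsRootSystem] (b : P.Base) [Finite ι] [P.IsIrreducible]
  [P.IsCrystallographic]

/-- Elements of length zero: those that keep the simple affine roots positive. -/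
def IsLengthZero (x : ExtWeyl P) : Prop := ∀ j, IsPosAff b (x • simpleAffRoot b j)

/-- Elements that keep the simple roots of the finite root system positive. -/
def KeepsFinite (x : ExtWeyl P) : Prop := ∀ j : b.support, IsPosAff b (x • simpleAffRoot b (some j))

variable {b}

lemma IsLengthZero.keepsFinite {x : ExtWeyl P} (hx : IsLengthZero b x) : KeepsFinite b x :=
  fun j => hx (some j)

variable [P.IsReduced]

lemma IsLengthZero.isPosAff {x : ExtWeyl P} (hx : IsLengthZero b x) {v : M × ℂ}
    (hv : IsPosAff b v) : IsPosAff b (x • v) := isPosAff_smul_of_forall_simple b hx hv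

lemma IsLengthZero.isPosAff_inv {x : ExtWeyl P} (hx : IsLengthZero b x) {v : M × ℂ}
    (hv : IsPosAff b v) : IsPosAff b (x⁻¹ • v) := by
  obtain ⟨k, n, rfl, -⟩ := id hv
  by_contra hc
  rw [← isPosAff_smul_neg_iff] at hc
  have := hx.isPosAff hc
  rw [smul_inv_smul, isPosAff_neg_iff] at this
  exact this hv

lemma IsLengthZero.isPosAff_iff {x : ExtWeyl P} (hx : IsLengthZero b x) {v : M × ℂ} :
    IsPosAff b (x • v) ↔ IsPosAff b v :=
  ⟨fun h => by simpa using hx.isPosAff_inv h, hx.isPosAff⟩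

lemma IsLengthZero.mul {x y : ExtWeyl P} (hx : IsLengthZero b x) (hy : IsLengthZero b y) :
    IsLengthZero b (x * y) := fun j => by
  rw [mul_smul]
  exact hx.isPosAff (hy j)

lemma IsLengthZero.inv {x : ExtWeyl P} (hx : IsLengthZero b x) : IsLengthZero b x⁻¹ :=
  fun j => hx.isPosAff_inv (isPosAff_simpleAffRoot b j)

lemma IsLengthZero.eq_one {x : ExtWeyl P} (hx : IsLengthZero b x) (h : x ∈ affineWeyl P) :
    x = 1 :=
  (affine_rootedGenerators b).eq_one_of_forall_pos ((mem_affineWeyl_iff_exists_word b x).1 h) hx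

lemma simpleAffRoot_injective : Function.Injective (simpleAffRoot b) := by
  intro j k h
  have h1 := congr_arg Prod.snd h
  have h2 := congr_arg Prod.fst h
  rcases j with _ | j <;> rcases k with _ | k <;>
    simp [simpleAffRoot, nodeLevel, nodeRoot] at h1 h2 ⊢
  exact h2

lemma simpleReflection_mem_affineWeyl (j : AffineNode b) :
    simpleReflection b j ∈ affineWeyl P :=
  (mem_affineWeyl_iff_exists_word b _).2 (RootedGenerators.isGen_simple j)

lemma simpleReflection_ne_one (j : AffineNode b) : simpleReflection b j ≠ 1 := by
  intro h
  have h1 := (affine_rootedGenerators b).pos_smul_neg 1 j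
  rw [h] at h1
  simp [isPosAff_simpleAffRoot] at h1

/-- The reflection x s_j x⁻¹ is a nontrivial element of W_af, so it makes some α_k negative. As x
preserves positivity, s_j makes x⁻¹α_k negative, whence x⁻¹α_k = α_j. -/
lemma IsLengthZero.exists_node {x : ExtWeyl P} (hx : IsLengthZero b x) (j : AffineNode b) :
    ∃ k, x • simpleAffRoot b j = simpleAffRoot b k := by
  have hR := affine_rootedGenerators b
  have h1 : x * simpleReflection b j * x⁻¹ ∈ affineWeyl P :=
    affineWeyl_normal.conj_mem _ (simpleReflection_mem_affineWeyl j) x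
  have h2 : x * simpleReflection b j * x⁻¹ ≠ 1 := by
    intro h
    exact simpleReflection_ne_one j (by simpa [mul_inv_eq_one] using h)
  obtain ⟨k, hk⟩ := hR.exists_descent ((mem_affineWeyl_iff_exists_word b _).1 h1) h2
  refine ⟨k, ?_⟩
  rw [mul_smul, mul_smul, hx.isPosAff_iff] at hk
  rw [← hR.eq_simple (hx.inv k) hk, smul_inv_smul]

/-- An element of length zero permutes the simple affine roots. -/
lemma IsLengthZero.exists_perm {x : ExtWeyl P} (hx : IsLengthZero b x) :
    ∃ σ : Equiv.Perm (AffineNode b), ∀ j, x • simpleAffRoot b j = simpleAffRoot b (σ j) := by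
  choose f hf using hx.exists_node
  have hinj : Function.Injective f := by
    intro j k h
    apply simpleAffRoot_injective
    apply MulAction.injective x
    change x • _ = x • _
    rw [hf, hf, h]
  exact ⟨Equiv.ofBijective f (Finite.injective_iff_bijective.1 hinj), hf⟩

lemma isDiagramAut_of_smul {x : ExtWeyl P} {σ : Equiv.Perm (AffineNode b)}
    (h : ∀ j, x • simpleAffRoot b j = simpleAffRoot b (σ j)) : IsDiagramAut b σ := by
  intro j k
  have h1 : ∀ l, x.right • P.root (nodeRoot b l) = P.root (nodeRoot b (σ l)) := fun l =>
    congr_arg Prod.fst (h l)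
  rw [← P.root_coroot_eq_pairing, ← h1 j, pairing_smul_coroot (h1 k), P.root_coroot_eq_pairing]

lemma pairing_fundCoweight_some (i : b.support) (m : M) :
    P.toLinearMap m (fundCoweight b (some i) : N) = b.toWeightBasis.repr m i :=
  LinearMap.congr_fun (P.flip.toPerfPair.apply_symm_apply (b.toWeightBasis.coord i)) m

lemma pairing_root_fundCoweight (j : b.support) (s : AffineNode b) [Decidable (some j = s)] :
    P.toLinearMap (P.root j) (fundCoweight b s : N) = if some j = s then 1 else 0 := by
  rcases s with _ | i
  · simp [fundCoweight]
  · rw [pairing_fundCoweight_some, b.toWeightBasis_repr_root]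
    classical
    simp [Finsupp.single_apply]

lemma coweight_ext {h h' : N}
    (e : ∀ j : b.support, P.toLinearMap (P.root j) h = P.toLinearMap (P.root j) h') : h = h' := by
  apply eq_of_pairing_eq (P := P)
  have : P.toLinearMap.flip h = P.toLinearMap.flip h' := by
    apply b.toWeightBasis.ext
    intro j
    simpa using e j
  exact fun m => LinearMap.congr_fun this m

lemma fundCoweight_injective : Function.Injective (fun s => (fundCoweight b s : N)) := by
  classical
  intro s s' h
  have h1 : ∀ j : b.support, (if some j = s then (1 : ℂ) else 0) = if some j = s' then 1 else 0 := by
    intro j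
    rw [← pairing_root_fundCoweight, ← pairing_root_fundCoweight]
    exact congr_arg _ h
  rcases s with _ | s
  · rcases s' with _ | s'
    · rfl
    · simpa using h1 s'
  · have := h1 s
    simp only [if_true] at this
    by_contra hc
    rw [if_neg hc] at this
    exact one_ne_zero this

/-- The translation part of an element of length zero is a fundamental coweight. -/
lemma left_eq_fundCoweight {x : ExtWeyl P} {σ : Equiv.Perm (AffineNode b)}
    (h : ∀ j, x • simpleAffRoot b j = simpleAffRoot b (σ j)) :
    x.left.toAdd = fundCoweight b (σ none) := by
  classical
  apply Subtype.ext
  apply coweight_ext (b := b)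
  intro j
  -- The δ-coordinate at the node mapped to j shows that the translation part pairs with α_j to the
  -- level of σ⁻¹ j, which is 1 exactly when σ 0 = j.
  have h1 := h (σ.symm (some j))
  rw [Equiv.apply_symm_apply] at h1
  have h2 := congr_arg Prod.snd h1
  have h3 := congr_arg Prod.fst h1
  rw [ext_smul_def] at h2 h3
  simp only at h2 h3
  rw [h3] at h2
  simp only [simpleAffRoot, nodeRoot, nodeLevel] at h2
  rw [pairing_root_fundCoweight]
  have h4 : (some j = σ none) ↔ σ.symm (some j) = none := by rw [Equiv.symm_apply_eq]
  simp only [h4]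
  generalize σ.symm (some j) = k at h2
  rcases k with _ | k
  · simp only [Int.cast_one, Int.cast_zero] at h2
    simp only [if_true]
    linear_combination -h2
  · simp only [Int.cast_zero] at h2
    simp only [reduceCtorEq, if_false]
    linear_combination -h2

lemma KeepsFinite.isPosAff {x : ExtWeyl P} (hx : KeepsFinite b x) {k : ι} (hk : 0 < b.height k) :
    IsPosAff b (x • (P.root k, (0 : ℂ))) := by
  refine RootPairing.Base.IsPos.induction_on_add (b := b)
    (p := fun k => IsPosAff b (x • (P.root k, (0 : ℂ)))) hk (fun i hi => ?_)
    fun i j k h hi hj => ?_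
  · simpa [simpleAffRoot, nodeRoot, nodeLevel] using hx ⟨i, hi⟩
  · have h2 := hx ⟨j, hj⟩
    simp only [simpleAffRoot, nodeRoot, nodeLevel] at h2
    obtain ⟨m₁, h₁⟩ := exists_ext_smul_root x i
    obtain ⟨m₂, h₂⟩ := exists_ext_smul_root x j
    obtain ⟨m₃, h₃⟩ := exists_ext_smul_root x k
    have e : x • (P.root k, ((0 : ℤ) : ℂ)) =
        x • (P.root i, ((0 : ℤ) : ℂ)) + ((1 : ℤ) : ℂ) • x • (P.root j, ((0 : ℤ) : ℂ)) := by
      rw [← ext_smul_smul, ← ext_smul_add, h]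
      simp
    rw [← Int.cast_zero] at hi ⊢
    rw [h₁, h₂, h₃] at e
    rw [h₁] at hi
    rw [h₂] at h2
    rw [h₃]
    exact isPosAff_add_smul b zero_le_one e hi h2

/-- There is at most one `u` such that `t_λ u` keeps finite positive roots positive. -/
lemma KeepsFinite.eq_one {x : ExtWeyl P} (hx : KeepsFinite b x) {w : P.weylGroup}
    (hw : KeepsFinite b (x * ofWeyl P w)) : w = 1 := by
  by_contra hc
  obtain ⟨j, hj⟩ := (finite_rootedGenerators b).exists_descent (exists_finite_word b w) hc
  have h1 := hw j
  simp only [simpleAffRoot, nodeRoot, nodeLevel, mul_smul, ofWeyl_smul, Int.cast_zero] at h1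
  rw [RootPairing.weylGroup_apply_root, isPosAff_finite_iff] at hj
  rw [RootPairing.weylGroup_apply_root] at h1
  set k := P.weylGroupToPerm w j
  have h2 : 0 < b.height (P.reflectionPerm k k) := by
    rw [height_neg]
    have := b.height_ne_zero k
    omega
  have h3 := hx.isPosAff h2
  have h4 : (P.root (P.reflectionPerm k k), (0 : ℂ)) = -(P.root k, ((0 : ℤ) : ℂ)) := by
    rw [root_neg]; simp
  rw [h4, isPosAff_smul_neg_iff] at h3
  exact h3 (by simpa using h1)

lemma finite_inversions (x : ExtWeyl P) :
    {v : M × ℂ | IsPosAff b v ∧ ¬ IsPosAff b (x • v)}.Finite := by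
  choose m hm using exists_ext_smul_root x
  refine Set.Finite.subset (Set.finite_iUnion fun k : ι =>
    (Set.finite_Icc 0 (-m k)).image fun n : ℤ => (P.root k, (n : ℂ))) ?_
  rintro v ⟨hv, hxv⟩
  obtain ⟨k, n, rfl, -⟩ := id hv
  rw [hm, isPosAff_iff] at hxv
  rw [isPosAff_iff] at hv
  refine Set.mem_iUnion.2 ⟨k, n, ?_, rfl⟩
  rw [Set.mem_Icc]
  omega

/-- The generators of the finite Weyl group inside the extended affine Weyl group. -/
lemma finite_rootedGenerators' :
    RootedGenerators (G := ExtWeyl P) (IsPosAff b) (fun j : b.support => simpleAffRoot b (some j))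
      (fun j => simpleReflection b (some j)) where
  sq _ := (affine_rootedGenerators b).sq _
  pos_simple _ := (affine_rootedGenerators b).pos_simple _
  pos_smul_neg x _ := (affine_rootedGenerators b).pos_smul_neg x _
  pos_smul _ := (affine_rootedGenerators b).pos_smul _
  conj x _ _ := (affine_rootedGenerators b).conj x _ _

lemma exists_keepsFinite (x : ExtWeyl P) : ∃ w : P.weylGroup, KeepsFinite b (x * ofWeyl P w) := by
  obtain ⟨l, hl⟩ := (finite_rootedGenerators' (b := b)).exists_mul_forall_pos x (finite_inversions x)
  refine ⟨genProd (fun j : b.support => RootPairing.weylGroup.ofIdx P (j : ι)) l, fun j => ?_⟩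
  rw [← genProd_map_some b l]
  have h1 := hl j
  have h2 : genProd (simpleReflection b) (l.map some) =
      genProd (fun j => simpleReflection b (some j)) l := by
    rw [genProd, genProd, List.map_map]
    rfl
  rwa [h2]

lemma exists_isLengthZero (x : ExtWeyl P) :
    ∃ y ∈ affineWeyl P, IsLengthZero b (x * y) := by
  obtain ⟨l, hl⟩ := (affine_rootedGenerators b).exists_mul_forall_pos x (finite_inversions x)
  exact ⟨_, (mem_affineWeyl_iff_exists_word b _).2 ⟨l, rfl⟩, hl⟩

lemma translation_mul_ofWeyl_smul_root (μ : coweightLattice P) (u : P.weylGroup) (j : ι) :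
    (translation P μ * ofWeyl P u) • (P.root j, (0 : ℂ)) =
      (P.root (P.weylGroupToPerm u j), -P.toLinearMap (P.root j) (coAct P u⁻¹ μ)) := by
  rw [mul_smul, ofWeyl_smul, translation_smul, pairing_coAct, inv_inv,
    RootPairing.weylGroup_apply_root, zero_sub]

lemma isAntidominant_of_keepsFinite {μ : coweightLattice P} {u : P.weylGroup}
    (h : KeepsFinite b (translation P μ * ofWeyl P u)) : IsAntidominant b (coAct P u⁻¹ μ) := by
  intro j
  have h1 := h j
  simp only [simpleAffRoot, nodeRoot, nodeLevel, Int.cast_zero,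
    translation_mul_ofWeyl_smul_root] at h1
  obtain ⟨n, hn⟩ := coAct_mem_coweightLattice P u⁻¹ μ.2 j
  rw [hn, ← Int.cast_neg, isPosAff_iff] at h1
  refine ⟨(-n).toNat, ?_⟩
  rw [hn, ← Int.cast_natCast, Int.toNat_of_nonneg (by omega)]
  simp

lemma weylLength_eq (u : P.weylGroup) : weylLength b u =
    genLength (fun j : b.support => RootPairing.weylGroup.ofIdx P (j : ι)) u := by
  unfold weylLength genLength genProd
  congr! 6 with n l
  simp [← List.map_eq_flatMap]

/-- The element t_ϖ u sends α_j to uα_j - ⟨α_j, u⁻¹ϖ⟩δ. Positivity for all j says that u⁻¹ϖ is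
anti-dominant and that uα_j > 0 wherever the pairing vanishes. A shortest u has the second property,
since otherwise u s_j would be shorter with the same u⁻¹ϖ. Conversely, at most one u keeps the
simple roots positive. -/
lemma isShortestAntidominant_iff (s : AffineNode b) (u : P.weylGroup) :
    IsShortestAntidominant b s u ↔
      KeepsFinite b (translation P (fundCoweight b s) * ofWeyl P u) := by
  have hR := finite_rootedGenerators b
  have h1 : ∀ u, IsShortestAntidominant b s u →
      KeepsFinite b (translation P (fundCoweight b s) * ofWeyl P u) := by
    intro u hu j
    simp only [simpleAffRoot, nodeRoot, nodeLevel, Int.cast_zero, translation_mul_ofWeyl_smul_root]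
    obtain ⟨n, hn⟩ := hu.1 j
    rw [hn, neg_neg, ← Int.cast_natCast, isPosAff_iff]
    rcases Nat.eq_zero_or_pos n with rfl | hn0
    · refine Or.inr ⟨rfl, ?_⟩
      by_contra hc
      have h2 := hR.genLength_mul_of_not_pos (exists_finite_word b u) (j := j) (by
        rwa [RootPairing.weylGroup_apply_root, isPosAff_finite_iff])
      have h3 := hu.2 (u * RootPairing.weylGroup.ofIdx P j) (by
        have e : (RootPairing.weylGroup.ofIdx P (j : ι))⁻¹ = RootPairing.weylGroup.ofIdx P j :=
          hR.inv j
        rw [mul_inv_rev, coAct_mul, e, coAct_ofIdx, hn]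
        simpa using hu.1)
      rw [weylLength_eq, weylLength_eq] at h3
      omega
    · exact Or.inl (by exact_mod_cast hn0)
  refine ⟨h1 u, fun hu => ?_⟩
  have hne : ∃ n, ∃ u', IsAntidominant b (coAct P u'⁻¹ (fundCoweight b s)) ∧
      weylLength b u' = n := ⟨_, u, isAntidominant_of_keepsFinite hu, rfl⟩
  classical
  obtain ⟨u', hu', hn⟩ := Nat.find_spec hne
  have h2 : IsShortestAntidominant b s u' :=
    ⟨hu', fun u'' h => hn.trans_le (Nat.find_min' hne ⟨u'', h, rfl⟩)⟩
  have h3 := h1 u' h2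
  have h4 := hu.eq_one (w := u⁻¹ * u') (by
    rwa [mul_assoc, ← map_mul, mul_inv_cancel_left])
  rw [← inv_mul_eq_one.1 h4] at h2
  exact h2

lemma existsUnique_isShortestAntidominant (s : AffineNode b) :
    ∃! u, IsShortestAntidominant b s u := by
  simp only [isShortestAntidominant_iff]
  obtain ⟨u, hu⟩ := exists_keepsFinite (b := b) (translation P (fundCoweight b s))
  refine ⟨u, hu, fun u' hu' => ?_⟩
  have := hu.eq_one (w := u⁻¹ * u') (by rwa [mul_assoc, ← map_mul, mul_inv_cancel_left])
  exact (inv_mul_eq_one.1 this).symm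

lemma keepsFinite_piElt (s : AffineNode b) : KeepsFinite b (piElt b s) :=
  (isShortestAntidominant_iff s _).1
    (Classical.epsilon_spec (existsUnique_isShortestAntidominant s).exists)

lemma piElt_left (s : AffineNode b) : (piElt b s).left.toAdd = fundCoweight b s := by
  rw [piElt]
  apply Subtype.ext
  rw [coe_mul_left]
  change (fundCoweight b s : N) + coAct P 1 0 = _
  simp

lemma piElt_right (s : AffineNode b) : (piElt b s).right = uElt b s := by
  simp [piElt, translation, ofWeyl]

/-- An element of length zero is `π_s` for a special node `s`. -/
lemma IsLengthZero.exists_eq_piElt {x : ExtWeyl P} (hx : IsLengthZero b x) :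
    ∃ s, IsSpecial b s ∧ x = piElt b s := by
  obtain ⟨σ, hσ⟩ := hx.exists_perm
  refine ⟨σ none, ⟨σ, isDiagramAut_of_smul hσ, rfl⟩, ?_⟩
  have h1 : x = translation P (fundCoweight b (σ none)) * ofWeyl P x.right := by
    rw [← left_eq_fundCoweight hσ, translation_mul_ofWeyl]
  have h2 : x = piElt b (σ none) * ofWeyl P ((uElt b (σ none))⁻¹ * x.right) := by
    rw [piElt, mul_assoc, ← map_mul, mul_inv_cancel_left]
    exact h1
  have h3 := (keepsFinite_piElt (σ none)).eq_one (w := (uElt b (σ none))⁻¹ * x.right)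
    (h2 ▸ hx.keepsFinite)
  rwa [h3, map_one, mul_one] at h2

lemma re_pairing_fundCoweight_nonneg (s : AffineNode b) {k : ι} (hk : 0 < b.height k) :
    0 ≤ (P.toLinearMap (P.root k) (fundCoweight b s : N)).re := by
  classical
  refine RootPairing.Base.IsPos.induction_on_add (b := b)
    (p := fun k => 0 ≤ (P.toLinearMap (P.root k) (fundCoweight b s : N)).re) hk (fun i hi => ?_)
    fun i j k h hi hj => ?_
  · rw [pairing_root_fundCoweight ⟨i, hi⟩]
    split_ifs <;> simp
  · rw [h, map_add, LinearMap.add_apply, Complex.add_re, pairing_root_fundCoweight ⟨j, hj⟩]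
    split_ifs <;> simp <;> linarith

lemma root_eq_sum (k : ι) : P.root k =
    ∑ j : b.support, P.toLinearMap (P.root k) (fundCoweight b (some j) : N) • P.root j := by
  conv_lhs => rw [← b.toWeightBasis.sum_repr (P.root k)]
  simp only [pairing_fundCoweight_some, RootPairing.Base.toWeightBasis_apply]

lemma eq_zero_of_pairing_coroot_eq_zero {m : M}
    (h : ∀ j : b.support, P.toLinearMap m (P.coroot j) = 0) : m = 0 := by
  have h1 : P.toLinearMap m = 0 := by
    apply b.toCoweightBasis.ext
    intro j
    simpa using h j
  exact P.toPerfPair.injective (h1.trans (map_zero P.toPerfPair).symm)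

/-- The mark of a special node is one. -/
lemma pairing_highestRoot_of_isSpecial {s : b.support} (hs : IsSpecial b (some s)) :
    P.toLinearMap (P.root (highestRoot b)) (fundCoweight b (some s) : N) = 1 := by
  classical
  obtain ⟨σ, hσ, hs⟩ := hs
  set θ := highestRoot b with hθ
  have hc : ∀ s : AffineNode b, ∃ n : ℕ,
      P.toLinearMap (P.root θ) (fundCoweight b s : N) = n := by
    intro s
    obtain ⟨n, hn⟩ := (fundCoweight b s).2 θ
    have h1 := re_pairing_fundCoweight_nonneg s (height_highestRoot_pos b)
    rw [← hθ, hn, Complex.intCast_re] at h1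
    have h2 : 0 ≤ n := by exact_mod_cast h1
    exact ⟨n.toNat, by rw [hn, ← Int.cast_natCast, Int.toNat_of_nonneg h2]⟩
  choose c hc using hc
  -- The marks: 1 at node 0 and the coefficients of θ elsewhere, so that Σ m_k α_k = 0. Since σ
  -- preserves the Cartan matrix, Σ m_k α_{σ k} is orthogonal to all simple coroots and vanishes
  -- too.
  let m : AffineNode b → ℕ := fun s => s.elim 1 fun j => c (some j)
  have hm : ∑ k, (m k : ℂ) • P.root (nodeRoot b k) = 0 := by
    rw [Fintype.sum_option]
    have h1 := root_eq_sum (b := b) θ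
    simp only [hc] at h1
    simp only [m, nodeRoot, Option.elim, root_neg, ← hθ]
    rw [← h1]
    simp
  have hv : ∑ k, (m k : ℂ) • P.root (nodeRoot b (σ k)) = 0 := by
    apply eq_zero_of_pairing_coroot_eq_zero (b := b)
    intro j
    have h1 := congr_arg
      (fun v => P.toLinearMap v (P.coroot (nodeRoot b (σ.symm (some j))))) hm
    simp only [map_sum, map_smul, LinearMap.sum_apply, LinearMap.smul_apply,
      P.root_coroot_eq_pairing, map_zero, LinearMap.zero_apply] at h1
    simp only [map_sum, map_smul, LinearMap.sum_apply, LinearMap.smul_apply,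
      P.root_coroot_eq_pairing]
    rw [← h1]
    refine Finset.sum_congr rfl fun k _ => ?_
    rw [← hσ k (σ.symm (some j)), Equiv.apply_symm_apply]
    rfl
  have h2 := congr_arg (fun v => P.toLinearMap v (fundCoweight b (some s) : N)) hv
  simp only [map_sum, map_smul, LinearMap.sum_apply, LinearMap.smul_apply, map_zero,
    LinearMap.zero_apply] at h2
  have h3 : ∑ k, (m k : ℂ) • P.toLinearMap (P.root (nodeRoot b (σ k))) (fundCoweight b (some s) : N)
      = ∑ k, (m (σ.symm k) : ℂ) •
        P.toLinearMap (P.root (nodeRoot b k)) (fundCoweight b (some s) : N) := by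
    rw [← Equiv.sum_comp σ (fun k => (m (σ.symm k) : ℂ) •
        P.toLinearMap (P.root (nodeRoot b k)) (fundCoweight b (some s) : N))]
    simp only [Equiv.symm_apply_apply]
  rw [h3, Fintype.sum_option] at h2
  simp only [nodeRoot, root_neg, map_neg, LinearMap.neg_apply, ← hθ, hc,
    pairing_root_fundCoweight] at h2
  simp only [Option.some.injEq, smul_eq_mul, mul_ite, mul_one, mul_zero, Finset.sum_ite_eq',
    Finset.mem_univ, if_true] at h2
  -- Pairing the permuted relation with ϖ_s^∨ gives m(σ⁻¹ s) = m(σ⁻¹ 0) c_s. The left side is the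
  -- mark of node 0, namely 1, and the factors on the right are natural numbers.
  have h4 : m (σ.symm (some s)) = 1 := by
    rw [← hs, Equiv.symm_apply_apply]
    rfl
  rw [h4] at h2
  have h5 : m (σ.symm none) * c (some s) = 1 := by
    have : ((m (σ.symm none) * c (some s) : ℕ) : ℂ) = ((1 : ℕ) : ℂ) := by
      push_cast at h2 ⊢
      linear_combination -h2
    exact_mod_cast this
  rw [hc, Nat.eq_one_of_mul_eq_one_left h5, Nat.cast_one]

/-- The elements `π_s`, for special nodes `s`, have length zero. -/
lemma isLengthZero_piElt {s : AffineNode b} (hs : IsSpecial b s) : IsLengthZero b (piElt b s) := by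
  classical
  intro j
  rcases j with _ | j
  swap
  · exact keepsFinite_piElt s j
  set θ := highestRoot b with hθ
  set u := uElt b s with hu
  have hle : (P.toLinearMap (P.root θ) (fundCoweight b s : N)).re ≤ 1 := by
    rcases s with _ | s
    · simp [fundCoweight]
    · rw [pairing_highestRoot_of_isSpecial hs, Complex.one_re]
  have hdom : ∀ j ∈ b.support, 0 ≤ P.pairingIn ℤ θ j := by
    intro j hj
    have h1 := pairingIn_highestRoot_nonneg b (k := j) (by
      rw [RootPairing.Base.height_one_of_mem_support hj]; exact one_pos)
    rw [← hθ] at h1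
    by_contra! hc
    have h2 := (P.pairingIn_lt_zero_iff ℤ (i := θ) (j := j)).1 hc
    omega
  -- With n = ⟨uθ, ϖ_s^∨⟩, the image of α_0 is -uθ + (1 + n)δ. As θ is dominant and pairs to at most
  -- 1 with ϖ_s^∨, n ≥ -1. If n = -1, then uθ is negative because ϖ_s^∨ is dominant, and -uθ is a
  -- positive root.
  obtain ⟨n, hn⟩ := (fundCoweight b s).2 (P.weylGroupToPerm u θ)
  have h1 : piElt b s • simpleAffRoot b none =
      (P.root (P.reflectionPerm (P.weylGroupToPerm u θ) (P.weylGroupToPerm u θ)),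
        ((1 + n : ℤ) : ℂ)) := by
    simp only [simpleAffRoot, nodeRoot, nodeLevel, piElt, mul_smul, ofWeyl_smul, translation_smul,
      root_neg, ← hθ, smul_neg, RootPairing.weylGroup_apply_root, ← hu, map_neg,
      LinearMap.neg_apply, hn]
    push_cast
    ring_nf
  have h2 := re_pairing_smul_le b hdom (fun k hk => re_pairing_fundCoweight_nonneg s hk)
    (u * RootPairing.weylGroup.ofIdx P θ)
  have h3 : (u * RootPairing.weylGroup.ofIdx P θ) • P.root θ =
      -P.root (P.weylGroupToPerm u θ) := by
    rw [mul_smul, ofIdx_smul_root, root_neg, smul_neg, RootPairing.weylGroup_apply_root]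
  rw [h3, map_neg, LinearMap.neg_apply, hn, Complex.neg_re, Complex.intCast_re] at h2
  have h4 : -n ≤ 1 := by
    have : -(n : ℝ) ≤ 1 := h2.trans hle
    exact_mod_cast this
  rw [h1, isPosAff_iff, height_neg]
  by_cases h5 : 0 < b.height (P.weylGroupToPerm u θ)
  · have h6 := re_pairing_fundCoweight_nonneg s h5
    rw [hn, Complex.intCast_re] at h6
    have h7 : 0 ≤ n := by exact_mod_cast h6
    omega
  · have := b.height_ne_zero (P.weylGroupToPerm u θ)
    omega

/-- On this description of Σ, closure under products and inverses is evident. -/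
lemma mem_sigmaSet_iff (x : ExtWeyl P) : x ∈ sigmaSet b ↔ IsLengthZero b x := by
  constructor
  · rintro ⟨s, hs, rfl⟩
    exact isLengthZero_piElt hs
  · exact fun h => h.exists_eq_piElt

/-- The special node attached to `i` exists and is unique. -/
lemma existsUnique_isSpecialFor (i : b.support) : ∃! s, IsSpecialFor b i s := by
  obtain ⟨y, hy, hz⟩ := exists_isLengthZero (b := b) (translation P (fundCoweight b (some i)))
  obtain ⟨s, hs, he⟩ := hz.exists_eq_piElt
  refine ⟨s, ⟨hs, ?_⟩, ?_⟩
  · have h1 : (piElt b s)⁻¹ * translation P (fundCoweight b (some i)) ∈ affineWeyl P := by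
      rw [← he, mul_inv_rev, inv_mul_cancel_right]
      exact inv_mem hy
    rwa [inv_mul_mem_affineWeyl_iff, piElt_left] at h1
  -- For two candidates, π_s⁻¹ π_{s'} has length zero and lies in W_af, hence is 1; the translation
  -- part of π_s then determines s.
  · rintro s' ⟨hs', h'⟩
    have h1 : (piElt b s)⁻¹ * translation P (fundCoweight b (some i)) ∈ affineWeyl P := by
      rw [← he, mul_inv_rev, inv_mul_cancel_right]
      exact inv_mem hy
    have h2 : (piElt b s')⁻¹ * translation P (fundCoweight b (some i)) ∈ affineWeyl P := by
      rw [inv_mul_mem_affineWeyl_iff, piElt_left]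
      exact h'
    have h3 := mul_mem h1 (inv_mem h2)
    rw [mul_inv_rev, inv_inv, mul_assoc, mul_inv_cancel_left] at h3
    have h4 := ((isLengthZero_piElt hs).inv.mul (isLengthZero_piElt hs')).eq_one h3
    have h5 : piElt b s = piElt b s' := inv_mul_eq_one.1 h4
    apply fundCoweight_injective (b := b)
    simp only
    rw [← piElt_left, ← piElt_left, h5]

lemma isSpecialFor_specialNode (i : b.support) : IsSpecialFor b i (specialNode b i) :=
  Classical.epsilon_spec (existsUnique_isSpecialFor i).exists

/-- Σ meets W_af only in 1. This forces the choice made in `decomp` and leaves a single value in the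
infimum defining `extLength`. -/
lemma eq_of_isLengthZero_mul_eq {x y v w : ExtWeyl P} (hx : IsLengthZero b x)
    (hy : IsLengthZero b y) (hv : v ∈ affineWeyl P) (hw : w ∈ affineWeyl P)
    (h : x * v = y * w) : x = y ∧ v = w := by
  have h1 : y⁻¹ * x = w * v⁻¹ := by
    rw [inv_mul_eq_iff_eq_mul, ← mul_assoc, ← h, mul_inv_cancel_right]
  have h2 := (hy.inv.mul hx).eq_one (h1 ▸ mul_mem hw (inv_mem hv))
  have h3 : y = x := inv_mul_eq_one.1 h2
  subst h3
  exact ⟨rfl, mul_left_cancel h⟩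

lemma decomp_eq {x v : ExtWeyl P} (hx : IsLengthZero b x) (hv : v ∈ affineWeyl P) :
    decomp b (x * v) = (x, v) := by
  have h := Classical.epsilon_spec (p := fun p : ExtWeyl P × ExtWeyl P =>
    p.1 ∈ sigmaSet b ∧ p.2 ∈ affineWeyl P ∧ x * v = p.1 * p.2)
    ⟨(x, v), (mem_sigmaSet_iff x).2 hx, hv, rfl⟩
  obtain ⟨h1, h2, h3⟩ := h
  obtain ⟨h4, h5⟩ := eq_of_isLengthZero_mul_eq hx ((mem_sigmaSet_iff _).1 h1) hv h2 h3
  exact (Prod.ext h4 h5).symm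

lemma exists_eq_mul (x : ExtWeyl P) :
    ∃ π v, IsLengthZero b π ∧ v ∈ affineWeyl P ∧ x = π * v := by
  obtain ⟨y, hy, hz⟩ := exists_isLengthZero (b := b) x
  exact ⟨_, y⁻¹, hz, inv_mem hy, by simp⟩

lemma extLength_mul {x v : ExtWeyl P} (hx : IsLengthZero b x) (hv : v ∈ affineWeyl P) :
    extLength b (x * v) = affLength b v := by
  have : {n | ∃ σ ∈ sigmaSet b, ∃ w ∈ affineWeyl P, x * v = σ * w ∧ affLength b w = n} =
      {affLength b v} := by
    ext n
    constructor
    · rintro ⟨σ, hσ, w, hw, h, rfl⟩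
      rw [(eq_of_isLengthZero_mul_eq hx ((mem_sigmaSet_iff _).1 hσ) hv hw h).2]
      rfl
    · rintro rfl
      exact ⟨x, (mem_sigmaSet_iff x).2 hx, v, hv, rfl, rfl⟩
  rw [extLength, this, csInf_singleton]

lemma affLength_mul_simple {x : ExtWeyl P} (hx : x ∈ affineWeyl P) {j : AffineNode b}
    (hp : IsPosAff b (x • simpleAffRoot b j)) :
    affLength b (x * simpleReflection b j) = affLength b x + 1 :=
  (affine_rootedGenerators b).genLength_mul_of_pos ((mem_affineWeyl_iff_exists_word b x).1 hx) hp

lemma affLength_mul_simple' {x : ExtWeyl P} (hx : x ∈ affineWeyl P) {j : AffineNode b}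
    (hp : ¬ IsPosAff b (x • simpleAffRoot b j)) :
    affLength b (x * simpleReflection b j) + 1 = affLength b x :=
  (affine_rootedGenerators b).genLength_mul_of_not_pos
    ((mem_affineWeyl_iff_exists_word b x).1 hx) hp

/-- A minimal element of xW has no descent among the finite simple reflections, and by
`KeepsFinite.eq_one` a coset contains only one element without such a descent. -/
lemma mem_affGrassmannian_iff (x : ExtWeyl P) :
    x ∈ affGrassmannian b ↔ x ∈ affineWeyl P ∧ KeepsFinite b x := by
  refine and_congr_right fun hx => ⟨fun h j => ?_, fun h u => ?_⟩
  · by_contra hc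
    have h1 := affLength_mul_simple' hx hc
    have h2 := h (RootPairing.weylGroup.ofIdx P j)
    change affLength b x ≤ affLength b (x * simpleReflection b (some j)) at h2
    omega
  · have hne : ∃ n, ∃ u, affLength b (x * ofWeyl P u) = n := ⟨_, 1, rfl⟩
    classical
    obtain ⟨u₀, hu₀⟩ := Nat.find_spec hne
    have hmin : ∀ u, affLength b (x * ofWeyl P u₀) ≤ affLength b (x * ofWeyl P u) := fun u =>
      hu₀.trans_le (Nat.find_min' hne ⟨u, rfl⟩)
    have h1 : KeepsFinite b (x * ofWeyl P u₀) := by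
      intro j
      by_contra hc
      have h2 := affLength_mul_simple' (mul_mem hx (ofWeyl_mem_affineWeyl u₀)) hc
      have h3 := hmin (u₀ * RootPairing.weylGroup.ofIdx P j)
      rw [map_mul, ← mul_assoc] at h3
      change _ ≤ affLength b (x * ofWeyl P u₀ * simpleReflection b (some j)) at h3
      omega
    rw [h.eq_one h1] at hmin
    simpa using hmin u

lemma mem_extGrassmannian_iff (x : ExtWeyl P) : x ∈ extGrassmannian b ↔ KeepsFinite b x := by
  obtain ⟨π, v, hπ, hv, rfl⟩ := exists_eq_mul (b := b) x
  have h1 : π * v ∈ extGrassmannian b ↔ v ∈ affGrassmannian b := by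
    refine ⟨fun h => ⟨hv, fun u => ?_⟩, fun h u => ?_⟩
    · have := h u
      rwa [mul_assoc, extLength_mul hπ hv, extLength_mul hπ (mul_mem hv (ofWeyl_mem_affineWeyl u))]
        at this
    · rw [mul_assoc, extLength_mul hπ hv, extLength_mul hπ (mul_mem hv (ofWeyl_mem_affineWeyl u))]
      exact h.2 u
  rw [h1, mem_affGrassmannian_iff, and_iff_right hv]
  refine forall_congr' fun j => ?_
  rw [mul_smul, hπ.isPosAff_iff]

lemma isLengthZero_piElt_specialNode (i : b.support) :
    IsLengthZero b (piElt b (specialNode b i)) :=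
  isLengthZero_piElt (isSpecialFor_specialNode i).1

lemma kappa_mem_affineWeyl (i : b.support) : kappa b i ∈ affineWeyl P := by
  rw [kappa, left_sub_mem_iff, piElt_left]
  have := (isSpecialFor_specialNode i).2
  have := neg_mem this
  rw [neg_sub] at this
  rwa [sub_eq_add_neg] at this

lemma translation_neg_smul_simple (i j : b.support) [Decidable (j = i)] :
    translation P (-fundCoweight b (some i)) • simpleAffRoot b (some j) =
      (P.root j, ((if j = i then 1 else 0 : ℤ) : ℂ)) := by
  rw [translation_smul]
  classical
  simp only [simpleAffRoot, nodeRoot, nodeLevel, AddSubgroup.coe_neg, map_neg,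
    pairing_root_fundCoweight, Option.some.injEq]
  split_ifs <;> simp

/-- The translation by -ϖ_i^∨ fixes α_j for j ≠ i and raises α_i by δ, and π_{i^s} preserves
positivity. -/
lemma kappa_mem_affGrassmannian (i : b.support) : kappa b i ∈ affGrassmannian b := by
  classical
  refine (mem_affGrassmannian_iff _).2 ⟨kappa_mem_affineWeyl i, fun j => ?_⟩
  rw [kappa, mul_smul, (isLengthZero_piElt_specialNode i).isPosAff_iff,
    translation_neg_smul_simple, isPosAff_iff]
  split_ifs
  · exact Or.inl one_pos
  · refine Or.inr ⟨rfl, ?_⟩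
    rw [RootPairing.Base.height_one_of_mem_support j.2]
    exact one_pos

end LengthZero

end AffineNilHecke

end

noncomputable section

namespace AffineNilHecke

/-! ### Arithmetic in the twisted group algebra. -/

section TwistedBasics

variable {ι M N : Type*} [AddCommGroup M] [Module ℂ M] [AddCommGroup N] [Module ℂ N]
  {P : RootPairing ι ℂ M N}

lemma scalar_mul (f g : SReg P) : scalar P f * scalar P g = scalar P (f * g) := by
  simp [scalar, SkewMonoidAlgebra.single_mul_single]

lemma scalar_one : scalar P 1 = 1 := rfl

lemma scalar_zero : scalar P 0 = 0 := SkewMonoidAlgebra.single_zero _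

lemma scalar_add (f g : SReg P) : scalar P (f + g) = scalar P f + scalar P g :=
  SkewMonoidAlgebra.single_add _ _ _

lemma scalar_neg (f : SReg P) : scalar P (-f) = -scalar P f :=
  SkewMonoidAlgebra.single_neg _ _

lemma grp_one : grp P 1 = 1 := rfl

lemma grp_mul (x y : ExtWeyl P) : grp P x * grp P y = grp P (x * y) := by
  simp [grp, SkewMonoidAlgebra.single_mul_single]

lemma grp_mul_scalar (x : ExtWeyl P) (f : SReg P) :
    grp P x * scalar P f = scalar P (x • f) * grp P x := by
  simp [grp, scalar, SkewMonoidAlgebra.single_mul_single]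

lemma single_eq (x : ExtWeyl P) (f : SReg P) :
    (SkewMonoidAlgebra.single x f : TwistedAlg P) = scalar P f * grp P x := by
  simp [grp, scalar, SkewMonoidAlgebra.single_mul_single]

lemma smul_eq_scalar_mul (f : SRing P) (a : TwistedAlg P) :
    f • a = scalar P (algebraMap (SRing P) (SReg P) f) * a := by
  ext x
  rw [scalar, SkewMonoidAlgebra.coeff_single_one_mul]
  simp [Algebra.smul_def]

/-- A weight as an element of `S^reg`. -/
def wt (P : RootPairing ι ℂ M N) (m : M) : SReg P :=
  algebraMap (SRing P) (SReg P) (SymmetricAlgebra.ι ℂ M m)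

/-- A complex number as an element of `S^reg`. -/
def const (P : RootPairing ι ℂ M N) (c : ℂ) : SReg P :=
  algebraMap (SRing P) (SReg P) (algebraMap ℂ (SRing P) c)

lemma wt_sub (m m' : M) : wt P (m - m') = wt P m - wt P m' := by simp [wt]

lemma wt_neg (m : M) : wt P (-m) = -wt P m := by simp [wt]

lemma wt_smul (c : ℂ) (m : M) : wt P (c • m) = const P c * wt P m := by
  simp [wt, const, Algebra.smul_def]

lemma ext_smul_algebraMap (x : ExtWeyl P) (f : SRing P) :
    x • algebraMap (SRing P) (SReg P) f = algebraMap _ _ (symAct P x.right f) :=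
  regAct_algebraMap P _ f

lemma ext_smul_wt (x : ExtWeyl P) (m : M) : x • wt P m = wt P (x.right • m) := by
  rw [wt, ext_smul_algebraMap, symAct_ι]; rfl

lemma ext_smul_const (x : ExtWeyl P) (c : ℂ) : x • const P c = const P c := by
  rw [const, ext_smul_algebraMap, AlgHom.commutes]

lemma rootInv_mul (k : ι) : rootInv P k * wt P (P.root k) = 1 := by
  have := IsLocalization.mk'_spec (SReg P) (1 : SRing P)
    (⟨rootS P k, Submonoid.subset_closure ⟨k, rfl⟩⟩ : rootMonoid P)
  rw [map_one] at this
  exact this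

lemma wt_mul_rootInv (k : ι) : wt P (P.root k) * rootInv P k = 1 := by
  rw [mul_comm, rootInv_mul]

/-- The sign ε is 1 when roots are transported by a group element and -1 when a root is replaced by
its opposite. -/
lemma ext_smul_rootInv {x : ExtWeyl P} {j k : ι} {ε : SReg P} (hε : ε * ε = 1)
    (h : x • wt P (P.root j) = ε * wt P (P.root k)) :
    x • rootInv P j = ε * rootInv P k := by
  have h1 : x • rootInv P j * x • wt P (P.root j) = 1 := by
    rw [← smul_mul', rootInv_mul, smul_one]
  calc x • rootInv P j = x • rootInv P j * (ε * ε * (wt P (P.root k) * rootInv P k)) := by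
        rw [hε, wt_mul_rootInv, mul_one, mul_one]
    _ = (x • rootInv P j * x • wt P (P.root j)) * (ε * rootInv P k) := by rw [h]; ring
    _ = _ := by rw [h1, one_mul]

variable [P.IsRootSystem]

instance : IsDomain (SRing P) :=
  ((SymmetricAlgebra.equivMvPolynomial (Module.Basis.ofVectorSpace ℂ M)).toMulEquiv).isDomain _

lemma sym_ι_injective : Function.Injective (SymmetricAlgebra.ι ℂ M) := by
  rw [injective_iff_map_eq_zero]
  intro m hm
  rw [← Module.forall_dual_apply_eq_zero_iff ℂ m]
  intro φ
  have h := SymmetricAlgebra.lift_ι_apply φ m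
  rwa [hm, map_zero, eq_comm] at h

lemma rootMonoid_le_nonZeroDivisors : rootMonoid P ≤ nonZeroDivisors (SRing P) := by
  rw [rootMonoid, Submonoid.closure_le]
  rintro _ ⟨k, rfl⟩
  refine mem_nonZeroDivisors_of_ne_zero fun h => P.ne_zero k ?_
  exact sym_ι_injective (h.trans (map_zero _).symm)

instance : IsDomain (SReg P) :=
  IsLocalization.isDomain_of_le_nonZeroDivisors (SReg P) (rootMonoid_le_nonZeroDivisors (P := P))

lemma wt_injective : Function.Injective (wt P) :=
  (IsLocalization.injective (SReg P) (rootMonoid_le_nonZeroDivisors (P := P))).comp sym_ι_injective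

end TwistedBasics

/-! ### Commutation of the generators A_j with S. -/

section NilGen

variable {ι M N : Type*} [AddCommGroup M] [Module ℂ M] [AddCommGroup N] [Module ℂ N]
  {P : RootPairing ι ℂ M N} [P.IsRootSystem] {b : P.Base} [Finite ι] [P.IsIrreducible]
  [P.IsCrystallographic]

lemma simpleReflection_right_smul (j : AffineNode b) (m : M) :
    (simpleReflection b j).right • m =
      m - P.toLinearMap m (P.coroot (nodeRoot b j)) • P.root (nodeRoot b j) :=
  congr_arg Prod.fst (simpleReflection_smul b j (m, 0))

lemma simpleReflection_smul_rootInv (j : AffineNode b) :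
    simpleReflection b j • rootInv P (nodeRoot b j) = -rootInv P (nodeRoot b j) := by
  rw [ext_smul_rootInv (ε := -1) (k := nodeRoot b j) (by ring), neg_one_mul]
  rw [ext_smul_wt, simpleReflection_right_smul, P.root_coroot_two, two_smul, neg_one_mul, ← wt_neg]
  congr 1
  abel

lemma grp_simpleReflection (j : AffineNode b) : grp P (simpleReflection b j) =
    1 - scalar P (wt P (P.root (nodeRoot b j))) * nilGen b j := by
  rw [nilGen, ← mul_assoc, scalar_mul, wt_mul_rootInv, scalar_one, one_mul, sub_sub_cancel]

lemma grp_mul_nilGen (j : AffineNode b) :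
    grp P (simpleReflection b j) * nilGen b j = nilGen b j := by
  rw [nilGen, ← mul_assoc, grp_mul_scalar, simpleReflection_smul_rootInv, mul_assoc, mul_sub,
    grp_mul, simpleReflection_sq, grp_one, mul_one, scalar_neg]
  noncomm_ring

lemma nilGen_mul_self (j : AffineNode b) : nilGen b j * nilGen b j = 0 := by
  conv_lhs => rw [nilGen, mul_assoc, ← nilGen, sub_mul, grp_mul_nilGen, one_mul, sub_self,
    mul_zero]

/-- The divided difference α⁻¹(m - s_j m), for α the root at node j, is the constant ⟨m, α^∨⟩. -/
lemma nilGen_mul_wt (j : AffineNode b) (m : M) :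
    nilGen b j * scalar P (wt P m) =
      scalar P (wt P ((simpleReflection b j).right • m)) * nilGen b j +
        scalar P (const P (P.toLinearMap m (P.coroot (nodeRoot b j)))) := by
  have h1 : rootInv P (nodeRoot b j) * wt P m = wt P ((simpleReflection b j).right • m) *
      rootInv P (nodeRoot b j) + const P (P.toLinearMap m (P.coroot (nodeRoot b j))) := by
    rw [simpleReflection_right_smul, wt_sub, wt_smul]
    linear_combination const P (P.toLinearMap m (P.coroot (nodeRoot b j))) *
      rootInv_mul (P := P) (nodeRoot b j)
  rw [nilGen, mul_assoc, sub_mul, grp_mul_scalar, one_mul, mul_sub, scalar_mul, h1, scalar_add,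
    ← mul_assoc, scalar_mul, ext_smul_wt, ← mul_assoc, scalar_mul, mul_sub,
    mul_comm (rootInv P _)]
  rw [mul_one]
  abel

lemma nilGen_mul_const (j : AffineNode b) (c : ℂ) :
    nilGen b j * scalar P (const P c) = scalar P (const P c) * nilGen b j := by
  rw [nilGen, mul_assoc, sub_mul, grp_mul_scalar, one_mul, ext_smul_const, ← mul_assoc,
    scalar_mul, mul_comm (const P c), ← scalar_mul, mul_assoc, mul_sub,
    mul_sub, mul_one, mul_sub]

/-- The nil-Hecke generators act as twisted derivations on the polynomial ring. -/
lemma exists_nilGen_mul_scalar (j : AffineNode b) (f : SRing P) : ∃ g : SRing P,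
    nilGen b j * scalar P (algebraMap (SRing P) (SReg P) f) =
      scalar P (algebraMap _ _ (symAct P (simpleReflection b j).right f)) * nilGen b j +
        scalar P (algebraMap _ _ g) := by
  induction f using SymmetricAlgebra.induction with
  | algebraMap c =>
    refine ⟨0, ?_⟩
    rw [AlgHom.commutes, map_zero, scalar_zero, add_zero]
    exact nilGen_mul_const j c
  | ι m =>
    refine ⟨algebraMap _ _ (P.toLinearMap m (P.coroot (nodeRoot b j))), ?_⟩
    rw [symAct_ι]
    exact nilGen_mul_wt j m
  | mul f g hf hg =>
    obtain ⟨f', hf'⟩ := hf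
    obtain ⟨g', hg'⟩ := hg
    refine ⟨symAct P (simpleReflection b j).right f * g' + f' * g, ?_⟩
    rw [map_mul, ← scalar_mul, ← mul_assoc, hf', add_mul, mul_assoc, hg', mul_add, ← mul_assoc]
    simp only [map_mul, map_add, scalar_add, scalar_mul]
    abel
  | add f g hf hg =>
    obtain ⟨f', hf'⟩ := hf
    obtain ⟨g', hg'⟩ := hg
    refine ⟨f' + g', ?_⟩
    simp only [map_add, scalar_add, mul_add, add_mul, hf', hg']
    abel

end NilGen

end AffineNilHecke

end

noncomputable section

namespace AffineNilHecke

/-! ### Alternating words and finite dihedral subgroups. -/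

section AlternatingWords

variable {G R J : Type*} [Group G] [MulAction G R]

/-- The last letter of the alternating word `i j i j …` with `n + 1` letters. -/
def altLast (i j : J) : ℕ → J
  | 0 => i
  | n + 1 => altLast j i n

lemma altWord_succ (i j : J) (n : ℕ) :
    altWord i j (n + 1) = altWord i j n ++ [altLast i j n] := by
  induction n generalizing i j with
  | zero => rfl
  | succ n ih => rw [altWord, ih]; rfl

variable {pos : R → Prop} {a : J → R} {s : J → G} (h : RootedGenerators pos a s)
include h

/-- The two alternating words are related by a power of the product of two generators. -/
lemma RootedGenerators.genProd_altWord (i j : J) (n : ℕ) :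
    genProd s (altWord i j n) = (s i * s j) ^ n * genProd s (altWord j i n) := by
  induction n generalizing i j with
  | zero => simp [altWord]
  | succ n ih =>
    have e : SemiconjBy (s i) (s j * s i) (s i * s j) := (mul_assoc _ _ _).symm
    rw [altWord, altWord, genProd_cons, genProd_cons, ih j i, ← mul_assoc, (e.pow_right n).eq,
      pow_succ, mul_assoc, mul_assoc, mul_assoc, h.mul_cancel]

/-- An element of a dihedral subgroup in which the two alternating words of some positive length
agree has finite order. -/
lemma RootedGenerators.exists_pow_eq_one (i j : J) {m : ℕ} (hm : 0 < m)
    (hb : genProd s (altWord i j m) = genProd s (altWord j i m)) {z : G}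
    (hz : z ∈ Subgroup.closure {s i, s j}) : ∃ n, 0 < n ∧ z ^ n = 1 := by
  have hr : (s i * s j) ^ m = 1 := by
    rw [h.genProd_altWord, mul_eq_right] at hb
    exact hb
  have hi : ∀ n : ℤ, s i * (s i * s j) ^ n = (s i * s j) ^ (-n) * s i := by
    intro n
    have : s i * (s i * s j) * (s i)⁻¹ = (s i * s j)⁻¹ := by
      rw [mul_inv_rev, h.inv, h.inv, h.mul_cancel]
    rw [zpow_neg, ← inv_zpow, ← this, conj_zpow]
    group
  -- Each element is a rotation (s_i s_j)^n, killed by the m-th power, or a rotation times s_i,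
  -- which squares to 1.
  have key : ∃ n : ℤ, z = (s i * s j) ^ n ∨ z = (s i * s j) ^ n * s i := by
    have hsi : ∀ z : G, (∃ n : ℤ, z = (s i * s j) ^ n ∨ z = (s i * s j) ^ n * s i) →
        ∃ n : ℤ, s i * z = (s i * s j) ^ n ∨ s i * z = (s i * s j) ^ n * s i := by
      rintro z ⟨n, rfl | rfl⟩
      · exact ⟨-n, Or.inr (hi n)⟩
      · exact ⟨-n, Or.inl (by rw [← mul_assoc, hi, h.mul_cancel_right])⟩
    have hsj : ∀ z : G, (∃ n : ℤ, z = (s i * s j) ^ n ∨ z = (s i * s j) ^ n * s i) →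
        ∃ n : ℤ, s j * z = (s i * s j) ^ n ∨ s j * z = (s i * s j) ^ n * s i := by
      intro z hz
      have e : s j * z = (s i * s j) ^ (-1 : ℤ) * (s i * z) := by
        rw [zpow_neg_one, mul_inv_rev, h.inv, h.inv, mul_assoc, h.mul_cancel]
      obtain ⟨n, hn | hn⟩ := hsi z hz
      · exact ⟨-1 + n, Or.inl (by rw [e, hn, ← zpow_add])⟩
      · exact ⟨-1 + n, Or.inr (by rw [e, hn, ← mul_assoc, ← zpow_add])⟩
    induction hz using Subgroup.closure_induction_left with
    | one => exact ⟨0, Or.inl (by simp)⟩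
    | mul_left x hx y hy ih =>
      rcases hx with rfl | rfl
      · exact hsi _ ih
      · exact hsj _ ih
    | inv_mul_cancel x hx y hy ih =>
      rcases hx with rfl | rfl
      · rw [h.inv]; exact hsi _ ih
      · rw [h.inv]; exact hsj _ ih
  obtain ⟨n, rfl | rfl⟩ := key
  · exact ⟨m, hm, by rw [← zpow_natCast, zpow_comm, zpow_natCast, hr, one_zpow]⟩
  · refine ⟨2, two_pos, ?_⟩
    rw [pow_two, mul_assoc, ← mul_assoc (s i), hi, mul_assoc, h.sq, mul_one, ← zpow_add]
    simp

end AlternatingWords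

/-! ### Braid relations for the generators A_j. -/

section Braid

variable {ι M N : Type*} [AddCommGroup M] [Module ℂ M] [AddCommGroup N] [Module ℂ N]
  {P : RootPairing ι ℂ M N} [P.IsRootSystem] {b : P.Base} [Finite ι] [P.IsIrreducible]
  [P.IsCrystallographic]

/-- The product of the nil-Hecke generators along a word. -/
def nilProd (b : P.Base) (l : List (AffineNode b)) : TwistedAlg P := (l.map (nilGen b)).prod

@[simp] lemma nilProd_nil : nilProd b [] = 1 := rfl

@[simp] lemma nilProd_cons (j : AffineNode b) (l : List (AffineNode b)) :
    nilProd b (j :: l) = nilGen b j * nilProd b l := by simp [nilProd]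

@[simp] lemma nilProd_append (l l' : List (AffineNode b)) :
    nilProd b (l ++ l') = nilProd b l * nilProd b l' := by simp [nilProd]

/-- The commutation of a product of nil-Hecke generators along an alternating word with a
weight. -/
lemma nilProd_altWord_mul_wt (i j : AffineNode b) (n : ℕ) (m : M) :
    nilProd b (altWord i j (n + 2)) * scalar P (wt P m) =
      scalar P (wt P ((genProd (simpleReflection b) (altWord i j (n + 2))).right • m)) *
          nilProd b (altWord i j (n + 2)) +
        scalar P (const P (P.toLinearMap
          ((genProd (simpleReflection b) (altWord j i (n + 1))).right • m)
            (P.coroot (nodeRoot b i)))) * nilProd b (altWord j i (n + 1)) +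
        scalar P (const P (P.toLinearMap m (P.coroot (nodeRoot b (altLast i j (n + 1)))))) *
          nilProd b (altWord i j (n + 1)) := by
  induction n generalizing i j with
  | zero =>
    simp only [altWord, nilProd_cons, nilProd_nil, mul_one, genProd_cons, genProd_nil, altLast]
    rw [mul_assoc, nilGen_mul_wt, mul_add, ← mul_assoc, nilGen_mul_wt, nilGen_mul_const]
    simp only [SemidirectProduct.mul_right, mul_smul, add_mul, mul_assoc]
  | succ n ih =>
    rw [altWord, nilProd_cons, mul_assoc, ih, mul_add, mul_add, ← mul_assoc (nilGen b i),
      nilGen_mul_wt, ← mul_assoc (nilGen b i), nilGen_mul_const, ← mul_assoc (nilGen b i),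
      nilGen_mul_const, mul_assoc (scalar P _) (nilGen b i) (nilProd b (altWord i j (n + 1)))]
    -- Deleting an inner letter leaves two equal neighbours, and A_i A_i = 0; only the deletions of
    -- the first and of the last letter survive.
    conv_lhs => enter [1, 2]; rw [altWord, nilProd_cons, ← mul_assoc (nilGen b i) (nilGen b i),
      nilGen_mul_self, zero_mul, mul_zero]
    simp only [genProd_cons, SemidirectProduct.mul_right, mul_smul, add_mul, mul_assoc, add_zero,
      altLast]
    rfl

/-- The sum of the coefficients. -/
def coeffSum (P : RootPairing ι ℂ M N) : TwistedAlg P →+ SReg P where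
  toFun a := a.sum fun _ f => f
  map_zero' := SkewMonoidAlgebra.sum_zero_index
  map_add' _ _ := SkewMonoidAlgebra.sum_add_index' (fun _ => rfl) (fun _ _ _ => rfl)

lemma coeffSum_single (x : ExtWeyl P) (f : SReg P) :
    coeffSum P (SkewMonoidAlgebra.single x f) = f :=
  SkewMonoidAlgebra.sum_single_index (h := fun _ f => f) rfl

lemma coeffSum_mul_grp (a : TwistedAlg P) (x : ExtWeyl P) :
    coeffSum P (a * grp P x) = coeffSum P a := by
  have : (coeffSum P).comp (AddMonoidHom.mulRight (grp P x)) = coeffSum P := by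
    refine SkewMonoidAlgebra.addHom_ext fun y f => ?_
    simp [grp, SkewMonoidAlgebra.single_mul_single, coeffSum_single]
  exact DFunLike.congr_fun this a

/-- Detects that an element ending in some A_j is zero once its support is known to be a single
point. -/
lemma coeffSum_mul_nilGen (a : TwistedAlg P) (j : AffineNode b) :
    coeffSum P (a * nilGen b j) = 0 := by
  rw [nilGen, ← mul_assoc, mul_sub, mul_one, map_sub, coeffSum_mul_grp, sub_self]

lemma coeff_nilGen_mul {H : Subgroup (ExtWeyl P)} {j : AffineNode b}
    (hj : simpleReflection b j ∈ H) {a : TwistedAlg P} (ha : ∀ x, x ∉ H → a.coeff x = 0)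
    (x : ExtWeyl P) (hx : x ∉ H) : (nilGen b j * a).coeff x = 0 := by
  rw [nilGen, mul_assoc, scalar, SkewMonoidAlgebra.coeff_single_one_mul, sub_mul, one_mul,
    SkewMonoidAlgebra.coeff_sub, grp]
  simp only [Finsupp.sub_apply, SkewMonoidAlgebra.coeff_single_mul]
  rw [ha x hx, ha _ fun h => hx ?_, smul_zero, mul_zero, sub_zero, mul_zero]
  simpa using mul_mem hj h

lemma coeff_nilProd_altWord (i j : AffineNode b) (n : ℕ) (x : ExtWeyl P)
    (hx : x ∉ Subgroup.closure {simpleReflection b i, simpleReflection b j}) :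
    (nilProd b (altWord i j n)).coeff x = 0 := by
  induction n generalizing i j x with
  | zero =>
    rw [altWord, nilProd_nil, SkewMonoidAlgebra.coeff_one]
    exact Finsupp.single_eq_of_ne (fun h => hx (h ▸ one_mem _))
  | succ n ih =>
    rw [altWord, nilProd_cons]
    refine coeff_nilGen_mul (Subgroup.subset_closure (by simp)) (fun y hy => ih j i y ?_) x hx
    rwa [Set.pair_comm]

/-- Nonzero translations have infinite order. Hence two elements of a group all of whose elements
have finite order coincide as soon as their finite parts do. -/
lemma eq_one_of_translation {z : ExtWeyl P} (hz : z.right = 1) {n : ℕ} (hn : 0 < n)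
    (h : z ^ n = 1) : z = 1 := by
  have key : ∀ (k : ℕ) (v : M × ℂ),
      z ^ k • v = (v.1, v.2 - k * P.toLinearMap v.1 (z.left.toAdd : N)) := by
    intro k v
    induction k with
    | zero => simp
    | succ k ih =>
      rw [pow_succ', mul_smul, ih, ext_smul_def, hz, one_smul]
      push_cast
      ext
      · rfl
      · ring
  apply extWeyl_ext
  intro v
  have h1 := congr_arg Prod.snd (key n v)
  rw [h, one_smul] at h1
  have h2 : P.toLinearMap v.1 (z.left.toAdd : N) = 0 := by
    have : (n : ℂ) * P.toLinearMap v.1 (z.left.toAdd : N) = 0 := by linear_combination h1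
    exact (mul_eq_zero.1 this).resolve_left (by exact_mod_cast hn.ne')
  rw [ext_smul_def, hz, one_smul, one_smul, h2, sub_zero]

variable [P.IsReduced]

/-- The common value of the two words is s_i x = x s_k, where x is the alternating word of n letters
starting with j and k is the letter that continues it. Reducedness gives xα_k > 0, and then xα_k =
α_i. This matches the lower terms in `nilProd_altWord_mul_wt`. -/
lemma coroot_altWord {i j : AffineNode b} {n : ℕ}
    (hb : genProd (simpleReflection b) (altWord i j (n + 1)) =
      genProd (simpleReflection b) (altWord j i (n + 1)))
    (hr : genLength (simpleReflection b) (genProd (simpleReflection b) (altWord i j (n + 1))) =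
      n + 1) (m : M) :
    P.toLinearMap ((genProd (simpleReflection b) (altWord j i n)).right • m)
      (P.coroot (nodeRoot b i)) =
    P.toLinearMap m (P.coroot (nodeRoot b (altLast j i n))) := by
  have hR := affine_rootedGenerators b
  set x := genProd (simpleReflection b) (altWord j i n) with hx
  have e1 : genProd (simpleReflection b) (altWord i j (n + 1)) = simpleReflection b i * x := by
    rw [altWord, genProd_cons]
  have e2 : genProd (simpleReflection b) (altWord i j (n + 1)) =
      x * simpleReflection b (altLast j i n) := by
    rw [hb, altWord_succ, genProd_append]; simp [hx]
  have hlen : genLength (simpleReflection b) x ≤ n := by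
    simpa using genLength_le (simpleReflection b) (altWord j i n)
  have h1 : IsPosAff b (x • simpleAffRoot b (altLast j i n)) := by
    by_contra hc
    have := hR.genLength_mul_of_not_pos ⟨_, rfl⟩ hc
    rw [← hx, ← e2, hr] at this
    omega
  have h2 : x • simpleAffRoot b (altLast j i n) = simpleAffRoot b i := by
    apply hR.eq_simple h1
    rw [← mul_smul, ← e1, e2, hR.pos_mul_simple, not_not]
    exact h1
  exact pairing_smul_coroot (congr_arg Prod.fst h2) m

/-- The braid relations for the nil-Hecke generators. -/
lemma nilProd_braid (i j : AffineNode b) (m : ℕ) (hij : i ≠ j)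
    (hb : genProd (simpleReflection b) (altWord i j m) =
      genProd (simpleReflection b) (altWord j i m))
    (hr : genLength (simpleReflection b) (genProd (simpleReflection b) (altWord i j m)) = m) :
    nilProd b (altWord i j m) = nilProd b (altWord j i m) := by
  have hR := affine_rootedGenerators b
  rcases m with _ | _ | n
  · rfl
  · simp only [altWord, genProd_cons, genProd_nil, mul_one] at hb
    exact absurd (simpleAffRoot_injective (hR.simple_injective hb)) hij
  -- The lower terms cancel in the difference D, so D μ = w(μ) D and every point of its support has
  -- the finite part of w. The support lies in a dihedral group of elements of finite order, so it
  -- is at most {w}.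
  set w := genProd (simpleReflection b) (altWord i j (n + 2)) with hw
  set D := nilProd b (altWord i j (n + 2)) - nilProd b (altWord j i (n + 2)) with hD
  have hcomm : ∀ μ : M, D * scalar P (wt P μ) = scalar P (wt P (w.right • μ)) * D := by
    intro μ
    rw [hD, sub_mul, nilProd_altWord_mul_wt, nilProd_altWord_mul_wt, ← hb, ← hw,
      coroot_altWord hb hr, coroot_altWord hb.symm (hb ▸ hr), mul_sub]
    abel
  have hsupp : ∀ x, x ≠ w → D.coeff x = 0 := by
    intro x hx
    by_contra hc
    have hH : ∀ {x}, D.coeff x ≠ 0 →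
        x ∈ Subgroup.closure {simpleReflection b i, simpleReflection b j} := by
      intro x hc
      by_contra hx
      apply hc
      rw [hD, SkewMonoidAlgebra.coeff_sub, Finsupp.sub_apply, coeff_nilProd_altWord i j _ _ hx,
        coeff_nilProd_altWord j i _ _ (by rwa [Set.pair_comm]), sub_zero]
    have hright : x.right = w.right := by
      apply weyl_ext
      intro μ
      have h1 := congr_arg (fun a => SkewMonoidAlgebra.coeff a x) (hcomm μ)
      simp only [scalar, SkewMonoidAlgebra.coeff_mul_single_one,
        SkewMonoidAlgebra.coeff_single_one_mul, ext_smul_wt] at h1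
      rw [mul_comm] at h1
      exact wt_injective (mul_right_cancel₀ hc h1)
    have hwH : w ∈ Subgroup.closure {simpleReflection b i, simpleReflection b j} := by
      have : ∀ (n : ℕ) (i j : AffineNode b), genProd (simpleReflection b) (altWord i j n) ∈
          Subgroup.closure {simpleReflection b i, simpleReflection b j} := by
        intro n
        induction n with
        | zero => intro i j; exact one_mem _
        | succ n ih =>
          intro i j
          rw [altWord, genProd_cons]
          refine mul_mem (Subgroup.subset_closure (by simp)) ?_
          rw [Set.pair_comm]
          exact ih j i
      exact this _ _ _
    obtain ⟨k, hk, hk'⟩ := hR.exists_pow_eq_one i j (Nat.succ_pos _) hb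
      (mul_mem (hH hc) (inv_mem hwH))
    have := eq_one_of_translation (by simp [hright]) hk hk'
    exact hx (mul_inv_eq_one.1 this)
  have hDs : D = SkewMonoidAlgebra.single w (D.coeff w) := by
    ext x
    by_cases hx : x = w
    · rw [hx]; simp
    · rw [hsupp x hx, SkewMonoidAlgebra.coeff_single, Finsupp.single_eq_of_ne hx]
  -- Now D = f ⊗ w, and f is the sum of the coefficients, which vanishes since both words end in a
  -- generator.
  have hzero : coeffSum P D = 0 := by
    rw [hD, map_sub, altWord_succ i, altWord_succ j, nilProd_append, nilProd_append]
    simp only [nilProd_cons, nilProd_nil, mul_one, coeffSum_mul_nilGen, sub_zero]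
  rw [hDs, coeffSum_single] at hzero
  rw [hzero, SkewMonoidAlgebra.single_zero] at hDs
  exact sub_eq_zero.1 hDs

end Braid

end AffineNilHecke

end

noncomputable section

namespace AffineNilHecke

/-! ### The elements A_w and the algebra they span. -/

section NilBasis

variable {ι M N : Type*} [AddCommGroup M] [Module ℂ M] [AddCommGroup N] [Module ℂ N]
  {P : RootPairing ι ℂ M N} [P.IsRootSystem] {b : P.Base} [Finite ι] [P.IsIrreducible]
  [P.IsCrystallographic] [P.IsReduced]

lemma exists_reduced_of_mem {x : ExtWeyl P} (hx : x ∈ affineWeyl P) :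
    ∃ l, genProd (simpleReflection b) l = x ∧ l.length = affLength b x :=
  exists_reduced _ ((mem_affineWeyl_iff_exists_word b x).1 hx)

lemma genProd_mem_affineWeyl (l : List (AffineNode b)) :
    genProd (simpleReflection b) l ∈ affineWeyl P :=
  (mem_affineWeyl_iff_exists_word b _).2 ⟨l, rfl⟩

/-- `A_w` can be computed from any reduced expression. -/
lemma nilAff_genProd {l : List (AffineNode b)}
    (hl : affLength b (genProd (simpleReflection b) l) = l.length) :
    nilAff b (genProd (simpleReflection b) l) = nilProd b l := by
  have h1 := Classical.epsilon_spec (p := fun l' : List (AffineNode b) =>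
    wordProd b l' = genProd (simpleReflection b) l ∧
      l'.length = affLength b (genProd (simpleReflection b) l)) ⟨l, rfl, hl.symm⟩
  exact (affine_rootedGenerators b).matsumoto (nilGen b)
    (fun i j m hij hb hr => nilProd_braid i j m hij hb hr) l.length _ _ (h1.2.trans hl) rfl h1.1
    ((congr_arg (genLength (simpleReflection b)) h1.1).trans hl)

lemma nilAff_one : nilAff b 1 = 1 :=
  nilAff_genProd (b := b) (l := []) (genLength_one _)

lemma nilGen_mul_nilAff_of_pos {x : ExtWeyl P} (hx : x ∈ affineWeyl P) {j : AffineNode b}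
    (hp : IsPosAff b (x⁻¹ • simpleAffRoot b j)) :
    nilGen b j * nilAff b x = nilAff b (simpleReflection b j * x) := by
  obtain ⟨l, rfl, hl⟩ := exists_reduced_of_mem (b := b) hx
  rw [← genProd_cons, nilAff_genProd hl.symm, nilAff_genProd, nilProd_cons]
  rw [genProd_cons, List.length_cons, hl]
  exact (affine_rootedGenerators b).genLength_simple_mul_of_pos ⟨l, rfl⟩ hp

lemma nilGen_mul_nilAff_of_not_pos {x : ExtWeyl P} (hx : x ∈ affineWeyl P) {j : AffineNode b}
    (hp : ¬ IsPosAff b (x⁻¹ • simpleAffRoot b j)) :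
    nilGen b j * nilAff b x = 0 := by
  have hR := affine_rootedGenerators b
  have h1 : IsPosAff b ((simpleReflection b j * x)⁻¹ • simpleAffRoot b j) := by
    rw [mul_inv_rev, hR.inv, hR.pos_mul_simple]
    exact hp
  have h2 := nilGen_mul_nilAff_of_pos (mul_mem (simpleReflection_mem_affineWeyl j) hx) h1
  rw [hR.mul_cancel] at h2
  rw [← h2, ← mul_assoc, nilGen_mul_self, zero_mul]

lemma nilAff_mul_nilGen_of_pos {x : ExtWeyl P} (hx : x ∈ affineWeyl P) {j : AffineNode b}
    (hp : IsPosAff b (x • simpleAffRoot b j)) :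
    nilAff b x * nilGen b j = nilAff b (x * simpleReflection b j) := by
  have hlen := affLength_mul_simple hx hp
  obtain ⟨l, rfl, hl⟩ := exists_reduced_of_mem (b := b) hx
  have e : genProd (simpleReflection b) l * simpleReflection b j =
      genProd (simpleReflection b) (l ++ [j]) := by simp
  rw [e] at hlen ⊢
  rw [nilAff_genProd hl.symm, nilAff_genProd, nilProd_append]
  · simp
  · rw [hlen, List.length_append, hl]; rfl

lemma nilAff_mul_nilGen_of_not_pos {x : ExtWeyl P} (hx : x ∈ affineWeyl P) {j : AffineNode b}
    (hp : ¬ IsPosAff b (x • simpleAffRoot b j)) :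
    nilAff b x * nilGen b j = 0 := by
  have hR := affine_rootedGenerators b
  have h1 : IsPosAff b ((x * simpleReflection b j) • simpleAffRoot b j) := by
    rw [hR.pos_mul_simple]
    exact hp
  have h2 := nilAff_mul_nilGen_of_pos (mul_mem hx (simpleReflection_mem_affineWeyl j)) h1
  rw [hR.mul_cancel_right] at h2
  rw [← h2, mul_assoc, nilGen_mul_self, mul_zero]

lemma nilAff_mul {x y : ExtWeyl P} (hx : x ∈ affineWeyl P) (hy : y ∈ affineWeyl P)
    (h : affLength b (x * y) = affLength b x + affLength b y) :
    nilAff b x * nilAff b y = nilAff b (x * y) := by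
  obtain ⟨l, rfl, hl⟩ := exists_reduced_of_mem (b := b) hx
  obtain ⟨l', rfl, hl'⟩ := exists_reduced_of_mem (b := b) hy
  rw [nilAff_genProd hl.symm, nilAff_genProd hl'.symm, ← nilProd_append, ← genProd_append,
    nilAff_genProd]
  rw [genProd_append, h, List.length_append, hl, hl']

lemma grp_mul_nilGen_of_smul {x : ExtWeyl P} {j k : AffineNode b}
    (h : x • simpleAffRoot b j = simpleAffRoot b k) :
    grp P x * nilGen b j = nilGen b k * grp P x := by
  have h1 : x • rootInv P (nodeRoot b j) = 1 * rootInv P (nodeRoot b k) := by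
    apply ext_smul_rootInv (one_mul 1)
    rw [ext_smul_wt, one_mul]
    exact congr_arg (wt P) (congr_arg Prod.fst h)
  rw [one_mul] at h1
  rw [nilGen, nilGen, ← mul_assoc, grp_mul_scalar, h1, mul_assoc, mul_assoc, mul_sub, sub_mul,
    grp_mul, grp_mul, conj_simpleReflection b x j k h, mul_one, one_mul]

/-- Conjugation by an element of length zero permutes the s_j and the A_j by the same permutation of
nodes. -/
lemma IsLengthZero.exists_map_word {x : ExtWeyl P} (hx : IsLengthZero b x)
    (l : List (AffineNode b)) : ∃ l', l'.length = l.length ∧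
      genProd (simpleReflection b) l' = x * genProd (simpleReflection b) l * x⁻¹ ∧
      grp P x * nilProd b l = nilProd b l' * grp P x := by
  induction l with
  | nil => exact ⟨[], rfl, by simp, by simp⟩
  | cons j l ih =>
    obtain ⟨l', h1, h2, h3⟩ := ih
    obtain ⟨k, hk⟩ := hx.exists_node j
    refine ⟨k :: l', by simp [h1], ?_, ?_⟩
    · rw [genProd_cons, genProd_cons, h2, ← mul_assoc, ← mul_assoc, ← mul_assoc,
        conj_simpleReflection b x j k hk]
    · rw [nilProd_cons, nilProd_cons, ← mul_assoc, grp_mul_nilGen_of_smul hk, mul_assoc, h3,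
        mul_assoc]

lemma IsLengthZero.affLength_conj {x v : ExtWeyl P} (hx : IsLengthZero b x)
    (hv : v ∈ affineWeyl P) : affLength b (x * v * x⁻¹) = affLength b v := by
  have key : ∀ {x v : ExtWeyl P}, IsLengthZero b x → v ∈ affineWeyl P →
      affLength b (x * v * x⁻¹) ≤ affLength b v := by
    intro x v hx hv
    obtain ⟨l, rfl, hl⟩ := exists_reduced_of_mem (b := b) hv
    obtain ⟨l', h1, h2, -⟩ := hx.exists_map_word l
    rw [← hl, ← h1, ← h2]
    exact genLength_le _ _
  refine le_antisymm (key hx hv) ?_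
  have := key hx.inv (affineWeyl_normal.conj_mem v hv x)
  simpa [mul_assoc] using this

lemma IsLengthZero.grp_mul_nilAff {x v : ExtWeyl P} (hx : IsLengthZero b x)
    (hv : v ∈ affineWeyl P) :
    grp P x * nilAff b v = nilAff b (x * v * x⁻¹) * grp P x := by
  have hlen := hx.affLength_conj hv
  obtain ⟨l, rfl, hl⟩ := exists_reduced_of_mem (b := b) hv
  obtain ⟨l', h1, h2, h3⟩ := hx.exists_map_word l
  rw [nilAff_genProd hl.symm, h3, ← h2, nilAff_genProd]
  rw [h2, hlen, h1, hl]

lemma nilExt_mul {x v : ExtWeyl P} (hx : IsLengthZero b x) (hv : v ∈ affineWeyl P) :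
    nilExt b (x * v) = grp P x * nilAff b v := by
  rw [nilExt, decomp_eq hx hv]

lemma isLengthZero_one : IsLengthZero b (1 : ExtWeyl P) := fun j => by
  rw [one_smul]; exact isPosAff_simpleAffRoot b j

lemma nilExt_of_mem {v : ExtWeyl P} (hv : v ∈ affineWeyl P) : nilExt b v = nilAff b v := by
  have := nilExt_mul (b := b) isLengthZero_one hv
  rwa [one_mul, grp_one, one_mul] at this

lemma IsLengthZero.grp_mul_nilExt {x : ExtWeyl P} (hx : IsLengthZero b x) (y : ExtWeyl P) :
    grp P x * nilExt b y = nilExt b (x * y) := by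
  obtain ⟨z, v, hz, hv, rfl⟩ := exists_eq_mul (b := b) y
  rw [nilExt_mul hz hv, ← mul_assoc, ← mul_assoc, grp_mul, nilExt_mul (hx.mul hz) hv]

lemma nilExt_mul_nilGen_of_pos {x : ExtWeyl P} {j : AffineNode b}
    (hp : IsPosAff b (x • simpleAffRoot b j)) :
    nilExt b x * nilGen b j = nilExt b (x * simpleReflection b j) := by
  obtain ⟨z, v, hz, hv, rfl⟩ := exists_eq_mul (b := b) x
  rw [mul_smul, hz.isPosAff_iff] at hp
  rw [nilExt_mul hz hv, mul_assoc, nilAff_mul_nilGen_of_pos hv hp, mul_assoc,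
    nilExt_mul hz (mul_mem hv (simpleReflection_mem_affineWeyl j))]

lemma nilExt_mul_nilGen_of_not_pos {x : ExtWeyl P} {j : AffineNode b}
    (hp : ¬ IsPosAff b (x • simpleAffRoot b j)) :
    nilExt b x * nilGen b j = 0 := by
  obtain ⟨z, v, hz, hv, rfl⟩ := exists_eq_mul (b := b) x
  rw [mul_smul, hz.isPosAff_iff] at hp
  rw [nilExt_mul hz hv, mul_assoc, nilAff_mul_nilGen_of_not_pos hv hp, mul_zero]

lemma nilExt_mem (x : ExtWeyl P) : nilExt b x ∈ nilHecke b :=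
  Submodule.subset_span ⟨x, rfl⟩

lemma nilHecke_scalar_mul {a : TwistedAlg P} (ha : a ∈ nilHecke b) (f : SRing P) :
    scalar P (algebraMap _ _ f) * a ∈ nilHecke b := by
  rw [← smul_eq_scalar_mul]
  exact Submodule.smul_mem _ _ ha

lemma nilGen_mul_nilExt_of_pos {x : ExtWeyl P} {j : AffineNode b}
    (hp : IsPosAff b (x⁻¹ • simpleAffRoot b j)) :
    nilGen b j * nilExt b x = nilExt b (simpleReflection b j * x) := by
  obtain ⟨z, v, hz, hv, rfl⟩ := exists_eq_mul (b := b) x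
  obtain ⟨k, hk⟩ := hz.inv.exists_node j
  have hk' : z • simpleAffRoot b k = simpleAffRoot b j := by rw [← hk, smul_inv_smul]
  rw [mul_inv_rev, mul_smul, hk] at hp
  rw [nilExt_mul hz hv, ← mul_assoc, ← grp_mul_nilGen_of_smul hk', mul_assoc,
    nilGen_mul_nilAff_of_pos hv hp, ← mul_assoc, ← conj_simpleReflection b z k j hk',
    mul_assoc, nilExt_mul hz (mul_mem (simpleReflection_mem_affineWeyl k) hv)]

lemma nilGen_mul_nilExt_of_not_pos {x : ExtWeyl P} {j : AffineNode b}
    (hp : ¬ IsPosAff b (x⁻¹ • simpleAffRoot b j)) : nilGen b j * nilExt b x = 0 := by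
  obtain ⟨z, v, hz, hv, rfl⟩ := exists_eq_mul (b := b) x
  obtain ⟨k, hk⟩ := hz.inv.exists_node j
  have hk' : z • simpleAffRoot b k = simpleAffRoot b j := by rw [← hk, smul_inv_smul]
  rw [mul_inv_rev, mul_smul, hk] at hp
  rw [nilExt_mul hz hv, ← mul_assoc, ← grp_mul_nilGen_of_smul hk', mul_assoc,
    nilGen_mul_nilAff_of_not_pos hv hp, mul_zero]

/-- By definition the span is only a left S-module. The twisted Leibniz rule
`exists_nilGen_mul_scalar` moves A_j past its coefficients without leaving S; closure under products
follows from this. -/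
lemma nilHecke_nilGen_mul (j : AffineNode b) {a : TwistedAlg P} (ha : a ∈ nilHecke b) :
    nilGen b j * a ∈ nilHecke b := by
  induction ha using Submodule.span_induction with
  | mem a h =>
    obtain ⟨x, rfl⟩ := h
    by_cases hp : IsPosAff b (x⁻¹ • simpleAffRoot b j)
    · rw [nilGen_mul_nilExt_of_pos hp]
      exact nilExt_mem _
    · rw [nilGen_mul_nilExt_of_not_pos hp]
      exact zero_mem _
  | zero => simp
  | add x y _ _ hx hy => rw [mul_add]; exact add_mem hx hy
  | smul f x hx hx' =>
    obtain ⟨g, hg⟩ := exists_nilGen_mul_scalar j f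
    rw [smul_eq_scalar_mul, ← mul_assoc, hg, add_mul, mul_assoc]
    exact add_mem (nilHecke_scalar_mul hx' _) (nilHecke_scalar_mul hx _)

lemma nilHecke_nilProd_mul (l : List (AffineNode b)) {a : TwistedAlg P} (ha : a ∈ nilHecke b) :
    nilProd b l * a ∈ nilHecke b := by
  induction l with
  | nil => simpa using ha
  | cons j l ih => rw [nilProd_cons, mul_assoc]; exact nilHecke_nilGen_mul j ih

lemma nilHecke_lengthZero_mul {z : ExtWeyl P} (hz : IsLengthZero b z) {a : TwistedAlg P}
    (ha : a ∈ nilHecke b) : grp P z * a ∈ nilHecke b := by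
  induction ha using Submodule.span_induction with
  | mem a h =>
    obtain ⟨x, rfl⟩ := h
    rw [hz.grp_mul_nilExt]
    exact nilExt_mem _
  | zero => simp
  | add x y _ _ hx hy => rw [mul_add]; exact add_mem hx hy
  | smul f x _ hx =>
    rw [smul_eq_scalar_mul, ← mul_assoc, grp_mul_scalar, ext_smul_algebraMap, mul_assoc]
    exact nilHecke_scalar_mul hx _

/-- A standard form of the basis elements. -/
lemma exists_nilExt_eq (x : ExtWeyl P) : ∃ z l, IsLengthZero b z ∧
    x = z * genProd (simpleReflection b) l ∧ nilExt b x = grp P z * nilProd b l := by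
  obtain ⟨z, v, hz, hv, rfl⟩ := exists_eq_mul (b := b) x
  obtain ⟨l, rfl, hl⟩ := exists_reduced_of_mem (b := b) hv
  exact ⟨z, l, hz, rfl, by rw [nilExt_mul hz hv, nilAff_genProd hl.symm]⟩

lemma nilHecke_mul_mem {a c : TwistedAlg P} (ha : a ∈ nilHecke b) (hc : c ∈ nilHecke b) :
    a * c ∈ nilHecke b := by
  induction ha using Submodule.span_induction with
  | mem a h =>
    obtain ⟨x, rfl⟩ := h
    obtain ⟨z, l, hz, -, h⟩ := exists_nilExt_eq (b := b) x
    rw [h, mul_assoc]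
    exact nilHecke_lengthZero_mul hz (nilHecke_nilProd_mul l hc)
  | zero => simp
  | add x y _ _ hx hy => rw [add_mul]; exact add_mem hx hy
  | smul f x _ hx => rw [smul_eq_scalar_mul, mul_assoc]; exact nilHecke_scalar_mul hx f

lemma one_mem_nilHecke : (1 : TwistedAlg P) ∈ nilHecke b := by
  have := nilExt_mem (b := b) (P := P) 1
  rwa [nilExt_of_mem (one_mem _), nilAff_one] at this

lemma scalar_mem_nilHecke (f : SRing P) : scalar P (algebraMap _ _ f) ∈ nilHecke b := by
  simpa using nilHecke_scalar_mul one_mem_nilHecke f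

lemma nilGen_mem_nilHecke (j : AffineNode b) : nilGen b j ∈ nilHecke b := by
  simpa using nilHecke_nilGen_mul j one_mem_nilHecke

/-- Because s_j = 1 - α A_j, with α the root at node j. -/
lemma grp_mem_nilHecke (x : ExtWeyl P) : grp P x ∈ nilHecke b := by
  obtain ⟨z, v, hz, hv, rfl⟩ := exists_eq_mul (b := b) x
  obtain ⟨l, rfl, -⟩ := exists_reduced_of_mem (b := b) hv
  rw [← grp_mul]
  apply nilHecke_lengthZero_mul hz
  induction l with
  | nil => exact one_mem_nilHecke
  | cons j l ih =>
    rw [genProd_cons, ← grp_mul]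
    refine nilHecke_mul_mem ?_ (ih (genProd_mem_affineWeyl l))
    rw [grp_simpleReflection]
    exact sub_mem one_mem_nilHecke (nilHecke_scalar_mul (nilGen_mem_nilHecke j) _)

end NilBasis

end AffineNilHecke

end

noncomputable section

namespace AffineNilHecke

/-! ### The projection onto the span of the translations. -/

section Projection

variable {ι M N : Type*} [AddCommGroup M] [Module ℂ M] [AddCommGroup N] [Module ℂ N]
  {P : RootPairing ι ℂ M N}

/-- The translation part of an element of the extended affine Weyl group. -/
def translationPart (x : ExtWeyl P) : ExtWeyl P := SemidirectProduct.inl x.left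

lemma translationPart_mul_ofWeyl (x : ExtWeyl P) (u : P.weylGroup) :
    translationPart (x * ofWeyl P u) = translationPart x := by
  simp [translationPart, ofWeyl]

lemma translationPart_mul_translationPart (x y : ExtWeyl P) :
    translationPart (x * translationPart y) = translationPart (x * y) := by
  simp [translationPart]

lemma translationPart_translationPart (x : ExtWeyl P) :
    translationPart (translationPart x) = translationPart x := rfl

lemma translationPart_eq (x : ExtWeyl P) :
    translationPart x = x * (ofWeyl P x.right)⁻¹ := by
  rw [eq_mul_inv_iff_mul_eq]
  exact SemidirectProduct.inl_left_mul_inr_right x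

lemma translationPart_smul (x : ExtWeyl P) (f : SReg P) : translationPart x • f = f :=
  one_smul (ExtWeyl P) f

lemma translationPart_comm (x y : ExtWeyl P) :
    translationPart x * translationPart y = translationPart y * translationPart x := by
  rw [translationPart, translationPart, ← map_mul, mul_comm, map_mul]

/-- The projection of the twisted group algebra onto the span of the translations. -/
def proj (P : RootPairing ι ℂ M N) : TwistedAlg P →+ TwistedAlg P :=
  SkewMonoidAlgebra.mapDomain translationPart

lemma proj_single (x : ExtWeyl P) (f : SReg P) :
    proj P (SkewMonoidAlgebra.single x f) = SkewMonoidAlgebra.single (translationPart x) f :=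
  SkewMonoidAlgebra.mapDomain_single

lemma proj_mul_grp_ofWeyl (a : TwistedAlg P) (u : P.weylGroup) :
    proj P (a * grp P (ofWeyl P u)) = proj P a := by
  have : (proj P).comp (AddMonoidHom.mulRight (grp P (ofWeyl P u))) = proj P := by
    refine SkewMonoidAlgebra.addHom_ext fun y f => ?_
    simp [grp, SkewMonoidAlgebra.single_mul_single, proj_single, translationPart_mul_ofWeyl]
  exact DFunLike.congr_fun this a

lemma proj_proj (a : TwistedAlg P) : proj P (proj P a) = proj P a := by
  have : (proj P).comp (proj P) = proj P := by
    refine SkewMonoidAlgebra.addHom_ext fun y f => ?_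
    simp [proj_single, translationPart_translationPart]
  exact DFunLike.congr_fun this a

lemma proj_scalar_mul (f : SReg P) (a : TwistedAlg P) :
    proj P (scalar P f * a) = scalar P f * proj P a := by
  have : (proj P).comp (AddMonoidHom.mulLeft (scalar P f)) =
      (AddMonoidHom.mulLeft (scalar P f)).comp (proj P) := by
    refine SkewMonoidAlgebra.addHom_ext fun y g => ?_
    simp [scalar, SkewMonoidAlgebra.single_mul_single, proj_single]
  exact DFunLike.congr_fun this a

lemma proj_mul_scalar (a : TwistedAlg P) (f : SReg P) :
    proj P a * scalar P f = scalar P f * proj P a := by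
  have : (AddMonoidHom.mulRight (scalar P f)).comp (proj P) =
      (AddMonoidHom.mulLeft (scalar P f)).comp (proj P) := by
    refine SkewMonoidAlgebra.addHom_ext fun y g => ?_
    simp [scalar, SkewMonoidAlgebra.single_mul_single, proj_single, translationPart_smul, mul_comm]
  exact DFunLike.congr_fun this a

/-- The elements x t_λ w and x t_λ have the same translation part, so a finite factor on the far
right is invisible to `proj`. -/
lemma proj_mul_proj (a c : TwistedAlg P) : proj P (a * proj P c) = proj P (a * c) := by
  have : (AddMonoidHom.mul.compr₂ (proj P)).compl₂ (proj P) =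
      (AddMonoidHom.mul (R := TwistedAlg P)).compr₂ (proj P) := by
    refine SkewMonoidAlgebra.addHom_ext fun x f => ?_
    refine SkewMonoidAlgebra.addHom_ext fun y g => ?_
    simp [SkewMonoidAlgebra.single_mul_single, proj_single, translationPart_mul_translationPart]
  exact DFunLike.congr_fun (DFunLike.congr_fun this a) c

/-- Translations commute with each other and, at level zero, act trivially on S^reg. -/
lemma proj_mul_comm (a c : TwistedAlg P) : proj P a * proj P c = proj P c * proj P a := by
  have : ((AddMonoidHom.mul (R := TwistedAlg P)).compl₂ (proj P)).comp (proj P) =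
      ((AddMonoidHom.mul (R := TwistedAlg P)).flip.compl₂ (proj P)).comp (proj P) := by
    refine SkewMonoidAlgebra.addHom_ext fun x f => ?_
    refine SkewMonoidAlgebra.addHom_ext fun y g => ?_
    simp [SkewMonoidAlgebra.single_mul_single, proj_single, translationPart_smul,
      translationPart_comm x y, mul_comm f g]
  exact DFunLike.congr_fun (DFunLike.congr_fun this a) c

/-- The projection of `x p` for `p` supported on the translations. -/
lemma proj_grp_mul_proj (x : ExtWeyl P) (a : TwistedAlg P) :
    proj P (grp P x * proj P a) = grp P x * proj P a * grp P (ofWeyl P x.right)⁻¹ := by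
  have : (proj P).comp ((AddMonoidHom.mulLeft (grp P x)).comp (proj P)) =
      (AddMonoidHom.mulRight (grp P (ofWeyl P x.right)⁻¹)).comp
        ((AddMonoidHom.mulLeft (grp P x)).comp (proj P)) := by
    refine SkewMonoidAlgebra.addHom_ext fun y g => ?_
    simp only [AddMonoidHom.comp_apply, proj_single, AddMonoidHom.coe_mulLeft,
      AddMonoidHom.coe_mulRight, grp, SkewMonoidAlgebra.single_mul_single, translationPart_eq
      (x * translationPart y)]
    simp [translationPart]
  exact DFunLike.congr_fun this a

/-- The projection is linear for right multiplication by Weyl invariant elements supported on the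
translations. -/
lemma proj_mul_of_invariant {p : TwistedAlg P} (hp : proj P p = p)
    (hW : ∀ u, grp P (ofWeyl P u) * p = p * grp P (ofWeyl P u)) (a : TwistedAlg P) :
    proj P (a * p) = proj P a * p := by
  -- For x = t w, invariance of p gives x p = t p w, and `proj` discards w.
  have h1 : ∀ (x : ExtWeyl P), grp P x * p = grp P (translationPart x) * p * grp P (ofWeyl P x.right)
      := by
    intro x
    rw [mul_assoc, ← hW, ← mul_assoc, grp_mul, translationPart_eq, inv_mul_cancel_right]
  have h2 : ∀ x : ExtWeyl P, proj P (grp P (translationPart x) * p) =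
      grp P (translationPart x) * p := by
    intro x
    have h := proj_grp_mul_proj (translationPart x) p
    have h' : (ofWeyl P (translationPart x).right)⁻¹ = 1 := by
      simp [translationPart]
    rwa [hp, h', grp_one, mul_one] at h
  have : (proj P).comp (AddMonoidHom.mulRight p) = (AddMonoidHom.mulRight p).comp (proj P) := by
    refine SkewMonoidAlgebra.addHom_ext fun x f => ?_
    simp only [AddMonoidHom.comp_apply, proj_single, AddMonoidHom.coe_mulRight]
    rw [single_eq, single_eq, mul_assoc, proj_scalar_mul, h1, proj_mul_grp_ofWeyl, h2, mul_assoc]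
  exact DFunLike.congr_fun this a

variable [P.IsRootSystem]

/-- Elements commuting with the weights are supported on the translations. -/
lemma proj_eq_self {a : TwistedAlg P}
    (ha : ∀ m, a * scalar P (wt P m) = scalar P (wt P m) * a) : proj P a = a := by
  -- At a point x of the support, x(μ) a_x = μ a_x; cancelling a_x shows that the finite part of x
  -- fixes every weight.
  have h1 : ∀ x, a.coeff x ≠ 0 → translationPart x = x := by
    intro x hx
    have h : x.right = 1 := by
      apply weyl_ext
      intro μ
      have h1 := congr_arg (fun a => SkewMonoidAlgebra.coeff a x) (ha μ)
      simp only [scalar, SkewMonoidAlgebra.coeff_mul_single_one,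
        SkewMonoidAlgebra.coeff_single_one_mul, ext_smul_wt] at h1
      rw [mul_comm] at h1
      rw [one_smul]
      exact wt_injective (mul_right_cancel₀ hx h1)
    rw [translationPart_eq, h, map_one, inv_one, mul_one]
  conv_rhs => rw [← a.sum_single]
  rw [proj, SkewMonoidAlgebra.mapDomain]
  change a.sum _ = _
  rw [SkewMonoidAlgebra.sum_def, SkewMonoidAlgebra.sum_def]
  refine Finset.sum_congr rfl fun x hx => ?_
  change SkewMonoidAlgebra.single (translationPart x) _ = _
  rw [h1 x (Finsupp.mem_support_iff.1 hx)]

end Projection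

/-! ### Existence and uniqueness of the elements j_w. -/

section Schubert

variable {ι M N : Type*} [AddCommGroup M] [Module ℂ M] [AddCommGroup N] [Module ℂ N]
  {P : RootPairing ι ℂ M N} [P.IsRootSystem] (b : P.Base) [Finite ι] [P.IsIrreducible]
  [P.IsCrystallographic] [P.IsReduced]

/-- The span of the `A_v` with `v` not affine Grassmannian. -/
def nonGrassSpan : Submodule (SRing P) (TwistedAlg P) :=
  Submodule.span (SRing P) (nilExt b '' (extGrassmannian b)ᶜ)

variable {b}

lemma nonGrassSpan_le : nonGrassSpan b ≤ nilHecke b :=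
  Submodule.span_mono (Set.image_subset_range _ _)

lemma nilExt_mul_nilGen_mem (x : ExtWeyl P) (j : b.support) :
    nilExt b x * nilGen b (some j) ∈ nonGrassSpan b := by
  by_cases hp : IsPosAff b (x • simpleAffRoot b (some j))
  · rw [nilExt_mul_nilGen_of_pos hp]
    refine Submodule.subset_span ⟨_, fun h => ?_, rfl⟩
    exact ((affine_rootedGenerators b).pos_mul_simple x (some j)).1
      ((mem_extGrassmannian_iff _).1 h j) hp
  · rw [nilExt_mul_nilGen_of_not_pos hp]
    exact zero_mem _

lemma mul_nilGen_mem {a : TwistedAlg P} (ha : a ∈ nilHecke b) (j : b.support) :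
    a * nilGen b (some j) ∈ nonGrassSpan b := by
  induction ha using Submodule.span_induction with
  | mem a h => obtain ⟨x, rfl⟩ := h; exact nilExt_mul_nilGen_mem x j
  | zero => simp
  | add x y _ _ hx hy => rw [add_mul]; exact add_mem hx hy
  | smul f x _ hx => 
    rw [smul_eq_scalar_mul, mul_assoc, ← smul_eq_scalar_mul]
    exact Submodule.smul_mem _ _ hx

/-- A finite descent j of x gives x = y s_j with length increasing from y to x. The right factor A_j
is what makes the span a left ideal and what `proj` kills. -/
lemma exists_eq_mul_nilGen {x : ExtWeyl P} (hx : x ∉ extGrassmannian b) :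
    ∃ (y : ExtWeyl P) (j : b.support), nilExt b x = nilExt b y * nilGen b (some j) := by
  rw [mem_extGrassmannian_iff, KeepsFinite] at hx
  push Not at hx
  obtain ⟨j, hj⟩ := hx
  refine ⟨x * simpleReflection b (some j), j, ?_⟩
  rw [nilExt_mul_nilGen_of_pos, (affine_rootedGenerators b).mul_cancel_right]
  rwa [(affine_rootedGenerators b).pos_mul_simple]

/-- The span of the `A_v` with `v` not affine Grassmannian is a left ideal. -/
lemma nonGrassSpan_mul_mem {a c : TwistedAlg P} (ha : a ∈ nilHecke b) (hc : c ∈ nonGrassSpan b) :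
    a * c ∈ nonGrassSpan b := by
  induction hc using Submodule.span_induction generalizing a with
  | mem c h =>
    obtain ⟨x, hx, rfl⟩ := h
    obtain ⟨y, k, h⟩ := exists_eq_mul_nilGen hx
    rw [h, ← mul_assoc]
    exact mul_nilGen_mem (nilHecke_mul_mem ha (nilExt_mem y)) k
  | zero => simp
  | add x y _ _ hx hy => rw [mul_add]; exact add_mem (hx ha) (hy ha)
  | smul f x _ hx =>
    rw [smul_eq_scalar_mul, ← mul_assoc]
    exact hx (nilHecke_mul_mem ha (scalar_mem_nilHecke f))

/-- Since s_j = 1 - α_j A_j, right multiplication by W is trivial modulo the left ideal. -/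
lemma mul_grp_sub_mem {a : TwistedAlg P} (ha : a ∈ nilHecke b) (u : P.weylGroup) :
    a * grp P (ofWeyl P u) - a ∈ nonGrassSpan b := by
  obtain ⟨l, rfl⟩ := exists_finite_word b u
  induction l using List.reverseRecOn with
  | nil => simp [grp_one]
  | append_singleton l j ih =>
    set v := genProd (fun j : b.support => RootPairing.weylGroup.ofIdx P (j : ι)) l with hv
    have h1 : genProd (fun j : b.support => RootPairing.weylGroup.ofIdx P (j : ι)) (l ++ [j]) =
        v * RootPairing.weylGroup.ofIdx P (j : ι) := by simp [hv]
    have h2 : ofWeyl P (v * RootPairing.weylGroup.ofIdx P (j : ι)) =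
        ofWeyl P v * simpleReflection b (some j) := map_mul _ _ _
    rw [h1, h2, ← grp_mul, grp_simpleReflection, ← mul_assoc, mul_sub, mul_one, sub_right_comm]
    refine sub_mem ih ?_
    rw [← mul_assoc]
    exact mul_nilGen_mem (nilHecke_mul_mem (nilHecke_mul_mem ha (grp_mem_nilHecke _))
      (scalar_mem_nilHecke _)) j

lemma nonGrassSpan_mul_grp {a : TwistedAlg P} (ha : a ∈ nonGrassSpan b) (u : P.weylGroup) :
    a * grp P (ofWeyl P u) ∈ nonGrassSpan b := by
  simpa using add_mem (mul_grp_sub_mem (nonGrassSpan_le ha) u) ha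

lemma proj_mul_nilGen (a : TwistedAlg P) (j : b.support) :
    proj P (a * nilGen b (some j)) = 0 := by
  rw [nilGen, ← mul_assoc, mul_sub, mul_one, map_sub]
  rw [simpleReflection, proj_mul_grp_ofWeyl, sub_self]

lemma proj_of_mem_nonGrassSpan {a : TwistedAlg P} (ha : a ∈ nonGrassSpan b) : proj P a = 0 := by
  induction ha using Submodule.span_induction with
  | mem a h =>
    obtain ⟨x, hx, rfl⟩ := h
    obtain ⟨y, k, h⟩ := exists_eq_mul_nilGen hx
    rw [h, proj_mul_nilGen]
  | zero => simp
  | add x y _ _ hx hy => rw [map_add, hx, hy, add_zero]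
  | smul f x _ hx => rw [smul_eq_scalar_mul, proj_scalar_mul, hx, mul_zero]

lemma ofIdx_neg (k : ι) : RootPairing.weylGroup.ofIdx P (P.reflectionPerm k k) =
    RootPairing.weylGroup.ofIdx P k := by
  apply weyl_ext
  intro m
  rw [ofIdx_smul_apply, ofIdx_smul_apply, root_neg, coroot_neg, map_neg, neg_smul_neg]

lemma simpleReflection_right (j : AffineNode b) : (simpleReflection b j).right =
    RootPairing.weylGroup.ofIdx P (nodeRoot b j) := by
  apply weyl_ext
  intro m
  rw [simpleReflection_right_smul, ofIdx_smul_apply]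

/-- The divided difference element attached to a root. -/
def rootNil (P : RootPairing ι ℂ M N) (k : ι) : TwistedAlg P :=
  scalar P (rootInv P k) * (1 - grp P (ofWeyl P (RootPairing.weylGroup.ofIdx P k)))

lemma grp_mul_rootNil {u : P.weylGroup} {j k : ι} (h : u • P.root j = P.root k) :
    grp P (ofWeyl P u) * rootNil P j = rootNil P k * grp P (ofWeyl P u) := by
  have h1 : ofWeyl P u • rootInv P j = 1 * rootInv P k := by
    apply ext_smul_rootInv (one_mul 1)
    rw [ext_smul_wt, one_mul]
    exact congr_arg (wt P) h
  rw [one_mul] at h1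
  rw [rootNil, rootNil, ← mul_assoc, grp_mul_scalar, h1, mul_assoc, mul_assoc, mul_sub, sub_mul,
    grp_mul, grp_mul, ← map_mul, ← map_mul, conj_ofIdx h, mul_one, one_mul]

lemma rootNil_neg (k : ι) : rootNil P (P.reflectionPerm k k) = -rootNil P k := by
  have h1 : (1 : ExtWeyl P) • rootInv P (P.reflectionPerm k k) = -1 * rootInv P k := by
    apply ext_smul_rootInv (by ring)
    rw [one_smul, root_neg, wt_neg, neg_one_mul]
  rw [one_smul, neg_one_mul] at h1
  rw [rootNil, rootNil, h1, ofIdx_neg, scalar_neg, neg_mul]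

/-- For a simple root this is A_j. The other roots are reached by sign changes and conjugation by W,
both of which preserve the ideal. -/
lemma rootNil_mem (k : ι) : rootNil P k ∈ nonGrassSpan b := by
  refine b.induction_reflect (p := fun k => rootNil P k ∈ nonGrassSpan b) k (fun k hk => ?_) (fun j hj => ?_) fun k j hk hj => ?_
  · rw [rootNil_neg]
    exact neg_mem hk
  · have := mul_nilGen_mem (one_mem_nilHecke (b := b) (P := P)) ⟨j, hj⟩
    rwa [one_mul] at this
  · have h := grp_mul_rootNil (ofIdx_smul_root (P := P) j k)
    rw [← mul_one (rootNil P (P.reflectionPerm j k)), ← grp_one, ← mul_inv_cancel (ofWeyl P _),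
      ← grp_mul, ← mul_assoc, ← h, ← map_inv]
    exact nonGrassSpan_mul_grp (nonGrassSpan_mul_mem (grp_mem_nilHecke _) hk) _

/-- The projection of a product with a nil-Hecke generator. -/
lemma proj_nilGen_mul_proj (j : AffineNode b) (a : TwistedAlg P) :
    proj P (nilGen b j * proj P a) = nilGen b j * proj P a -
      grp P (simpleReflection b j) * proj P a * rootNil P (nodeRoot b j) := by
  have h1 : (ofWeyl P (simpleReflection b j).right)⁻¹ =
      ofWeyl P (RootPairing.weylGroup.ofIdx P (nodeRoot b j)) := by
    rw [simpleReflection_right, ← map_inv, inv_eq_of_mul_eq_one_right (ofIdx_sq _)]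
  -- With p = `proj` a and α the root at node j, p commutes with α⁻¹ while s_j changes its sign.
  -- Subtracting s_j p α⁻¹(1 - s_α) from α⁻¹(p - s_j p) therefore leaves α⁻¹(p - s_j p s_α).
  have h2 : grp P (simpleReflection b j) * proj P a * scalar P (rootInv P (nodeRoot b j)) =
      -(scalar P (rootInv P (nodeRoot b j)) * (grp P (simpleReflection b j) * proj P a)) := by
    rw [mul_assoc, proj_mul_scalar, ← mul_assoc, grp_mul_scalar, simpleReflection_smul_rootInv,
      scalar_neg, neg_mul, neg_mul, mul_assoc]
  rw [rootNil, ← mul_assoc, h2, nilGen, mul_assoc, proj_scalar_mul, sub_mul, one_mul, map_sub,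
    proj_proj, proj_grp_mul_proj, h1]
  noncomm_ring

/-- The two claims go together: the correction term s_j p · `rootNil` lies in the left ideal because
p is already known to lie in the nil-Hecke algebra, that is, to have coefficients in S on the A_w.
-/
lemma proj_nilProd (l : List (AffineNode b)) : proj P (nilProd b l) ∈ nilHecke b ∧
    proj P (nilProd b l) - nilProd b l ∈ nonGrassSpan b := by
  induction l with
  | nil =>
    have : proj P (1 : TwistedAlg P) = 1 := proj_single 1 1
    rw [nilProd_nil, this, sub_self]
    exact ⟨one_mem_nilHecke, zero_mem _⟩
  | cons j l ih =>
    have h1 : grp P (simpleReflection b j) * proj P (nilProd b l) *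
        rootNil P (nodeRoot b j) ∈ nonGrassSpan b :=
      nonGrassSpan_mul_mem (nilHecke_mul_mem (grp_mem_nilHecke _) ih.1) (rootNil_mem _)
    rw [nilProd_cons, ← proj_mul_proj, proj_nilGen_mul_proj]
    refine ⟨sub_mem (nilHecke_nilGen_mul j ih.1) (nonGrassSpan_le h1), ?_⟩
    rw [sub_right_comm, ← mul_sub]
    exact sub_mem (nonGrassSpan_mul_mem (nilGen_mem_nilHecke j) ih.2) h1

lemma proj_nilExt (x : ExtWeyl P) : proj P (nilExt b x) ∈ nilHecke b ∧
    proj P (nilExt b x) - nilExt b x ∈ nonGrassSpan b := by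
  obtain ⟨z, l, -, -, h⟩ := exists_nilExt_eq (b := b) x
  obtain ⟨h1, h2⟩ := proj_nilProd l
  have h3 : grp P z * proj P (nilProd b l) ∈ nilHecke b :=
    nilHecke_mul_mem (grp_mem_nilHecke z) h1
  have h4 := mul_grp_sub_mem h3 z.right⁻¹
  rw [h, ← proj_mul_proj, proj_grp_mul_proj, ← map_inv]
  refine ⟨nilHecke_mul_mem h3 (grp_mem_nilHecke _), ?_⟩
  rw [← sub_add_sub_cancel _ (grp P z * proj P (nilProd b l)), ← mul_sub]
  exact add_mem h4 (nonGrassSpan_mul_mem (grp_mem_nilHecke z) h2)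

lemma isSchubert_proj (w : ExtWeyl P) : IsSchubert b w (proj P (nilExt b w)) :=
  ⟨⟨(proj_nilExt w).1, fun _ => proj_mul_scalar _ _⟩, (proj_nilExt w).2⟩

/-- `proj` fixes a and kills a - A_w. -/
lemma IsSchubert.eq_proj {w : ExtWeyl P} {a : TwistedAlg P} (ha : IsSchubert b w a) :
    a = proj P (nilExt b w) := by
  have h1 := proj_of_mem_nonGrassSpan ha.2
  rw [map_sub, sub_eq_zero, proj_eq_self (fun m => ha.1.2 _)] at h1
  exact h1

lemma existsUnique_isSchubert (w : ExtWeyl P) : ∃! a, IsSchubert b w a :=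
  ⟨_, isSchubert_proj w, fun _ h => h.eq_proj⟩

lemma jElt_eq (w : ExtWeyl P) : jElt b w = proj P (nilExt b w) :=
  (Classical.epsilon_spec (existsUnique_isSchubert w).exists).eq_proj

end Schubert

end AffineNilHecke

end

noncomputable section

namespace AffineNilHecke

/-! ### Weyl invariance at -ϖ_i^∨ and the factorization. -/

section Factorization

variable {ι M N : Type*} [AddCommGroup M] [Module ℂ M] [AddCommGroup N] [Module ℂ N]
  {P : RootPairing ι ℂ M N} [P.IsRootSystem] {b : P.Base} [Finite ι] [P.IsIrreducible]
  [P.IsCrystallographic] [P.IsReduced]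

lemma translation_neg_smul_of_ne {i j : b.support} (h : j ≠ i) :
    translation P (-fundCoweight b (some i)) • simpleAffRoot b (some j) =
      simpleAffRoot b (some j) := by
  classical
  rw [translation_neg_smul_simple, if_neg h]
  rfl

/-- So s_i is a left descent of the translation by -ϖ_i^∨. -/
lemma not_isPosAff_translation_neg_inv_smul (i : b.support) :
    ¬ IsPosAff b ((translation P (-fundCoweight b (some i)))⁻¹ • simpleAffRoot b (some i)) := by
  classical
  have h : (translation P (-fundCoweight b (some i)))⁻¹ • simpleAffRoot b (some i) =
      (P.root i, ((-1 : ℤ) : ℂ)) := by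
    rw [inv_smul_eq_iff, translation_smul]
    simp only [simpleAffRoot, nodeRoot, nodeLevel, AddSubgroup.coe_neg, map_neg,
      pairing_root_fundCoweight, if_true]
    simp
  rw [h, isPosAff_iff]
  omega

/-- For p supported on translations, `proj` (A_j p) = α_j⁻¹(p - s_j p s_j). -/
lemma grp_simpleReflection_comm {p : TwistedAlg P} (hp : proj P p = p) {j : b.support}
    (h : proj P (nilGen b (some j) * p) = 0) :
    grp P (simpleReflection b (some j)) * p = p * grp P (simpleReflection b (some j)) := by
  have h1 := proj_grp_mul_proj (simpleReflection b (some j)) p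
  have h2 : ofWeyl P (simpleReflection b (some j)).right = simpleReflection b (some j) := rfl
  rw [hp, h2] at h1
  rw [nilGen, mul_assoc, proj_scalar_mul, sub_mul, one_mul, map_sub, hp, h1] at h
  have h3 := congr_arg (scalar P (wt P (P.root (nodeRoot b (some j)))) * ·) h
  simp only [mul_zero] at h3
  rw [← mul_assoc, scalar_mul, wt_mul_rootInv, scalar_one, one_mul, sub_eq_zero] at h3
  conv_rhs => rw [h3]
  rw [mul_assoc, grp_mul, inv_mul_cancel, grp_one, mul_one]

lemma grp_ofWeyl_comm {p : TwistedAlg P} (hp : proj P p = p)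
    (h : ∀ j : b.support, proj P (nilGen b (some j) * p) = 0) (u : P.weylGroup) :
    grp P (ofWeyl P u) * p = p * grp P (ofWeyl P u) := by
  obtain ⟨l, rfl⟩ := exists_finite_word b u
  induction l with
  | nil => simp [grp_one]
  | cons j l ih =>
    have h1 : grp P (ofWeyl P (RootPairing.weylGroup.ofIdx P (j : ι))) * p =
        p * grp P (ofWeyl P (RootPairing.weylGroup.ofIdx P (j : ι))) :=
      grp_simpleReflection_comm hp (h j)
    rw [genProd_cons, map_mul, ← grp_mul, mul_assoc, ih, ← mul_assoc, h1, mul_assoc]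

/-- The projection of the basis element of the translation by `-ϖ_i^∨` is invariant under the
Weyl group. -/
lemma grp_comm_proj_nilExt_translation (i : b.support) (u : P.weylGroup) :
    grp P (ofWeyl P u) * proj P (nilExt b (translation P (-fundCoweight b (some i)))) =
      proj P (nilExt b (translation P (-fundCoweight b (some i)))) * grp P (ofWeyl P u) := by
  refine grp_ofWeyl_comm (b := b) (proj_proj _) (fun j => ?_) u
  rw [proj_mul_proj]
  -- For y = t_{-ϖ_i^∨}: A_i A_y = 0 by the left descent, while for j ≠ i the reflection s_j
  -- commutes with y, so A_j A_y = A_y A_j is killed by `proj`.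
  by_cases h : j = i
  · rw [h, nilGen_mul_nilExt_of_not_pos (not_isPosAff_translation_neg_inv_smul i), map_zero]
  · have h1 := translation_neg_smul_of_ne h
    rw [nilGen_mul_nilExt_of_pos, ← conj_simpleReflection b _ _ _ h1, ← nilExt_mul_nilGen_of_pos,
      proj_mul_nilGen]
    · rw [h1]; exact isPosAff_simpleAffRoot b _
    · rw [← h1, inv_smul_smul]; exact isPosAff_simpleAffRoot b _

lemma bar_mem_affineWeyl (i : b.support) {v : ExtWeyl P} (hv : v ∈ affineWeyl P) :
    bar b i v ∈ affineWeyl P := by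
  have := affineWeyl_normal.conj_mem v hv (piElt b (specialNode b i))⁻¹
  rwa [inv_inv] at this

lemma mul_kappa (i : b.support) (v : ExtWeyl P) : v * kappa b i =
    piElt b (specialNode b i) * (bar b i v * translation P (-fundCoweight b (some i))) := by
  simp [kappa, bar, mul_assoc]

/-- For j ≠ i the translation by -ϖ_i^∨ fixes α_j, so v̄ inherits positivity from v κ_i. For j = i
let α_k = π_{i^s} α_i: if v̄α_i were negative, s_k would shorten v on the right, and it always
shortens κ_i on the left, so ℓ(v κ_i) would be at most ℓ(v) + ℓ(κ_i) - 2. -/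
lemma bar_mem_affGrassmannian (i : b.support) {v : ExtWeyl P} (hv : v ∈ affineWeyl P)
    (hκ : v * kappa b i ∈ affGrassmannian b)
    (hlen : affLength b (v * kappa b i) = affLength b v + affLength b (kappa b i)) :
    bar b i v ∈ affGrassmannian b := by
  have hπ := isLengthZero_piElt_specialNode i
  refine (mem_affGrassmannian_iff _).2 ⟨bar_mem_affineWeyl i hv, fun j => ?_⟩
  by_cases h : j = i
  · subst h
    by_contra hc
    obtain ⟨k, hk⟩ := hπ.exists_node (some j)
    have h1 : ¬ IsPosAff b (v • simpleAffRoot b k) := by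
      rw [← hπ.isPosAff_iff] at hc
      rwa [bar, mul_smul, mul_smul, smul_inv_smul, hk] at hc
    have h2 : ¬ IsPosAff b ((kappa b j)⁻¹ • simpleAffRoot b k) := by
      rw [kappa, mul_inv_rev, mul_smul, ← hk, inv_smul_smul]
      exact not_isPosAff_translation_neg_inv_smul j
    have hR := affine_rootedGenerators b
    have hκ' := (mem_affineWeyl_iff_exists_word b _).1 (kappa_mem_affineWeyl j)
    have hv' := (mem_affineWeyl_iff_exists_word b _).1 hv
    have h3 := affLength_mul_simple' hv h1
    have h4 : affLength b (simpleReflection b k * kappa b j) + 1 = affLength b (kappa b j) :=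
      hR.genLength_simple_mul_of_not_pos hκ' h2
    have h5 : affLength b (v * simpleReflection b k * (simpleReflection b k * kappa b j)) ≤
        affLength b (v * simpleReflection b k) + affLength b (simpleReflection b k * kappa b j) :=
      genLength_mul_le _ (RootedGenerators.isGen_mul hv' (RootedGenerators.isGen_simple k))
        (RootedGenerators.isGen_mul (RootedGenerators.isGen_simple k) hκ')
    rw [mul_assoc, hR.mul_cancel] at h5
    omega
  · have h1 := ((mem_affGrassmannian_iff _).1 hκ).2 j
    rwa [mul_kappa, mul_smul, hπ.isPosAff_iff, mul_smul, translation_neg_smul_of_ne h] at h1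

lemma jElt_mul_kappa (i : b.support) {v : ExtWeyl P} (hv : v ∈ affineWeyl P)
    (hlen : affLength b (v * kappa b i) = affLength b v + affLength b (kappa b i)) :
    jElt b (v * kappa b i) =
      conj P (uElt b (specialNode b i)) (jElt b (bar b i v)) * jElt b (kappa b i) := by
  have hπ := isLengthZero_piElt_specialNode i
  have hκ := kappa_mem_affineWeyl i
  have hbar := bar_mem_affineWeyl i hv
  set π := piElt b (specialNode b i) with hπ'
  set u := uElt b (specialNode b i) with hu
  set y := translation P (-fundCoweight b (some i)) with hy
  set q := proj P (nilExt b y) with hq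
  have hκy : nilAff b (kappa b i) = grp P π * nilExt b y := by
    rw [hπ.grp_mul_nilExt, ← nilExt_of_mem hκ]; rfl
  have hvb : nilAff b v * grp P π = grp P π * nilAff b (bar b i v) := by
    rw [hπ.grp_mul_nilAff hbar]
    congr 2
    simp [bar, ← hπ', mul_assoc]
  have h1 : nilExt b (v * kappa b i) = grp P π * (nilAff b (bar b i v) * nilExt b y) := by
    rw [nilExt_of_mem (mul_mem hv hκ), ← nilAff_mul hv hκ hlen, hκy, ← mul_assoc, hvb, mul_assoc]
  -- Inside `proj` the factor A_y may be replaced by q, which then comes out by Weyl invariance.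
  have h2 : proj P (nilAff b (bar b i v) * nilExt b y) = proj P (nilAff b (bar b i v)) * q := by
    rw [← proj_mul_proj]
    exact proj_mul_of_invariant (proj_proj _) (grp_comm_proj_nilExt_translation i) _
  have hr : π.right = u := piElt_right _
  have h3 : jElt b (kappa b i) = grp P π * q * grp P (ofWeyl P u)⁻¹ := by
    rw [jElt_eq, nilExt_of_mem hκ, hκy, ← proj_mul_proj, proj_grp_mul_proj, hr]
  have h4 : jElt b (v * kappa b i) =
      grp P π * (proj P (nilAff b (bar b i v)) * q) * grp P (ofWeyl P u)⁻¹ := by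
    rw [jElt_eq, h1, ← proj_mul_proj, proj_grp_mul_proj, hr, h2]
  -- Conjugation by u keeps j_v̄ supported on translations, so it commutes with the translation part
  -- of π.
  have h5 : conj P u (proj P (nilAff b (bar b i v))) * grp P (translationPart π) =
      grp P (translationPart π) * conj P u (proj P (nilAff b (bar b i v))) := by
    have e1 : conj P u (proj P (nilAff b (bar b i v))) =
        proj P (grp P (ofWeyl P u) * proj P (nilAff b (bar b i v))) :=
      (proj_grp_mul_proj (ofWeyl P u) _).symm
    have e2 : grp P (translationPart π) = proj P (grp P π) := (proj_single π 1).symm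
    rw [e1, e2, proj_mul_comm]
  have h6 : grp P π = grp P (translationPart π) * grp P (ofWeyl P u) := by
    rw [grp_mul, translationPart_eq, hr, inv_mul_cancel_right]
  have h7 : conj P u (proj P (nilAff b (bar b i v))) * grp P (ofWeyl P u) =
      grp P (ofWeyl P u) * proj P (nilAff b (bar b i v)) := by
    rw [conj, mul_assoc, grp_mul, inv_mul_cancel, grp_one, mul_one]
  rw [h4, h3, jElt_eq, nilExt_of_mem hbar, ← mul_assoc (conj _ _ _), h6, ← mul_assoc (conj _ _ _),
    ← mul_assoc (conj _ _ _), h5, mul_assoc (grp P (translationPart π)) (conj _ _ _), h7]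
  simp only [mul_assoc]

end Factorization

end AffineNilHecke

end

/-- Factorization of the Schubert class of `v κ_i` in the extended Peterson algebra. The first
four clauses say that `i^s`, `u_{i^s}`, `κ_i` and the Schubert basis are well defined. -/
theorem mainTheorem9 {ι M N : Type*} [Finite ι] [AddCommGroup M] [Module ℂ M]
    [AddCommGroup N] [Module ℂ N] (P : RootPairing ι ℂ M N)
    [P.IsRootSystem] [P.IsCrystallographic] [P.IsReduced] [P.IsIrreducible]
    (b : P.Base) (i : b.support) :
    (∃! s, IsSpecialFor b i s) ∧
    (∃! u, IsShortestAntidominant b (specialNode b i) u) ∧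
    kappa b i ∈ affGrassmannian b ∧
    (∀ w ∈ extGrassmannian b, ∃! a, IsSchubert b w a) ∧
    ∀ v ∈ affineWeyl P,
      v * kappa b i ∈ affGrassmannian b →
      affLength b (v * kappa b i) = affLength b v + affLength b (kappa b i) →
        bar b i v ∈ affGrassmannian b ∧
        jElt b (v * kappa b i) =
          conj P (uElt b (specialNode b i)) (jElt b (bar b i v)) * jElt b (kappa b i) := by
  exact ⟨existsUnique_isSpecialFor i, existsUnique_isShortestAntidominant _,
    kappa_mem_affGrassmannian i, fun w _ => existsUnique_isSchubert w, fun v hv hκ hlen =>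
    ⟨bar_mem_affGrassmannian i hv hκ hlen, jElt_mul_kappa i hv hlen⟩⟩
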